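/- Let $H\in\mathbb R^{m\times n}$, $U=[\mu_1\cdots\mu_N]\in\mathbb R^{n\times N}$, let $C_x\in\mathbb R^{n\times n}$ and $C_w\in\mathbb R^{m\times m}$ be symmetric positive definite, and let $\nu_x>n+1$, $\nu_w>m+1$ be real. For $\nu$ and $C\succ0$ let $\mathcal W^{-1}(C,\nu)$ denote the inverse-Wishart law, with density proportional to $|P|^{-(\nu+d+1)/2}e^{-\frac12\operatorname{tr}(CP^{-1})}$ on positive definite $d\times d$ matrices $P$. Consider the model in which $P\sim\mathcal W^{-1}(C_x,\nu_x)$ and $R\sim\mathcal W^{-1}(C_w,\nu_w)$ are independent, the columns of $X\in\mathbb R^{n\times N}$ are conditionally independent with $x_t\mid P\sim\mathcal N(\mu_t,P)$, and the columns of $Y\in\mathbb R^{m\times N}$ are conditionally independent with $y_t\mid X,R\sim\mathcal N(Hx_t,R)$. Fix $Y$, let $p(X,P,R\mid Y)$ be the posterior law, and put $\gamma'_x=\nu_x+N$, $\gamma'_w=\nu_w+N$. For probability laws $q_X,q_P,q_R$ let $$F(q_X,q_P,q_R)=\mathrm{KL}\bigl(q_X\otimes q_P\otimes q_R\,\big\|\,p(X,P,R\mid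 Y)\bigr)\in[0,\infty].$$ For $V\in\mathbb R^{n\times n}$, $W\in\mathbb R^{m\times m}$ put $$\widetilde P=(H^\top WH+V)^{-1},\qquad \widetilde U=(H^\top WH+V)^{-1}(H^\top WY+VU).$$ (1) *Optimal factors.* In each case, suppose that the two fixed factors are probability laws and that $F$ is finite for at least one choice of the remaining factor. Then the expectations below are finite, and: (a) given $q_P,q_R$, with $V=\mathbb E_{q_P}[P^{-1}]$ and $W=\mathbb E_{q_R}[R^{-1}]$, the unique minimizer of $F$ over $q_X$ is the law of a matrix with independent columns distributed as $\mathcal N([\widetilde U]_t,\widetilde P)$, $t=1,\dots,N$, and $\widetilde U$ is the unique mode of this law; (b) given $q_X,q_R$, the unique minimizer over $q_P$ is $\mathcal W^{-1}\bigl(C_x+\mathbb E_{q_X}[(X-U)(X-U)^\top],\gamma'_x\bigr)$; (c) given $q_X,q_P$, the unique minimizer over $q_R$ is $\mathcal W^{-1}\bigl(C_w+\mathbb E_{q_X}[(Y-HX)(Y-HX)^\top],\gamma'_w\bigr)$. (2) *Mean-field optimum.* There is a triple $(q_X,q_P,q_R)$ that minimizes $F$ over all triples of probability laws. For every such triple,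 with $V=\mathbb E_{q_P}[P^{-1}]$, $W=\mathbb E_{q_R}[R^{-1}]$ and $\widetilde U,\widetilde P$ as above, all expectations involved are finite, $q_X$ is the law of a matrix with independent columns $\mathcal N([\widetilde U]_t,\widetilde P)$, $q_P=\mathcal W^{-1}(\widetilde C_x,\gamma'_x)$ and $q_R=\mathcal W^{-1}(\widetilde C_w,\gamma'_w)$, where $\widetilde P,\widetilde C_x,\widetilde C_w$ are positive definite and $$\begin{aligned}\widetilde C_x&=C_x+\mathbb E_{q_X}[(X-U)(X-U)^\top]=C_x+N\widetilde P+\widetilde U\widetilde U^\top-\widetilde UU^\top-U\widetilde U^\top+UU^\top,\\ \widetilde C_w&=C_w+\mathbb E_{q_X}[(Y-HX)(Y-HX)^\top]\\&=C_w+YY^\top-Y\widetilde U^\top H^\top-H\widetilde UY^\top+NH\widetilde PH^\top+H\widetilde U\widetilde U^\top H^\top.\end{aligned}$$ Moreover $V=\gamma'_x\widetilde C_x^{-1}$ and $W=\gamma'_w\widetilde C_w^{-1}$, and the unique maximizer $\widehat X_{\mathrm{vmap}}$ of the density of $q_X$ is $$\widehat X_{\mathrm{vmap}}=\widetilde U=(\gamma'_wH^\top\widetilde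 C_w^{-1}H+\gamma'_x\widetilde C_x^{-1})^{-1}(\gamma'_wH^\top\widetilde C_w^{-1}Y+\gamma'_x\widetilde C_x^{-1}U).\tag{$*$}$$ (3) *Iteration.* Start with $\widetilde C_x^{(0)}=C_x$, $\widetilde C_w^{(0)}=C_w$. For $k\ge0$ let $\widehat X^{(k)}$ be the right-hand side of $(*)$ and $\widetilde P^{(k)}=(\gamma'_wH^\top\widetilde C_w^{-1}H+\gamma'_x\widetilde C_x^{-1})^{-1}$, both evaluated at $\widetilde C_x^{(k)},\widetilde C_w^{(k)}$, and let $\widetilde C_x^{(k+1)},\widetilde C_w^{(k+1)}$ be given by the explicit formulas of (2) with $\widetilde U=\widehat X^{(k)}$, $\widetilde P=\widetilde P^{(k)}$. Then all $\widetilde C_x^{(k)},\widetilde C_w^{(k)},\widetilde P^{(k)}$ are positive definite. Put $q_P^{(k)}=\mathcal W^{-1}(\widetilde C_x^{(k)},\gamma'_x)$ and $q_R^{(k)}=\mathcal W^{-1}(\widetilde C_w^{(k)},\gamma'_w)$, and let $q_X^{(k)}$ be the law of a matrix with independent columns $\mathcal N([\widehat X^{(k)}]_t,\widetilde P^{(k)})$.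 Then $\mathbb E_{q_P^{(k)}}[P^{-1}]=\gamma'_x(\widetilde C_x^{(k)})^{-1}$ and $\mathbb E_{q_R^{(k)}}[R^{-1}]=\gamma'_w(\widetilde C_w^{(k)})^{-1}$. Further, $q_X^{(k)}$ is the unique minimizer of $F(\cdot,q_P^{(k)},q_R^{(k)})$ and $\widehat X^{(k)}$ is its unique mode, $q_P^{(k+1)}$ is the unique minimizer of $F(q_X^{(k)},\cdot,q_R^{(k)})$, and $q_R^{(k+1)}$ is the unique minimizer of $F(q_X^{(k)},q_P^{(k+1)},\cdot)$. -/

import Mathlib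

open MeasureTheory ProbabilityTheory Matrix
open scoped ENNReal

/-- The product (equivalently, Borel) σ-algebra on real matrices. -/
instance realMatrixMeasurableSpace {a b : ℕ} : MeasurableSpace (Matrix (Fin a) (Fin b) ℝ) :=
  inferInstanceAs (MeasurableSpace (Fin a → Fin b → ℝ))

noncomputable section

/-- Lebesgue measure on the space of real `a × b` matrices. -/
def matrixLebesgue (a b : ℕ) : Measure (Matrix (Fin a) (Fin b) ℝ) :=
  (volume : Measure (Fin a → Fin b → ℝ)).map (fun v => Matrix.of v)

/-- The symmetric matrix whose entries on and above the diagonal are prescribed. -/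
def symFill {n : ℕ} (v : {p : Fin n × Fin n // p.1 ≤ p.2} → ℝ) : Matrix (Fin n) (Fin n) ℝ :=
  Matrix.of fun i j => v ⟨(min i j, max i j), min_le_max⟩

/-- Lebesgue measure on the cone of positive definite matrices: the product of the Lebesgue
measures of the `n (n + 1) / 2` entries on and above the diagonal. -/
def posDefLebesgue (n : ℕ) : Measure (Matrix (Fin n) (Fin n) ℝ) :=
  ((volume : Measure ({p : Fin n × Fin n // p.1 ≤ p.2} → ℝ)).map symFill).restrict
    {P | P.PosDef}

/-- Density of `𝒩(μ, S)` on `ℝⁿ`, for `S` positive definite. -/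
def gaussianDensity {n : ℕ} (μ : Fin n → ℝ) (S : Matrix (Fin n) (Fin n) ℝ) (x : Fin n → ℝ) : ℝ :=
  (2 * Real.pi) ^ (-(n : ℝ) / 2) * S.det ^ (-(1 : ℝ) / 2) *
    Real.exp (-(1 / 2) * ((x - μ) ⬝ᵥ (S⁻¹ *ᵥ (x - μ))))

/-- Unnormalised density `|P|^{-(ν+n+1)/2} exp(-tr(C P⁻¹)/2)` of the inverse-Wishart law. -/
def invWishartKernel {n : ℕ} (C : Matrix (Fin n) (Fin n) ℝ) (ν : ℝ)
    (P : Matrix (Fin n) (Fin n) ℝ) : ℝ :=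
  P.det ^ (-(ν + n + 1) / 2) * Real.exp (-(1 / 2) * (C * P⁻¹).trace)

/-- Density of the inverse-Wishart law `𝒲⁻¹(C, ν)` on positive definite matrices. -/
def invWishartDensity {n : ℕ} (C : Matrix (Fin n) (Fin n) ℝ) (ν : ℝ)
    (P : Matrix (Fin n) (Fin n) ℝ) : ℝ :=
  (∫ Q, invWishartKernel C ν Q ∂(posDefLebesgue n))⁻¹ * invWishartKernel C ν P

/-- The inverse-Wishart law `𝒲⁻¹(C, ν)`. -/
def invWishart {n : ℕ} (C : Matrix (Fin n) (Fin n) ℝ) (ν : ℝ) :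
    Measure (Matrix (Fin n) (Fin n) ℝ) :=
  (posDefLebesgue n).withDensity fun P => ENNReal.ofReal (invWishartDensity C ν P)

/-- The law of an `n × N` random matrix with independent columns, the `t`-th of which is
Gaussian with mean the `t`-th column of `M` and covariance `S`. -/
def columnGaussian {n N : ℕ} (M : Matrix (Fin n) (Fin N) ℝ) (S : Matrix (Fin n) (Fin n) ℝ) :
    Measure (Matrix (Fin n) (Fin N) ℝ) :=
  (Measure.pi fun t : Fin N => multivariateGaussian (WithLp.toLp 2 fun i => M i t) S).map
    fun z => Matrix.of fun i t => z t i

/-- `q` has a continuous Lebesgue density, and `M` is the unique maximiser of that density. -/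
def IsUniqueMode {n N : ℕ} (q : Measure (Matrix (Fin n) (Fin N) ℝ))
    (M : Matrix (Fin n) (Fin N) ℝ) : Prop :=
  ∃ f : Matrix (Fin n) (Fin N) ℝ → ℝ, Continuous f ∧ (∀ X, 0 ≤ f X) ∧
    q = (matrixLebesgue n N).withDensity (fun X => ENNReal.ofReal (f X)) ∧
    ∀ X, X ≠ M → f X < f M

/-- Entrywise expectation of a matrix-valued function. -/
def matrixExpect {α : Type*} [MeasurableSpace α] {a b : ℕ} (q : Measure α)
    (F : α → Matrix (Fin a) (Fin b) ℝ) : Matrix (Fin a) (Fin b) ℝ :=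
  Matrix.of fun i j => ∫ x, F x i j ∂q

/-- All entries of a matrix-valued function are integrable. -/
def MatrixIntegrable {α : Type*} [MeasurableSpace α] {a b : ℕ} (q : Measure α)
    (F : α → Matrix (Fin a) (Fin b) ℝ) : Prop :=
  ∀ i j, Integrable (fun x => F x i j) q

/-- The data of the model `Y = H X + W`: the observation matrix `H`, the prior means `U` (as
columns), the inverse-Wishart parameters, and the observation `Y`. -/
structure LinearModel (n m N : ℕ) where
  H : Matrix (Fin m) (Fin n) ℝ
  U : Matrix (Fin n) (Fin N) ℝ
  Cx : Matrix (Fin n) (Fin n) ℝ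
  Cw : Matrix (Fin m) (Fin m) ℝ
  νx : ℝ
  νw : ℝ
  Y : Matrix (Fin m) (Fin N) ℝ

namespace LinearModel

variable {n m N : ℕ} (d : LinearModel n m N)

/-- `γ'_x = ν_x + N`. -/
def γx : ℝ := d.νx + N

/-- `γ'_w = ν_w + N`. -/
def γw : ℝ := d.νw + N

/-- The joint density `p(X, P, R, Y) = p(Y | X, R) p(X | P) p(P) p(R)`, where, independently
over the columns, `x_t | P ∼ 𝒩(u_t, P)` and `y_t | x_t, R ∼ 𝒩(H x_t, R)`. -/
def jointDensity (X : Matrix (Fin n) (Fin N) ℝ) (P : Matrix (Fin n) (Fin n) ℝ)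
    (R : Matrix (Fin m) (Fin m) ℝ) : ℝ :=
  (∏ t, gaussianDensity ((d.H * X).col t) R (d.Y.col t)) *
    (∏ t, gaussianDensity (d.U.col t) P (X.col t)) *
    invWishartDensity d.Cx d.νx P * invWishartDensity d.Cw d.νw R

/-- The measure with density `(X, P, R) ↦ p(X, P, R, Y)`, for the observed `Y`. -/
def jointMeasure : Measure (Matrix (Fin n) (Fin N) ℝ × Matrix (Fin n) (Fin n) ℝ ×
    Matrix (Fin m) (Fin m) ℝ) :=
  ((matrixLebesgue n N).prod ((posDefLebesgue n).prod (posDefLebesgue m))).withDensity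
    fun z => ENNReal.ofReal (d.jointDensity z.1 z.2.1 z.2.2)

/-- The posterior law `p(X, P, R | Y)`, by Bayes' rule. -/
def posterior : Measure (Matrix (Fin n) (Fin N) ℝ × Matrix (Fin n) (Fin n) ℝ ×
    Matrix (Fin m) (Fin m) ℝ) :=
  (d.jointMeasure Set.univ)⁻¹ • d.jointMeasure

/-- The Kullback-Leibler divergence `KL(q(X) q(P) q(R) ‖ p(X, P, R | Y))`. -/
def meanFieldKL (qX : Measure (Matrix (Fin n) (Fin N) ℝ)) (qP : Measure (Matrix (Fin n) (Fin n) ℝ))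
    (qR : Measure (Matrix (Fin m) (Fin m) ℝ)) : ℝ≥0∞ :=
  InformationTheory.klDiv (qX.prod (qP.prod qR)) d.posterior

/-- `q(X) q(P) q(R)` minimises the divergence to the posterior among all products of
probability measures. -/
def IsMeanFieldOptimal (qX : Measure (Matrix (Fin n) (Fin N) ℝ))
    (qP : Measure (Matrix (Fin n) (Fin n) ℝ)) (qR : Measure (Matrix (Fin m) (Fin m) ℝ)) : Prop :=
  IsProbabilityMeasure qX ∧ IsProbabilityMeasure qP ∧ IsProbabilityMeasure qR ∧
    ∀ (rX : Measure (Matrix (Fin n) (Fin N) ℝ)) (rP : Measure (Matrix (Fin n) (Fin n) ℝ))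
      (rR : Measure (Matrix (Fin m) (Fin m) ℝ)), IsProbabilityMeasure rX →
      IsProbabilityMeasure rP → IsProbabilityMeasure rR →
      d.meanFieldKL qX qP qR ≤ d.meanFieldKL rX rP rR

/-- `qX` is an optimal first factor when the other two are `qP` and `qR`. -/
def IsOptimalX (qX : Measure (Matrix (Fin n) (Fin N) ℝ))
    (qP : Measure (Matrix (Fin n) (Fin n) ℝ)) (qR : Measure (Matrix (Fin m) (Fin m) ℝ)) : Prop :=
  IsProbabilityMeasure qX ∧ ∀ r : Measure (Matrix (Fin n) (Fin N) ℝ), IsProbabilityMeasure r →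
    d.meanFieldKL qX qP qR ≤ d.meanFieldKL r qP qR

/-- `qP` is an optimal second factor when the other two are `qX` and `qR`. -/
def IsOptimalP (qX : Measure (Matrix (Fin n) (Fin N) ℝ))
    (qP : Measure (Matrix (Fin n) (Fin n) ℝ)) (qR : Measure (Matrix (Fin m) (Fin m) ℝ)) : Prop :=
  IsProbabilityMeasure qP ∧ ∀ r : Measure (Matrix (Fin n) (Fin n) ℝ), IsProbabilityMeasure r →
    d.meanFieldKL qX qP qR ≤ d.meanFieldKL qX r qR

/-- `qR` is an optimal third factor when the other two are `qX` and `qP`. -/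
def IsOptimalR (qX : Measure (Matrix (Fin n) (Fin N) ℝ))
    (qP : Measure (Matrix (Fin n) (Fin n) ℝ)) (qR : Measure (Matrix (Fin m) (Fin m) ℝ)) : Prop :=
  IsProbabilityMeasure qR ∧ ∀ r : Measure (Matrix (Fin m) (Fin m) ℝ), IsProbabilityMeasure r →
    d.meanFieldKL qX qP qR ≤ d.meanFieldKL qX qP r

/-- `P̃ = (Hᵀ W H + V)⁻¹`, where `V = E[P⁻¹]` and `W = E[R⁻¹]`. -/
def tildeP (V : Matrix (Fin n) (Fin n) ℝ) (W : Matrix (Fin m) (Fin m) ℝ) :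
    Matrix (Fin n) (Fin n) ℝ :=
  (d.Hᵀ * W * d.H + V)⁻¹

/-- `Ũ = (Hᵀ W H + V)⁻¹ (Hᵀ W Y + V U)`, where `V = E[P⁻¹]` and `W = E[R⁻¹]`. -/
def tildeU (V : Matrix (Fin n) (Fin n) ℝ) (W : Matrix (Fin m) (Fin m) ℝ) :
    Matrix (Fin n) (Fin N) ℝ :=
  (d.Hᵀ * W * d.H + V)⁻¹ * (d.Hᵀ * W * d.Y + V * d.U)

/-- `C̃_x = C_x + N P̃ + Ũ Ũᵀ - Ũ Uᵀ - U Ũᵀ + U Uᵀ`. -/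
def tildeCx (U' : Matrix (Fin n) (Fin N) ℝ) (P' : Matrix (Fin n) (Fin n) ℝ) :
    Matrix (Fin n) (Fin n) ℝ :=
  d.Cx + (N : ℝ) • P' + U' * U'ᵀ - U' * d.Uᵀ - d.U * U'ᵀ + d.U * d.Uᵀ

/-- `C̃_w = C_w + Y Yᵀ - Y Ũᵀ Hᵀ - H Ũ Yᵀ + N H P̃ Hᵀ + H Ũ Ũᵀ Hᵀ`. -/
def tildeCw (U' : Matrix (Fin n) (Fin N) ℝ) (P' : Matrix (Fin n) (Fin n) ℝ) :
    Matrix (Fin m) (Fin m) ℝ :=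
  d.Cw + d.Y * d.Yᵀ - d.Y * U'ᵀ * d.Hᵀ - d.H * U' * d.Yᵀ + (N : ℝ) • (d.H * P' * d.Hᵀ) +
    d.H * U' * U'ᵀ * d.Hᵀ

/-- `(γ'_w Hᵀ C̃_w⁻¹ H + γ'_x C̃_x⁻¹)⁻¹`. -/
def vmapCov (A : Matrix (Fin n) (Fin n) ℝ) (B : Matrix (Fin m) (Fin m) ℝ) :
    Matrix (Fin n) (Fin n) ℝ :=
  (d.γw • (d.Hᵀ * B⁻¹ * d.H) + d.γx • A⁻¹)⁻¹

/-- `(γ'_w Hᵀ C̃_w⁻¹ H + γ'_x C̃_x⁻¹)⁻¹ (γ'_w Hᵀ C̃_w⁻¹ Y + γ'_x C̃_x⁻¹ U)`. -/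
def vmapEstimate (A : Matrix (Fin n) (Fin n) ℝ) (B : Matrix (Fin m) (Fin m) ℝ) :
    Matrix (Fin n) (Fin N) ℝ :=
  (d.γw • (d.Hᵀ * B⁻¹ * d.H) + d.γx • A⁻¹)⁻¹ *
    (d.γw • (d.Hᵀ * B⁻¹ * d.Y) + d.γx • (A⁻¹ * d.U))

/-- The scale matrices `(C̃_x, C̃_w)` after `k` rounds of the variational iteration, which starts
from `(C_x, C_w)`. -/
def vmapScales : ℕ → Matrix (Fin n) (Fin n) ℝ × Matrix (Fin m) (Fin m) ℝ
  | 0 => (d.Cx, d.Cw)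
  | k + 1 =>
    let A := (vmapScales k).1
    let B := (vmapScales k).2
    (d.tildeCx (d.vmapEstimate A B) (d.vmapCov A B),
      d.tildeCw (d.vmapEstimate A B) (d.vmapCov A B))

end LinearModel

end

/-! Up to an additive constant, minus the logarithm of the posterior density is `energy`: affine in
`P⁻¹` and in `R⁻¹` apart from log-determinants, and quadratic in `X`. Under a product law the
factors are independent, so the divergence involves the factors only through their entropies, the
log-determinant terms and three kinds of moments: `V = E[P⁻¹]`, `W = E[R⁻¹]` and the second moments
of `X` (`exists_meanFieldKL_eq`). With two factors fixed, what remains is the divergence of the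
third factor to one explicit law `Q`, plus a constant: `Q` is Gaussian for `X` (complete the square,
`exists_trace_add_trace_eq`) and inverse-Wishart for `P` and `R`. As a divergence vanishes only at
`Q` itself, `Q` is the unique minimizer (`isMin_iff_of_eq_klDiv_add`). The mean-field equations, the
formula for the mode and the statements about the iteration are this fact combined with explicit
Gaussian and inverse-Wishart moments.

Three points need real work.

Finiteness. A finite divergence only says that a sum of terms is integrable. Fubini isolates the
terms of each variable, and the entropy inequality behind `integrable_of_integrable_llr_sub` then
separates the entropy from the moments (`integrable_llr_add_trace_iff`,
`integrable_llr_add_log_det_iff`, `integrable_energy_iff`).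

The inverse-Wishart law. Its kernel is integrable because an integral over the cone against the
congruence-invariant measure is comparable with one over the general linear group, where it becomes
a Gaussian integral (`lintegral_posDefHaar_mul_eq`, `lintegral_invWishartKernel_one_lt_top`). The
normalizer is a constant times `|C|^{-ν/2}`, by congruence; this gives the Laplace transform of
`P⁻¹`, and Jensen's inequality, tight at the origin, gives the mean `ν C⁻¹`
(`matrixExpect_inv_invWishart`).

Existence of an optimum. Updating `R`, then `P`, then `X` never increases the divergence and ends at
a triple determined by two scale matrices `A ≥ C_x`, `B ≥ C_w`. On such triples the divergence is a
constant plus `objective A B`, which is continuous and bounded below by positive multiples of `log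
|A|` and `log |B|` up to a constant. These tend to infinity with the traces, so a minimum is
attained on a compact set (`objective_ge`, `exists_objective_le`). -/

noncomputable section

/-! ### Semidefinite matrices -/

namespace Matrix

variable {n : ℕ}

lemma IsHermitian.exists_orthogonal_diagonal {A : Matrix (Fin n) (Fin n) ℝ} (hA : A.IsHermitian) :
    ∃ U : Matrix (Fin n) (Fin n) ℝ, U * Uᵀ = 1 ∧ Uᵀ * U = 1 ∧
      A = U * diagonal hA.eigenvalues * Uᵀ := by
  refine ⟨hA.eigenvectorUnitary, ?_, ?_, ?_⟩
  · have := Unitary.coe_mul_star_self hA.eigenvectorUnitary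
    simpa [star_eq_conjTranspose] using this
  · have := Unitary.coe_star_mul_self hA.eigenvectorUnitary
    simpa [star_eq_conjTranspose] using this
  · have h := hA.spectral_theorem
    rw [Unitary.conjStarAlgAut_apply] at h
    simpa [star_eq_conjTranspose, Function.comp_def] using h

lemma PosSemidef.exists_eq_mul_transpose {A : Matrix (Fin n) (Fin n) ℝ} (hA : A.PosSemidef) :
    ∃ L : Matrix (Fin n) (Fin n) ℝ, A = L * Lᵀ := by
  obtain ⟨U, -, -, h⟩ := hA.1.exists_orthogonal_diagonal
  refine ⟨U * diagonal fun i => Real.sqrt (hA.1.eigenvalues i), ?_⟩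
  have h2 : diagonal hA.1.eigenvalues = (diagonal fun i => Real.sqrt (hA.1.eigenvalues i)) *
      diagonal fun i => Real.sqrt (hA.1.eigenvalues i) := by
    rw [diagonal_mul_diagonal]
    congr 1
    ext i
    exact (Real.mul_self_sqrt (hA.eigenvalues_nonneg i)).symm
  rw [transpose_mul, diagonal_transpose, ← Matrix.mul_assoc, Matrix.mul_assoc U, ← h2]
  exact h

lemma PosDef.exists_eq_mul_transpose {A : Matrix (Fin n) (Fin n) ℝ} (hA : A.PosDef) :
    ∃ L : Matrix (Fin n) (Fin n) ℝ, L.det ≠ 0 ∧ A = L * Lᵀ := by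
  obtain ⟨L, h⟩ := hA.posSemidef.exists_eq_mul_transpose
  refine ⟨L, fun h0 => ?_, h⟩
  have := hA.det_pos
  rw [h, det_mul, h0, zero_mul] at this
  exact this.false

lemma posSemidef_mul_transpose_self {m : ℕ} (L : Matrix (Fin n) (Fin m) ℝ) :
    (L * Lᵀ).PosSemidef := by
  simpa using posSemidef_self_mul_conjTranspose L

lemma PosSemidef.congr_transpose {m : ℕ} {A : Matrix (Fin n) (Fin n) ℝ} (hA : A.PosSemidef)
    (B : Matrix (Fin m) (Fin n) ℝ) : (B * A * Bᵀ).PosSemidef := by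
  simpa using hA.mul_mul_conjTranspose_same B

lemma PosSemidef.transpose_congr {m : ℕ} {A : Matrix (Fin n) (Fin n) ℝ} (hA : A.PosSemidef)
    (B : Matrix (Fin n) (Fin m) ℝ) : (Bᵀ * A * B).PosSemidef := by
  simpa using hA.conjTranspose_mul_mul_same B

lemma posDef_congr_iff {L : Matrix (Fin n) (Fin n) ℝ} (hL : L.det ≠ 0)
    {A : Matrix (Fin n) (Fin n) ℝ} : (L * A * Lᵀ).PosDef ↔ A.PosDef := by
  have h := (L.isUnit_iff_isUnit_det.2 (isUnit_iff_ne_zero.2 hL)).posDef_star_right_conjugate_iff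
    (x := A)
  simpa [star_eq_conjTranspose] using h

lemma PosSemidef.trace_mul_nonneg {A B : Matrix (Fin n) (Fin n) ℝ} (hA : A.PosSemidef)
    (hB : B.PosSemidef) : 0 ≤ (A * B).trace := by
  obtain ⟨L, rfl⟩ := hA.exists_eq_mul_transpose
  rw [Matrix.mul_assoc, trace_mul_comm]
  have := (hB.transpose_congr L).trace_nonneg
  simpa [Matrix.mul_assoc] using this

/-- In terms of eigenvalues, `∏ (1 + λᵢ)` expands into nonnegative terms, among them `1` and every
`λᵢ`. -/
lemma PosSemidef.one_add_trace_le_det {K : Matrix (Fin n) (Fin n) ℝ} (hK : K.PosSemidef) :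
    1 + K.trace ≤ (1 + K).det := by
  obtain ⟨U, h1, h2, h⟩ := hK.1.exists_orthogonal_diagonal
  have h3 : 1 + K = U * diagonal (fun i => 1 + hK.1.eigenvalues i) * Uᵀ := by
    have : diagonal (fun i => 1 + hK.1.eigenvalues i) = 1 + diagonal hK.1.eigenvalues := by
      rw [← diagonal_one, diagonal_add]
    rw [this, Matrix.mul_add, Matrix.add_mul, ← h, Matrix.mul_one, h1]
  have h4 : (1 + K).det = ∏ i, (1 + hK.1.eigenvalues i) := by
    rw [h3, det_mul, det_mul, mul_right_comm, ← det_mul, h1, det_one, one_mul, det_diagonal]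
  rw [h4, hK.1.trace_eq_sum_eigenvalues]
  simp only [RCLike.ofReal_real_eq_id, id]
  have key : ∀ s : Finset (Fin n), 1 + ∑ i ∈ s, hK.1.eigenvalues i ≤
      ∏ i ∈ s, (1 + hK.1.eigenvalues i) := by
    intro s
    induction s using Finset.induction_on with
    | empty => simp
    | insert a s ha ih =>
      rw [Finset.sum_insert ha, Finset.prod_insert ha]
      have h5 := hK.eigenvalues_nonneg a
      have h6 : 0 ≤ ∑ i ∈ s, hK.1.eigenvalues i :=
        Finset.sum_nonneg fun i _ => hK.eigenvalues_nonneg i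
      nlinarith [mul_le_mul_of_nonneg_left ih h5]
  exact key _

/-- Multiply `λ ≤ exp λ` over the eigenvalues. This lets a Gaussian factor absorb any power of a
determinant. -/
lemma PosSemidef.det_le_exp_trace {K : Matrix (Fin n) (Fin n) ℝ} (hK : K.PosSemidef) :
    K.det ≤ Real.exp K.trace := by
  rw [hK.1.det_eq_prod_eigenvalues, hK.1.trace_eq_sum_eigenvalues]
  simp only [RCLike.ofReal_real_eq_id, id]
  rw [Real.exp_sum]
  exact Finset.prod_le_prod (fun i _ => hK.eigenvalues_nonneg i) fun i _ => by
    linarith [Real.add_one_le_exp (hK.1.eigenvalues i)]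

lemma PosDef.exists_smul_one_le {C : Matrix (Fin n) (Fin n) ℝ} (hC : C.PosDef) :
    ∃ c : ℝ, 0 < c ∧ (C - c • 1).PosSemidef := by
  obtain ⟨U, h1, h2, h⟩ := hC.1.exists_orthogonal_diagonal
  obtain ⟨c, hc, hle⟩ : ∃ c : ℝ, 0 < c ∧ ∀ i, c ≤ hC.1.eigenvalues i := by
    rcases isEmpty_or_nonempty (Fin n) with hn | hn
    -- In dimension zero there is no least eigenvalue and any positive constant works.
    · exact ⟨1, one_pos, fun i => isEmptyElim i⟩
    · obtain ⟨i, hi⟩ := Finite.exists_min hC.1.eigenvalues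
      exact ⟨_, hC.eigenvalues_pos i, hi⟩
  refine ⟨c, hc, ?_⟩
  have h3 : C - c • 1 = U * diagonal (fun i => hC.1.eigenvalues i - c) * Uᵀ := by
    have : diagonal (fun i => hC.1.eigenvalues i - c) = diagonal hC.1.eigenvalues - c • 1 := by
      rw [smul_one_eq_diagonal, diagonal_sub]
    rw [this, Matrix.mul_sub, Matrix.sub_mul, ← h, Matrix.mul_smul, Matrix.smul_mul,
      Matrix.mul_one, h1]
  rw [h3]
  exact (PosSemidef.diagonal fun i => sub_nonneg.2 (hle i)).congr_transpose U

/-- For `A = L Lᵀ` an entry is an inner product of two rows of `L`, at most the mean of their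
squared lengths, which are diagonal entries of `A`. Hence the trace alone controls integrability and
boundedness of all entries. -/
lemma PosSemidef.abs_apply_le_trace {A : Matrix (Fin n) (Fin n) ℝ} (hA : A.PosSemidef)
    (i j : Fin n) : |A i j| ≤ A.trace := by
  obtain ⟨L, rfl⟩ := hA.exists_eq_mul_transpose
  have hd : ∀ k, (L * Lᵀ) k k ≤ (L * Lᵀ).trace := fun k =>
    Finset.single_le_sum (f := fun k => (L * Lᵀ) k k)
      (fun l _ => hA.diag_nonneg) (Finset.mem_univ k)
  have h1 : 2 * |(L * Lᵀ) i j| ≤ (L * Lᵀ) i i + (L * Lᵀ) j j := by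
    simp only [mul_apply, transpose_apply]
    calc 2 * |∑ k, L i k * L j k| ≤ 2 * ∑ k, |L i k * L j k| := by
          gcongr; exact Finset.abs_sum_le_sum_abs _ _
      _ = ∑ k, 2 * |L i k * L j k| := by rw [Finset.mul_sum]
      _ ≤ ∑ k, (L i k * L i k + L j k * L j k) := by
          refine Finset.sum_le_sum fun k _ => ?_
          rw [abs_mul, ← abs_mul_abs_self (L i k), ← abs_mul_abs_self (L j k)]
          nlinarith [sq_nonneg (|L i k| - |L j k|)]
      _ = _ := Finset.sum_add_distrib
  linarith [hd i, hd j]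

/-- Congruence by `L⁻¹`, where `X = L Lᵀ`, reduces this to `det (1 + K') ≥ 1 + tr K' ≥ 1`. -/
lemma PosDef.det_le_det_add {X K : Matrix (Fin n) (Fin n) ℝ} (hX : X.PosDef)
    (hK : K.PosSemidef) : X.det ≤ (X + K).det := by
  obtain ⟨L, hL, rfl⟩ := hX.exists_eq_mul_transpose
  have hu : IsUnit L.det := isUnit_iff_ne_zero.2 hL
  have h1 : L * Lᵀ + K = L * (1 + L⁻¹ * K * L⁻¹ᵀ) * Lᵀ := by
    rw [Matrix.mul_add, Matrix.add_mul, Matrix.mul_one, transpose_nonsing_inv]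
    congr 1
    rw [← Matrix.mul_assoc, ← Matrix.mul_assoc, mul_nonsing_inv _ hu, Matrix.one_mul,
      Matrix.mul_assoc, nonsing_inv_mul _ (by rwa [det_transpose]), Matrix.mul_one]
  have h2 := (hK.congr_transpose L⁻¹)
  have h3 := h2.one_add_trace_le_det
  have h4 := h2.trace_nonneg
  rw [h1, det_mul, det_mul, det_mul, det_transpose]
  nlinarith [mul_self_nonneg L.det]

/-- The source of coercivity: on `{A ≥ c}` the determinant grows at least linearly with the trace.
-/
lemma PosSemidef.pow_mul_le_det {A : Matrix (Fin n) (Fin n) ℝ} {c : ℝ} (hc : 0 < c)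
    (hA : (A - c • 1).PosSemidef) : c ^ n * (1 + c⁻¹ * (A - c • 1).trace) ≤ A.det := by
  have h1 : A = c • (1 + c⁻¹ • (A - c • 1)) := by
    rw [smul_add, smul_smul, mul_inv_cancel₀ hc.ne', one_smul]
    abel
  have h2 := (hA.smul (inv_nonneg.2 hc.le)).one_add_trace_le_det
  conv_rhs => rw [h1, det_smul, Fintype.card_fin]
  rw [trace_smul, smul_eq_mul] at h2
  gcongr

lemma trace_mul_mul_transpose_eq_sum {N : ℕ} (A : Matrix (Fin n) (Fin n) ℝ)
    (X : Matrix (Fin n) (Fin N) ℝ) :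
    (A * (X * Xᵀ)).trace = ∑ t, X.col t ⬝ᵥ (A *ᵥ X.col t) := by
  rw [← Matrix.mul_assoc, trace_mul_comm]
  simp [trace, dotProduct, mulVec, mul_apply, Matrix.col]

lemma trace_mul_transpose_self_eq_sum {N : ℕ} (X : Matrix (Fin n) (Fin N) ℝ) :
    (X * Xᵀ).trace = ∑ i, ∑ t, X i t ^ 2 := by
  simp [trace, mul_apply, pow_two]

end Matrix

end

noncomputable section

/-! ### Lebesgue measures on matrices -/

namespace Matrix

variable {n : ℕ}

/-- A multiplicative function on matrices is determined by its values on diagonal matrices. -/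
lemma eq_det_pow_of_mul (f : Matrix (Fin n) (Fin n) ℝ → ℝ) (k : ℕ)
    (hmul : ∀ A B, f (A * B) = f A * f B) (hdiag : ∀ D, f (diagonal D) = (∏ i, D i) ^ k)
    (A : Matrix (Fin n) (Fin n) ℝ) (hA : A.det ≠ 0) : f A = A.det ^ k := by
  have hone : f 1 = 1 := by
    rw [← diagonal_one, hdiag]; simp
  refine diagonal_transvection_induction_of_det_ne_zero (fun A => f A = A.det ^ k) A hA
    (fun D _ => by rw [hdiag, det_diagonal]) (fun t => ?_) (fun A B _ _ hA hB => by
      rw [hmul, hA, hB, det_mul, mul_pow])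
  obtain ⟨i, j, hij, c⟩ := t
  rw [TransvectionStruct.det, one_pow]
  change f (transvection i j c) = 1
  have h1 : f (transvection i j c) * f (transvection i j (-c)) = 1 := by
    rw [← hmul, transvection_mul_transvection_same _ _ hij, add_neg_cancel, transvection_zero, hone]
  have h2 : f (transvection i j (c + c)) = f (transvection i j c) * f (transvection i j c) := by
    rw [← hmul, transvection_mul_transvection_same _ _ hij]
  -- Conjugating by a diagonal matrix doubles the parameter of the transvection, which also squares
  -- it; so its `f`-value `x` satisfies `x = x²` with `x ≠ 0`.
  have h3 : diagonal (fun l => if l = i then (2 : ℝ) else 1) * transvection i j c =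
      transvection i j (c + c) * diagonal (fun l => if l = i then (2 : ℝ) else 1) := by
    ext a b
    rw [diagonal_mul, mul_diagonal]
    simp only [transvection, add_apply, one_apply, single_apply]
    split_ifs <;> grind
  have h4 : f (diagonal fun l => if l = i then (2 : ℝ) else 1) ≠ 0 := by
    rw [hdiag]
    refine pow_ne_zero _ (Finset.prod_ne_zero_iff.2 fun l _ => ?_)
    split_ifs <;> norm_num
  have h5 := congrArg f h3
  rw [hmul, hmul, h2, mul_comm] at h5
  have h6 := mul_right_cancel₀ h4 h5
  have h7 : f (transvection i j c) ≠ 0 := left_ne_zero_of_mul_eq_one h1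
  field_simp at h6
  exact h6.symm

instance borelSpaceReal {a b : ℕ} : BorelSpace (Matrix (Fin a) (Fin b) ℝ) :=
  inferInstanceAs (BorelSpace (Fin a → Fin b → ℝ))

instance secondCountableReal {a b : ℕ} : SecondCountableTopology (Matrix (Fin a) (Fin b) ℝ) :=
  inferInstanceAs (SecondCountableTopology (Fin a → Fin b → ℝ))

lemma measurable_of_apply {α : Type*} [MeasurableSpace α] {a b : ℕ}
    {f : α → Matrix (Fin a) (Fin b) ℝ} (hf : ∀ i j, Measurable fun x => f x i j) :
    Measurable f :=
  measurable_pi_iff.2 fun i => measurable_pi_iff.2 fun j => hf i j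

lemma measurable_apply {a b : ℕ} (i : Fin a) (j : Fin b) :
    Measurable fun A : Matrix (Fin a) (Fin b) ℝ => A i j :=
  (measurable_pi_apply j).comp (measurable_pi_apply (X := fun _ : Fin a => Fin b → ℝ) i)

lemma inv_apply_eq (A : Matrix (Fin n) (Fin n) ℝ) (i j : Fin n) :
    A⁻¹ i j = A.det⁻¹ * A.adjugate i j := by
  rw [inv_def, Ring.inverse_eq_inv', smul_apply, smul_eq_mul]

lemma measurable_det : Measurable (det : Matrix (Fin n) (Fin n) ℝ → ℝ) :=
  (Continuous.matrix_det continuous_id).measurable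

lemma measurable_inv : Measurable (fun A : Matrix (Fin n) (Fin n) ℝ => A⁻¹) := by
  refine measurable_of_apply fun i j => ?_
  simp_rw [inv_apply_eq]
  exact measurable_det.inv.mul
    ((Continuous.matrix_adjugate continuous_id).matrix_elem i j).measurable

lemma isClosed_posSemidef : IsClosed {A : Matrix (Fin n) (Fin n) ℝ | A.PosSemidef} := by
  have : {A : Matrix (Fin n) (Fin n) ℝ | A.PosSemidef} =
      {A | Aᵀ = A} ∩ ⋂ x : Fin n → ℝ, {A | 0 ≤ x ⬝ᵥ (A *ᵥ x)} := by
    ext A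
    simp only [Set.mem_ofPred_eq, posSemidef_iff_dotProduct_mulVec, IsHermitian,
      conjTranspose_eq_transpose_of_trivial, Set.mem_inter_iff, Set.mem_iInter, star_trivial]
  rw [this]
  refine (isClosed_eq (continuous_id.matrix_transpose) continuous_id).inter
    (isClosed_iInter fun x => isClosed_le continuous_const ?_)
  exact continuous_const.dotProduct (continuous_id.matrix_mulVec continuous_const)

lemma measurableSet_posDef : MeasurableSet {A : Matrix (Fin n) (Fin n) ℝ | A.PosDef} := by
  have : {A : Matrix (Fin n) (Fin n) ℝ | A.PosDef} =
      {A | A.PosSemidef} ∩ {A | A.det ≠ 0} := by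
    ext A
    constructor
    · intro h
      exact ⟨h.posSemidef, h.det_pos.ne'⟩
    · rintro ⟨h1, h2⟩
      exact h1.posDef_iff_det_ne_zero.2 h2
  rw [this]
  exact isClosed_posSemidef.measurableSet.inter
    (measurable_det (measurableSet_singleton 0).compl)

end Matrix

/-! ### Lebesgue measure under transposition and multiplication by a matrix. -/

section Lebesgue

variable {a b n : ℕ}

lemma matrixLebesgue_eq : matrixLebesgue a b = (volume : Measure (Fin a → Fin b → ℝ)) :=
  Measure.map_id

instance : SigmaFinite (matrixLebesgue a b) := by
  rw [matrixLebesgue_eq]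
  exact inferInstanceAs (SigmaFinite (volume : Measure (Fin a → Fin b → ℝ)))

/-- Transposition of doubly indexed families of reals. -/
def swapCLE (a b : ℕ) : (Fin a → Fin b → ℝ) ≃L[ℝ] (Fin b → Fin a → ℝ) :=
  LinearEquiv.toContinuousLinearEquiv
    { toFun := fun v i j => v j i
      invFun := fun v i j => v j i
      map_add' := fun _ _ => rfl
      map_smul' := fun _ _ => rfl
      left_inv := fun _ => rfl
      right_inv := fun _ => rfl }

/-- Both sides are Haar measures, hence proportional; the unit cube is preserved and fixes the
constant as 1. -/
lemma map_swap_volume : (volume : Measure (Fin a → Fin b → ℝ)).map (fun v i j => v j i) =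
    (volume : Measure (Fin b → Fin a → ℝ)) := by
  have hU : (volume : Measure (Fin a → Fin b → ℝ)).IsAddHaarMeasure :=
    Measure.pi.isAddHaarMeasure fun _ => volume
  have hH : ((volume : Measure (Fin a → Fin b → ℝ)).map (swapCLE a b)).IsAddHaarMeasure :=
    (swapCLE a b).isAddHaarMeasure_map _
  change (volume : Measure (Fin a → Fin b → ℝ)).map (swapCLE a b) = _
  have hV : (volume : Measure (Fin b → Fin a → ℝ)).IsAddHaarMeasure :=
    Measure.pi.isAddHaarMeasure fun _ => volume
  have h := Measure.isAddLeftInvariant_eq_smul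
    ((volume : Measure (Fin a → Fin b → ℝ)).map (swapCLE a b)) volume
  have hbox : ∀ c d : ℕ, (volume : Measure (Fin c → Fin d → ℝ))
      (Set.univ.pi fun _ => Set.univ.pi fun _ => Set.Icc 0 1) = 1 := by
    intro c d
    rw [volume_pi_pi]
    simp_rw [volume_pi_pi]
    simp
  have h1 : ((volume : Measure (Fin a → Fin b → ℝ)).map (swapCLE a b))
      (Set.univ.pi fun _ => Set.univ.pi fun _ => Set.Icc 0 1) = 1 := by
    rw [Measure.map_apply (swapCLE a b).continuous.measurable
      (MeasurableSet.univ_pi fun _ => MeasurableSet.univ_pi fun _ => measurableSet_Icc),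
      ← hbox a b]
    congr 1
    ext v
    simp only [Set.mem_preimage, Set.mem_pi, Set.mem_univ, true_implies]
    exact ⟨fun h i j => h j i, fun h i j => h j i⟩
  rw [h, Measure.smul_apply, hbox, ENNReal.smul_def, smul_eq_mul, mul_one] at h1
  rw [h, ENNReal.coe_eq_one.1 h1, one_smul]

lemma map_transpose_matrixLebesgue :
    (matrixLebesgue a b).map transpose = matrixLebesgue b a := by
  rw [matrixLebesgue_eq, matrixLebesgue_eq]
  exact map_swap_volume

lemma map_pi_matrixVec {A : Matrix (Fin b) (Fin b) ℝ} (hA : A.det ≠ 0) :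
    (volume : Measure (Fin a → Fin b → ℝ)).map (fun v i => A *ᵥ v i) =
      ENNReal.ofReal |A.det⁻¹| ^ a • volume := by
  have h1 := Real.map_matrix_volume_pi_eq_smul_volume_pi hA
  have h2 : (volume : Measure (Fin b → ℝ)).map (fun v => A *ᵥ v) =
    ENNReal.ofReal |A.det⁻¹| • volume := h1
  have hs : SigmaFinite (ENNReal.ofReal |A.det⁻¹| • (volume : Measure (Fin b → ℝ))) :=
    inferInstanceAs (SigmaFinite (Real.toNNReal |A.det⁻¹| • (volume : Measure (Fin b → ℝ))))
  have hm : Measurable fun v : Fin b → ℝ => A *ᵥ v :=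
    (continuous_const.matrix_mulVec continuous_id).measurable
  rw [volume_pi, Measure.pi_map_pi (f := fun _ v => A *ᵥ v) (hμ := fun _ => by rw [h2]; exact hs)
    (fun _ => hm.aemeasurable), h2]
  refine Measure.pi_eq fun s hs => ?_
  rw [Measure.smul_apply, Measure.pi_pi]
  simp [Finset.prod_mul_distrib]

/-- Right multiplication acts on each of the `a` rows separately by `Aᵀ`, hence the exponent `a`. -/
lemma map_mul_right_matrixLebesgue {A : Matrix (Fin b) (Fin b) ℝ} (hA : A.det ≠ 0) :
    (matrixLebesgue a b).map (fun X => X * A) =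
      ENNReal.ofReal |A.det⁻¹| ^ a • matrixLebesgue a b := by
  have h := map_pi_matrixVec (a := a) (A := Aᵀ) (by rwa [det_transpose])
  rw [det_transpose] at h
  have e : (fun X : Matrix (Fin a) (Fin b) ℝ => X * A) = fun v i => Aᵀ *ᵥ v i := by
    ext X i j
    simp [mul_apply, mulVec, dotProduct, mul_comm]
  rw [e, matrixLebesgue_eq]
  exact h

lemma measurable_transpose {a b : ℕ} :
    Measurable (transpose : Matrix (Fin a) (Fin b) ℝ → Matrix (Fin b) (Fin a) ℝ) :=
  (continuous_id.matrix_transpose).measurable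

lemma measurable_mul_left {c : ℕ} (A : Matrix (Fin c) (Fin a) ℝ) :
    Measurable fun X : Matrix (Fin a) (Fin b) ℝ => A * X :=
  (continuous_const.matrix_mul continuous_id).measurable

lemma measurable_mul_right {c : ℕ} (A : Matrix (Fin b) (Fin c) ℝ) :
    Measurable fun X : Matrix (Fin a) (Fin b) ℝ => X * A :=
  (continuous_id.matrix_mul continuous_const).measurable

lemma map_mul_left_matrixLebesgue {A : Matrix (Fin a) (Fin a) ℝ} (hA : A.det ≠ 0) :
    (matrixLebesgue a b).map (fun X => A * X) =
      ENNReal.ofReal |A.det⁻¹| ^ b • matrixLebesgue a b := by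
  have h : (fun X : Matrix (Fin a) (Fin b) ℝ => A * X) =
      transpose ∘ (fun X => X * Aᵀ) ∘ transpose := by
    ext X : 1
    simp [transpose_mul]
  rw [h, ← Measure.map_map measurable_transpose
      ((measurable_mul_right _).comp measurable_transpose),
    ← Measure.map_map (measurable_mul_right _) measurable_transpose,
    map_transpose_matrixLebesgue, map_mul_right_matrixLebesgue (by rwa [det_transpose]),
    Measure.map_smul, map_transpose_matrixLebesgue, det_transpose]

end Lebesgue

/-! ### Symmetric matrices in upper triangular coordinates, and congruence on the cone. -/

section SymFill

variable {n : ℕ}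

lemma symFill_apply_of_le (v : {p : Fin n × Fin n // p.1 ≤ p.2} → ℝ) {i j : Fin n} (h : i ≤ j) :
    symFill v i j = v ⟨(i, j), h⟩ := by
  simp only [symFill, of_apply]
  congr 2
  rw [min_eq_left h, max_eq_right h]

lemma symFill_transpose (v : {p : Fin n × Fin n // p.1 ≤ p.2} → ℝ) :
    (symFill v)ᵀ = symFill v := by
  ext i j
  simp only [symFill, transpose_apply, of_apply]
  congr 2
  rw [min_comm, max_comm]

lemma symFill_upper {A : Matrix (Fin n) (Fin n) ℝ} (hA : Aᵀ = A) :
    symFill (fun p => A p.1.1 p.1.2) = A := by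
  ext i j
  rcases le_total i j with h | h
  · rw [symFill_apply_of_le _ h]
  · rw [← symFill_transpose, transpose_apply, symFill_apply_of_le _ h, ← transpose_apply A, hA]

lemma continuous_symFill : Continuous (symFill (n := n)) :=
  continuous_matrix fun _ _ => continuous_apply _

/-- Reading off the upper triangle is a measurable left inverse, and the range is the closed set of
symmetric matrices. Being an embedding carries sigma-finiteness over to `posDefLebesgue`. -/
lemma measurableEmbedding_symFill : MeasurableEmbedding (symFill (n := n)) := by
  refine MeasurableEmbedding.of_measurable_inverse (g := fun A p => A p.1.1 p.1.2)
    continuous_symFill.measurable ?_ ?_ ?_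
  · have : Set.range (symFill (n := n)) = {A | Aᵀ = A} := by
      ext A
      constructor
      · rintro ⟨v, rfl⟩
        exact symFill_transpose v
      · intro h
        exact ⟨_, symFill_upper h⟩
    rw [this]
    exact (isClosed_eq continuous_id.matrix_transpose continuous_id).measurableSet
  · exact measurable_pi_iff.2 fun p => Matrix.measurable_apply _ _
  · intro v
    ext p
    exact symFill_apply_of_le v p.2

instance : SigmaFinite (posDefLebesgue n) := by
  have : SigmaFinite ((volume : Measure ({p : Fin n × Fin n // p.1 ≤ p.2} → ℝ)).map symFill) :=
    measurableEmbedding_symFill.sigmaFinite_map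
  unfold posDefLebesgue
  infer_instance

lemma ae_posDef : ∀ᵐ P ∂(posDefLebesgue n), P.PosDef :=
  ae_restrict_mem measurableSet_posDef

/-- The action `S ↦ L S Lᵀ` on symmetric matrices, in upper triangular coordinates. -/
def symCongr (L : Matrix (Fin n) (Fin n) ℝ) :
    ({p : Fin n × Fin n // p.1 ≤ p.2} → ℝ) →ₗ[ℝ] ({p : Fin n × Fin n // p.1 ≤ p.2} → ℝ) where
  toFun v p := (L * symFill v * Lᵀ) p.1.1 p.1.2
  map_add' v w := by
    ext p
    have : symFill (v + w) = symFill v + symFill w := by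
      ext i j; rfl
    simp [this, Matrix.mul_add, Matrix.add_mul]
  map_smul' c v := by
    ext p
    have : symFill (c • v) = c • symFill v := by
      ext i j; rfl
    simp [this]

lemma symFill_symCongr (L : Matrix (Fin n) (Fin n) ℝ)
    (v : {p : Fin n × Fin n // p.1 ≤ p.2} → ℝ) :
    symFill (symCongr L v) = L * symFill v * Lᵀ :=
  symFill_upper (A := L * symFill v * Lᵀ) (by simp [transpose_mul, symFill_transpose, Matrix.mul_assoc])

lemma symCongr_mul (A B : Matrix (Fin n) (Fin n) ℝ) :
    symCongr (A * B) = symCongr A ∘ₗ symCongr B := by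
  refine LinearMap.ext fun v => measurableEmbedding_symFill.injective ?_
  rw [LinearMap.comp_apply, symFill_symCongr, symFill_symCongr, symFill_symCongr]
  simp [transpose_mul, Matrix.mul_assoc]

/-- Counting from 0, the index `i` occurs `n - i` times as a row and `i + 1` times as a column of
the upper triangle, `n + 1` times in all. -/
lemma prod_upper_mul (D : Fin n → ℝ) :
    ∏ p : {p : Fin n × Fin n // p.1 ≤ p.2}, D p.1.1 * D p.1.2 = (∏ i, D i) ^ (n + 1) := by
  rw [Finset.prod_mul_distrib]
  have h1 : ∏ p : {p : Fin n × Fin n // p.1 ≤ p.2}, D p.1.1 =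
      ∏ i, D i ^ (Finset.Ici i).card := by
    rw [← Finset.prod_subtype (Finset.univ.filter fun p : Fin n × Fin n => p.1 ≤ p.2)
      (by simp) (f := fun p => D p.1), Finset.prod_filter, Fintype.prod_prod_type]
    refine Finset.prod_congr rfl fun i _ => ?_
    rw [← Finset.prod_filter, ← Finset.prod_const]
    refine Finset.prod_congr ?_ fun _ _ => rfl
    ext j
    simp
  have h2 : ∏ p : {p : Fin n × Fin n // p.1 ≤ p.2}, D p.1.2 =
      ∏ i, D i ^ (Finset.Iic i).card := by
    rw [← Finset.prod_subtype (Finset.univ.filter fun p : Fin n × Fin n => p.1 ≤ p.2)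
      (by simp) (f := fun p => D p.2), Finset.prod_filter, Fintype.prod_prod_type_right]
    refine Finset.prod_congr rfl fun i _ => ?_
    rw [← Finset.prod_filter, ← Finset.prod_const]
    refine Finset.prod_congr ?_ fun _ _ => rfl
    ext j
    simp
  rw [h1, h2, ← Finset.prod_mul_distrib, ← Finset.prod_pow]
  refine Finset.prod_congr rfl fun i _ => ?_
  rw [← pow_add, Fin.card_Ici, Fin.card_Iic]
  congr 1
  omega

/-- The determinant of the action is multiplicative in `L`, so diagonal `L` decide; there the
coordinate `(i, j)` is scaled by `Dᵢ Dⱼ`. -/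
lemma det_symCongr {L : Matrix (Fin n) (Fin n) ℝ} (hL : L.det ≠ 0) :
    LinearMap.det (symCongr L) = L.det ^ (n + 1) := by
  refine eq_det_pow_of_mul (fun L => LinearMap.det (symCongr L)) (n + 1)
    (fun A B => ?_) (fun D => ?_) L hL
  · simp only [symCongr_mul, LinearMap.det_comp]
  · have : symCongr (diagonal D) = toLin' (diagonal fun p => D p.1.1 * D p.1.2) := by
      refine LinearMap.ext fun v => funext fun p => ?_
      rw [toLin'_apply, mulVec_diagonal]
      change (diagonal D * symFill v * (diagonal D)ᵀ) p.1.1 p.1.2 = _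
      rw [diagonal_transpose, mul_diagonal, diagonal_mul, symFill_apply_of_le v p.2]
      ring
    simp only [this, LinearMap.det_toLin', det_diagonal, prod_upper_mul]

lemma map_congr_posDefLebesgue {L : Matrix (Fin n) (Fin n) ℝ} (hL : L.det ≠ 0) :
    (posDefLebesgue n).map (fun P => L * P * Lᵀ) =
      ENNReal.ofReal |(L.det ^ (n + 1))⁻¹| • posDefLebesgue n := by
  have hm : Measurable fun P : Matrix (Fin n) (Fin n) ℝ => L * P * Lᵀ :=
    (measurable_mul_right _).comp (measurable_mul_left _)
  have hdet := det_symCongr hL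
  have hne : LinearMap.det (symCongr L) ≠ 0 := by
    rw [hdet]
    exact pow_ne_zero _ hL
  have h1 := Real.map_linearMap_volume_pi_eq_smul_volume_pi hne
  rw [hdet] at h1
  have hpre : (fun P : Matrix (Fin n) (Fin n) ℝ => L * P * Lᵀ) ⁻¹' {P | P.PosDef} =
      {P | P.PosDef} := by
    ext P
    exact posDef_congr_iff hL
  have hcont : Measurable (symCongr L) := (symCongr L).continuous_of_finiteDimensional.measurable
  unfold posDefLebesgue
  conv_lhs => rw [← hpre]
  rw [← Measure.restrict_map hm measurableSet_posDef,
    Measure.map_map hm continuous_symFill.measurable]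
  have h2 : (fun P : Matrix (Fin n) (Fin n) ℝ => L * P * Lᵀ) ∘ symFill = symFill ∘ symCongr L := by
    ext1 v
    exact (symFill_symCongr L v).symm
  rw [h2, ← Measure.map_map continuous_symFill.measurable hcont, h1, Measure.map_smul,
    Measure.restrict_smul]

/-- The form of `E = A - 1` is at most `n / (n + 1) < 1` times `x ⬝ᵥ x`. The denominator `n + 1`
makes the bound strict and covers `n = 0`. This is the explicit neighbourhood of the identity used
for nonvanishing of the measure and for perturbations inside the cone. -/
lemma posDef_of_forall_abs_sub_one_le {A : Matrix (Fin n) (Fin n) ℝ} (hA : Aᵀ = A)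
    (h : ∀ i j, |A i j - (1 : Matrix (Fin n) (Fin n) ℝ) i j| ≤ 1 / (n + 1)) : A.PosDef := by
  refine PosDef.of_dotProduct_mulVec_pos (by simpa [IsHermitian] using hA) fun x hx => ?_
  have hn : (0 : ℝ) < n + 1 := by positivity
  obtain ⟨E, hE⟩ : ∃ E, E = A - 1 := ⟨_, rfl⟩
  have hAE : A = 1 + E := by rw [hE]; abel
  have h' : ∀ i j, |E i j| ≤ 1 / (n + 1) := fun i j => by rw [hE]; exact h i j
  have hpos : 0 < x ⬝ᵥ x := by
    have := dotProduct_star_self_pos_iff (v := x)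
    simpa using this.2 hx
  have h1 : |x ⬝ᵥ (E *ᵥ x)| ≤ n / (n + 1) * (x ⬝ᵥ x) := by
    calc |x ⬝ᵥ (E *ᵥ x)| = |∑ i, ∑ j, x i * (E i j * x j)| := by
          simp [dotProduct, mulVec, Finset.mul_sum]
      _ ≤ ∑ i, ∑ j, |x i * (E i j * x j)| :=
          (Finset.abs_sum_le_sum_abs _ _).trans
            (Finset.sum_le_sum fun i _ => Finset.abs_sum_le_sum_abs _ _)
      _ ≤ ∑ i, ∑ j, (1 / (n + 1)) * ((x i * x i + x j * x j) / 2) := by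
          refine Finset.sum_le_sum fun i _ => Finset.sum_le_sum fun j _ => ?_
          rw [abs_mul, abs_mul, mul_left_comm]
          refine mul_le_mul (h' i j) ?_ (by positivity) (by positivity)
          rw [← abs_mul_abs_self (x i), ← abs_mul_abs_self (x j)]
          nlinarith [sq_nonneg (|x i| - |x j|)]
      _ = n / (n + 1) * (x ⬝ᵥ x) := by
          simp only [← Finset.mul_sum, ← Finset.sum_div, Finset.sum_add_distrib, dotProduct,
            Finset.sum_const, Finset.card_univ, Fintype.card_fin, nsmul_eq_mul]
          simp only [mul_left_comm (x _) (n : ℝ), ← Finset.mul_sum]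
          ring
  have h2 : (n : ℝ) / (n + 1) < 1 := by rw [div_lt_one hn]; linarith
  have h3 := neg_abs_le (x ⬝ᵥ (E *ᵥ x))
  rw [star_trivial, hAE, add_mulVec, one_mulVec, dotProduct_add]
  nlinarith

lemma posDefLebesgue_ne_zero : posDefLebesgue n ≠ 0 := by
  intro h0
  have h1 : posDefLebesgue n Set.univ = 0 := by rw [h0]; rfl
  rw [posDefLebesgue, Measure.restrict_apply_univ,
    Measure.map_apply continuous_symFill.measurable measurableSet_posDef] at h1
  have hn : (0 : ℝ) < 1 / (n + 1) := by positivity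
  let v₀ : {p : Fin n × Fin n // p.1 ≤ p.2} → ℝ :=
    fun p => (1 : Matrix (Fin n) (Fin n) ℝ) p.1.1 p.1.2
  have hsub : Metric.ball v₀ (1 / (n + 1)) ⊆ symFill ⁻¹' {P | P.PosDef} := by
    intro v hv
    refine posDef_of_forall_abs_sub_one_le (symFill_transpose v) fun i j => ?_
    have h2 : symFill v₀ = 1 := symFill_upper transpose_one
    rw [← h2]
    have h3 := (dist_pi_lt_iff hn).1 hv ⟨(min i j, max i j), min_le_max⟩
    exact h3.le
  have h2 := measure_mono_null hsub h1
  exact (Metric.measure_ball_pos volume v₀ hn).ne' h2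

end SymFill

end

noncomputable section

/-! ### Haar measures -/

section Measurability

variable {α : Type*} [MeasurableSpace α] {a b c n : ℕ}

lemma Measurable.matrix_mul' {f : α → Matrix (Fin a) (Fin b) ℝ} {g : α → Matrix (Fin b) (Fin c) ℝ}
    (hf : Measurable f) (hg : Measurable g) : Measurable fun x => f x * g x :=
  (Continuous.measurable (f := fun p : Matrix (Fin a) (Fin b) ℝ × Matrix (Fin b) (Fin c) ℝ =>
    p.1 * p.2) (continuous_fst.matrix_mul continuous_snd)).comp (hf.prodMk hg)

lemma Measurable.matrix_transpose' {f : α → Matrix (Fin a) (Fin b) ℝ} (hf : Measurable f) :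
    Measurable fun x => (f x)ᵀ :=
  measurable_transpose.comp hf

lemma Measurable.matrix_inv' {f : α → Matrix (Fin n) (Fin n) ℝ} (hf : Measurable f) :
    Measurable fun x => (f x)⁻¹ :=
  Matrix.measurable_inv.comp hf

lemma Measurable.matrix_det' {f : α → Matrix (Fin n) (Fin n) ℝ} (hf : Measurable f) :
    Measurable fun x => (f x).det :=
  Matrix.measurable_det.comp hf

lemma Measurable.matrix_trace' {f : α → Matrix (Fin n) (Fin n) ℝ} (hf : Measurable f) :
    Measurable fun x => (f x).trace :=
  (continuous_id.matrix_trace.measurable).comp hf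

lemma Measurable.matrix_sub' {f g : α → Matrix (Fin a) (Fin b) ℝ} (hf : Measurable f)
    (hg : Measurable g) : Measurable fun x => f x - g x :=
  (Continuous.measurable (f := fun p : Matrix (Fin a) (Fin b) ℝ × Matrix (Fin a) (Fin b) ℝ =>
    p.1 - p.2) (continuous_fst.sub continuous_snd)).comp (hf.prodMk hg)

end Measurability

section Invariance

variable {n : ℕ}

/-- The Haar measure of the general linear group, as a measure on matrices. -/
def generalLinearHaar (n : ℕ) : Measure (Matrix (Fin n) (Fin n) ℝ) :=
  (matrixLebesgue n n).withDensity fun X => ENNReal.ofReal (|X.det| ^ n)⁻¹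

/-- The measure on positive definite matrices that is invariant under congruence. -/
def posDefHaar (n : ℕ) : Measure (Matrix (Fin n) (Fin n) ℝ) :=
  (posDefLebesgue n).withDensity fun P => ENNReal.ofReal (P.det ^ (-((n : ℝ) + 1) / 2))

lemma measurable_generalLinearHaar_density :
    Measurable fun X : Matrix (Fin n) (Fin n) ℝ => ENNReal.ofReal (|X.det| ^ n)⁻¹ :=
  ((measurable_id.matrix_det'.abs.pow_const n).inv).ennreal_ofReal

lemma measurable_posDefHaar_density :
    Measurable fun P : Matrix (Fin n) (Fin n) ℝ =>
      ENNReal.ofReal (P.det ^ (-((n : ℝ) + 1) / 2)) :=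
  (measurable_id.matrix_det'.pow_const _).ennreal_ofReal

instance : SigmaFinite (generalLinearHaar n) :=
  SigmaFinite.withDensity_ofReal _

instance : SigmaFinite (posDefHaar n) :=
  SigmaFinite.withDensity_ofReal _

lemma ae_det_ne_zero_generalLinearHaar : ∀ᵐ X ∂(generalLinearHaar n), X.det ≠ 0 := by
  rw [generalLinearHaar, ae_withDensity_iff measurable_generalLinearHaar_density]
  refine Filter.Eventually.of_forall fun X h h0 => h ?_
  rcases Nat.eq_zero_or_pos n with rfl | hn
  · simp at h0
  · simp [h0, hn.ne']

lemma ae_posDef_posDefHaar : ∀ᵐ P ∂(posDefHaar n), P.PosDef :=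
  (withDensity_absolutelyContinuous _ _).ae_le ae_posDef

/-- If `φ` scales `μ` by `c` and the density compensates by `c'` with `c' c = 1`, the weighted
measure is invariant. All invariances below are instances. -/
lemma lintegral_withDensity_comp_of_map_eq_smul {α : Type*} [MeasurableSpace α] {μ : Measure α}
    {φ : α → α} (hφ : Measurable φ) {c c' : ℝ≥0∞} (hmap : μ.map φ = c • μ) (hc : c' * c = 1)
    {δ : α → ℝ≥0∞} (hδ : Measurable δ) (h : ∀ᵐ x ∂μ, δ x = c' * δ (φ x)) {g : α → ℝ≥0∞}
    (hg : Measurable g) :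
    ∫⁻ x, g (φ x) ∂(μ.withDensity δ) = ∫⁻ x, g x ∂(μ.withDensity δ) := by
  have e1 := lintegral_withDensity_eq_lintegral_mul μ hδ (hg.comp hφ)
  have e2 := lintegral_withDensity_eq_lintegral_mul μ hδ hg
  have e3 := lintegral_map (μ := μ) (hδ.mul hg) hφ
  rw [hmap, lintegral_smul_measure, smul_eq_mul] at e3
  have e4 : ∫⁻ x, (δ * (g ∘ φ)) x ∂μ = ∫⁻ x, c' * (δ * g) (φ x) ∂μ := by
    refine lintegral_congr_ae ?_
    filter_upwards [h] with x hx
    rw [Pi.mul_apply, Pi.mul_apply, Function.comp_apply, hx, mul_assoc]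
  rw [e2]
  refine e1.trans ?_
  rw [e4, lintegral_const_mul (f := fun x => (δ * g) (φ x)) _ ((hδ.mul hg).comp hφ), ← e3, ← mul_assoc, hc, one_mul]

lemma lintegral_generalLinearHaar_mul_left {A : Matrix (Fin n) (Fin n) ℝ} (hA : A.det ≠ 0)
    {g : Matrix (Fin n) (Fin n) ℝ → ℝ≥0∞} (hg : Measurable g) :
    ∫⁻ X, g (A * X) ∂(generalLinearHaar n) = ∫⁻ X, g X ∂(generalLinearHaar n) := by
  have h0 : 0 < |A.det| := abs_pos.2 hA
  refine lintegral_withDensity_comp_of_map_eq_smul (measurable_mul_left A)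
    (map_mul_left_matrixLebesgue hA) (c' := ENNReal.ofReal (|A.det| ^ n)) ?_
    measurable_generalLinearHaar_density (Filter.Eventually.of_forall fun X => ?_) hg
  · rw [← ENNReal.ofReal_pow (abs_nonneg _), ← ENNReal.ofReal_mul (by positivity), abs_inv,
      inv_pow, mul_inv_cancel₀ (by positivity), ENNReal.ofReal_one]
  · rw [← ENNReal.ofReal_mul (by positivity), det_mul, abs_mul, mul_pow, mul_inv,
      ← mul_assoc, mul_inv_cancel₀ (by positivity), one_mul]

lemma lintegral_generalLinearHaar_mul_right {A : Matrix (Fin n) (Fin n) ℝ} (hA : A.det ≠ 0)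
    {g : Matrix (Fin n) (Fin n) ℝ → ℝ≥0∞} (hg : Measurable g) :
    ∫⁻ X, g (X * A) ∂(generalLinearHaar n) = ∫⁻ X, g X ∂(generalLinearHaar n) := by
  have h0 : 0 < |A.det| := abs_pos.2 hA
  refine lintegral_withDensity_comp_of_map_eq_smul (measurable_mul_right A)
    (map_mul_right_matrixLebesgue hA) (c' := ENNReal.ofReal (|A.det| ^ n)) ?_
    measurable_generalLinearHaar_density (Filter.Eventually.of_forall fun X => ?_) hg
  · rw [← ENNReal.ofReal_pow (abs_nonneg _), ← ENNReal.ofReal_mul (by positivity), abs_inv,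
      inv_pow, mul_inv_cancel₀ (by positivity), ENNReal.ofReal_one]
  · rw [← ENNReal.ofReal_mul (by positivity), det_mul, abs_mul, mul_pow, mul_inv,
      mul_left_comm, mul_inv_cancel₀ (by positivity), mul_one]

lemma measurable_congr (L : Matrix (Fin n) (Fin n) ℝ) :
    Measurable fun P : Matrix (Fin n) (Fin n) ℝ => L * P * Lᵀ :=
  (measurable_mul_right _).comp (measurable_mul_left _)

lemma det_congr_rpow {L P : Matrix (Fin n) (Fin n) ℝ} (hP : 0 ≤ P.det) (s : ℝ) :
    (L * P * Lᵀ).det ^ s = |L.det| ^ (2 * s) * P.det ^ s := by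
  have : (L * P * Lᵀ).det = |L.det| ^ (2 : ℝ) * P.det := by
    rw [det_mul, det_mul, det_transpose, Real.rpow_two, sq_abs]
    ring
  rw [this, Real.mul_rpow (by positivity) hP, ← Real.rpow_mul (abs_nonneg _)]

lemma lintegral_posDefHaar_congr {L : Matrix (Fin n) (Fin n) ℝ} (hL : L.det ≠ 0)
    {g : Matrix (Fin n) (Fin n) ℝ → ℝ≥0∞} (hg : Measurable g) :
    ∫⁻ P, g (L * P * Lᵀ) ∂(posDefHaar n) = ∫⁻ P, g P ∂(posDefHaar n) := by
  have h0 : 0 < |L.det| := abs_pos.2 hL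
  refine lintegral_withDensity_comp_of_map_eq_smul (measurable_congr L)
    (map_congr_posDefLebesgue hL) (c' := ENNReal.ofReal (|L.det| ^ (n + 1))) ?_
    measurable_posDefHaar_density ?_ hg
  · rw [← ENNReal.ofReal_mul (by positivity), abs_inv, abs_pow,
      mul_inv_cancel₀ (by positivity), ENNReal.ofReal_one]
  · filter_upwards [ae_posDef] with P hP
    rw [← ENNReal.ofReal_mul (by positivity), det_congr_rpow hP.det_pos.le, ← mul_assoc,
      ← Real.rpow_natCast, ← Real.rpow_add h0]
    have : ((n + 1 : ℕ) : ℝ) + 2 * (-((n : ℝ) + 1) / 2) = 0 := by push_cast; ring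
    rw [this, Real.rpow_zero, one_mul]

/-- The substitution `P ↦ Xᵀ P X`, under which `posDefHaar` is invariant. -/
lemma lintegral_posDefHaar_inv_congr_mul {f w : Matrix (Fin n) (Fin n) ℝ → ℝ≥0∞}
    (hf : Measurable f) (hw : Measurable w) {X : Matrix (Fin n) (Fin n) ℝ} (hX : X.det ≠ 0) :
    ∫⁻ P, f (X⁻¹ᵀ * P * X⁻¹) * w P ∂(posDefHaar n) =
      ∫⁻ P, f P * w (Xᵀ * P * X) ∂(posDefHaar n) := by
  have hu : IsUnit X.det := isUnit_iff_ne_zero.2 hX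
  have h := lintegral_posDefHaar_congr (L := Xᵀ) (by rwa [det_transpose])
    (g := fun P => f (X⁻¹ᵀ * P * X⁻¹) * w P)
    ((hf.comp ((measurable_mul_right _).comp (measurable_mul_left _))).mul hw)
  rw [← h]
  refine lintegral_congr fun P => ?_
  have : X⁻¹ᵀ * (Xᵀ * P * Xᵀᵀ) * X⁻¹ = P := by
    rw [transpose_transpose, transpose_nonsing_inv, Matrix.mul_assoc Xᵀ, ← Matrix.mul_assoc Xᵀ⁻¹,
      nonsing_inv_mul _ (by rwa [det_transpose]), Matrix.one_mul, Matrix.mul_assoc,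
      mul_nonsing_inv _ hu, Matrix.mul_one]
  rw [this, transpose_transpose]

/-- With `P = S Sᵀ`, left invariance absorbs `Sᵀ` into `X`, so the integral does not depend on `P`.
-/
lemma lintegral_generalLinearHaar_transpose_congr {w : Matrix (Fin n) (Fin n) ℝ → ℝ≥0∞}
    (hw : Measurable w) {P : Matrix (Fin n) (Fin n) ℝ} (hP : P.PosDef) :
    ∫⁻ X, w (Xᵀ * P * X) ∂(generalLinearHaar n) = ∫⁻ X, w (Xᵀ * X) ∂(generalLinearHaar n) := by
  obtain ⟨S, hS, rfl⟩ := hP.exists_eq_mul_transpose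
  have h := lintegral_generalLinearHaar_mul_left (A := Sᵀ) (by rwa [det_transpose])
    (g := fun X => w (Xᵀ * X)) (hw.comp (measurable_id.matrix_transpose'.matrix_mul'
      measurable_id))
  rw [← h]
  refine lintegral_congr fun X => ?_
  rw [transpose_mul, transpose_transpose, Matrix.mul_assoc, Matrix.mul_assoc, Matrix.mul_assoc]

/-- The same with right invariance: replacing `X` by `X Sᵀ` cancels `P = S Sᵀ`. -/
lemma lintegral_generalLinearHaar_inv_congr {f : Matrix (Fin n) (Fin n) ℝ → ℝ≥0∞}
    (hf : Measurable f) {P : Matrix (Fin n) (Fin n) ℝ} (hP : P.PosDef) :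
    ∫⁻ X, f (X⁻¹ᵀ * P * X⁻¹) ∂(generalLinearHaar n) =
      ∫⁻ X, f (X⁻¹ᵀ * X⁻¹) ∂(generalLinearHaar n) := by
  obtain ⟨S, hS, rfl⟩ := hP.exists_eq_mul_transpose
  have hu : IsUnit S.det := isUnit_iff_ne_zero.2 hS
  have h := lintegral_generalLinearHaar_mul_right (A := Sᵀ) (by rwa [det_transpose])
    (g := fun X => f (X⁻¹ᵀ * (S * Sᵀ) * X⁻¹)) (hf.comp
      ((measurable_id.matrix_inv'.matrix_transpose'.matrix_mul' measurable_const).matrix_mul'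
      measurable_id.matrix_inv'))
  rw [← h]
  refine lintegral_congr fun X => ?_
  have : (X * Sᵀ)⁻¹ᵀ * (S * Sᵀ) * (X * Sᵀ)⁻¹ = X⁻¹ᵀ * X⁻¹ := by
    rw [Matrix.mul_inv_rev, transpose_mul, transpose_nonsing_inv Sᵀ, transpose_transpose,
      Matrix.mul_assoc, Matrix.mul_assoc, Matrix.mul_assoc S, ← Matrix.mul_assoc Sᵀ,
      mul_nonsing_inv _ (by rwa [det_transpose]), Matrix.one_mul, ← Matrix.mul_assoc S⁻¹,
      nonsing_inv_mul _ hu, Matrix.one_mul]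
  rw [this]

/-- Comparison of integrals over the positive cone and over the general linear group. -/
lemma lintegral_posDefHaar_mul_eq {f w : Matrix (Fin n) (Fin n) ℝ → ℝ≥0∞} (hf : Measurable f)
    (hw : Measurable w) :
    (∫⁻ P, f P ∂(posDefHaar n)) * ∫⁻ X, w (Xᵀ * X) ∂(generalLinearHaar n) =
      (∫⁻ P, w P ∂(posDefHaar n)) * ∫⁻ X, f (X⁻¹ᵀ * X⁻¹) ∂(generalLinearHaar n) := by
  have hm1 : Measurable fun z : Matrix (Fin n) (Fin n) ℝ × Matrix (Fin n) (Fin n) ℝ =>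
      f (z.1⁻¹ᵀ * z.2 * z.1⁻¹) := hf.comp
    ((measurable_fst.matrix_inv'.matrix_transpose'.matrix_mul' measurable_snd).matrix_mul'
      measurable_fst.matrix_inv')
  have hm2 : Measurable fun z : Matrix (Fin n) (Fin n) ℝ × Matrix (Fin n) (Fin n) ℝ =>
      w (z.2ᵀ * z.1 * z.2) := hw.comp
    ((measurable_snd.matrix_transpose'.matrix_mul' measurable_fst).matrix_mul' measurable_snd)
  -- The double integral of `f P * w (Xᵀ P X)` is computed in two ways. Integrating over `X` first
  -- makes the `w` factor independent of `P`; substituting in `P` first moves the dependence on `X`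
  -- to `f`, and the `f` factor becomes independent of `P`.
  have s1 : ∫⁻ P, ∫⁻ X, f P * w (Xᵀ * P * X) ∂(generalLinearHaar n) ∂(posDefHaar n) =
      ∫⁻ X, ∫⁻ P, f P * w (Xᵀ * P * X) ∂(posDefHaar n) ∂(generalLinearHaar n) :=
    lintegral_lintegral_swap (f := fun P X => f P * w (Xᵀ * P * X))
      ((hf.comp measurable_fst).mul hm2).aemeasurable
  have s2 : ∫⁻ X, ∫⁻ P, f (X⁻¹ᵀ * P * X⁻¹) * w P ∂(posDefHaar n) ∂(generalLinearHaar n) =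
      ∫⁻ P, ∫⁻ X, f (X⁻¹ᵀ * P * X⁻¹) * w P ∂(generalLinearHaar n) ∂(posDefHaar n) :=
    lintegral_lintegral_swap (f := fun X P => f (X⁻¹ᵀ * P * X⁻¹) * w P)
      (hm1.mul (hw.comp measurable_snd)).aemeasurable
  have s3 : ∫⁻ X, ∫⁻ P, f P * w (Xᵀ * P * X) ∂(posDefHaar n) ∂(generalLinearHaar n) =
      ∫⁻ X, ∫⁻ P, f (X⁻¹ᵀ * P * X⁻¹) * w P ∂(posDefHaar n) ∂(generalLinearHaar n) := by
    refine lintegral_congr_ae ?_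
    filter_upwards [ae_det_ne_zero_generalLinearHaar] with X hX
    exact (lintegral_posDefHaar_inv_congr_mul hf hw hX).symm
  have s4 : ∫⁻ P, ∫⁻ X, f P * w (Xᵀ * P * X) ∂(generalLinearHaar n) ∂(posDefHaar n) =
      ∫⁻ P, f P * ∫⁻ X, w (Xᵀ * X) ∂(generalLinearHaar n) ∂(posDefHaar n) := by
    refine lintegral_congr_ae ?_
    filter_upwards [ae_posDef_posDefHaar] with P hP
    rw [← lintegral_generalLinearHaar_transpose_congr hw hP]
    have hm : Measurable fun X : Matrix (Fin n) (Fin n) ℝ => w (Xᵀ * P * X) := hw.comp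
      ((measurable_id.matrix_transpose'.matrix_mul' measurable_const).matrix_mul' measurable_id)
    exact lintegral_const_mul _ hm
  have s5 : ∫⁻ P, ∫⁻ X, f (X⁻¹ᵀ * P * X⁻¹) * w P ∂(generalLinearHaar n) ∂(posDefHaar n) =
      ∫⁻ P, w P * ∫⁻ X, f (X⁻¹ᵀ * X⁻¹) ∂(generalLinearHaar n) ∂(posDefHaar n) := by
    refine lintegral_congr_ae ?_
    filter_upwards [ae_posDef_posDefHaar] with P hP
    rw [← lintegral_generalLinearHaar_inv_congr hf hP, mul_comm (w P)]
    have hm : Measurable fun X : Matrix (Fin n) (Fin n) ℝ => f (X⁻¹ᵀ * P * X⁻¹) := hf.comp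
      ((measurable_id.matrix_inv'.matrix_transpose'.matrix_mul' measurable_const).matrix_mul'
        measurable_id.matrix_inv')
    exact lintegral_mul_const _ hm
  rw [← lintegral_mul_const _ hf, ← lintegral_mul_const _ hw, ← s4, ← s5, s1, s3, s2]

end Invariance

end

noncomputable section

/-! ### Integrability of the Gaussian and inverse-Wishart kernels -/

section Finiteness

variable {n a b : ℕ}

lemma measurable_matrixOf :
    Measurable fun v : Fin a → Fin b → ℝ => (Matrix.of v : Matrix (Fin a) (Fin b) ℝ) :=
  measurable_of_apply fun i j => (measurable_pi_apply j).comp (measurable_pi_apply i)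

lemma integrable_exp_neg_trace {c : ℝ} (hc : 0 < c) :
    Integrable (fun X : Matrix (Fin a) (Fin b) ℝ => Real.exp (-c * (X * Xᵀ).trace))
      (matrixLebesgue a b) := by
  have hm : Measurable fun X : Matrix (Fin a) (Fin b) ℝ => Real.exp (-c * (X * Xᵀ).trace) :=
    (measurable_const.mul
      (measurable_id.matrix_mul' measurable_id.matrix_transpose').matrix_trace').exp
  have h1 : Integrable (fun v : Fin b → ℝ => ∏ j, Real.exp (-c * v j ^ 2)) :=
    Integrable.fintype_prod (f := fun _ x => Real.exp (-c * x ^ 2))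
      fun _ => integrable_exp_neg_mul_sq hc
  have h2 : Integrable (fun v : Fin a → Fin b → ℝ => ∏ i, ∏ j, Real.exp (-c * v i j ^ 2)) :=
    Integrable.fintype_prod (ι := Fin a) (E := Fin b → ℝ) (μ := fun _ => volume)
      (f := fun _ v => ∏ j, Real.exp (-c * v j ^ 2)) fun _ => h1
  have h3 : (fun v : Fin a → Fin b → ℝ => ∏ i, ∏ j, Real.exp (-c * v i j ^ 2)) =
      fun v => Real.exp (-c * (Matrix.of v * (Matrix.of v)ᵀ).trace) := by
    ext v
    simp_rw [← Real.exp_sum, ← Finset.mul_sum]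
    rw [trace_mul_transpose_self_eq_sum]
    rfl
  rw [h3] at h2
  rw [matrixLebesgue, integrable_map_measure hm.aestronglyMeasurable
    measurable_matrixOf.aemeasurable]
  exact h2

/-- Apply `det ≤ exp tr` to a multiple of `X Xᵀ`. The multiple `(2 s)⁻¹` is chosen so that raising
to the power `s / 2` leaves the exponent `1 / 4`, half of the Gaussian decay available later. -/
lemma rpow_abs_det_le {s : ℝ} (hs : 0 < s) :
    ∃ c : ℝ, 0 < c ∧ ∀ X : Matrix (Fin n) (Fin n) ℝ,
      |X.det| ^ s ≤ c * Real.exp (1 / 4 * (X * Xᵀ).trace) := by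
  refine ⟨((2 * s) ^ n) ^ (s / 2), by positivity, fun X => ?_⟩
  have hε : 0 < (2 * s)⁻¹ := by positivity
  have h1 := ((posSemidef_mul_transpose_self X).smul hε.le).det_le_exp_trace
  rw [det_smul, Fintype.card_fin, det_mul, det_transpose, trace_smul, smul_eq_mul] at h1
  have h2 : |X.det| ^ 2 ≤ (2 * s) ^ n * Real.exp ((2 * s)⁻¹ * (X * Xᵀ).trace) := by
    rw [sq_abs, sq]
    rw [inv_pow, inv_mul_le_iff₀ (by positivity)] at h1
    exact h1
  have h3 := Real.rpow_le_rpow (by positivity) h2 (by positivity : 0 ≤ s / 2)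
  rw [Real.mul_rpow (by positivity) (by positivity), ← Real.exp_mul, ← Real.rpow_natCast |X.det|,
    ← Real.rpow_mul (abs_nonneg _)] at h3
  convert h3 using 2
  · push_cast; ring
  · congr 1
    field_simp
    ring

lemma isOpenPosMeasure_matrixLebesgue {s : Set (Matrix (Fin a) (Fin b) ℝ)} (hs : IsOpen s)
    (hne : s.Nonempty) : matrixLebesgue a b s ≠ 0 := by
  rw [matrixLebesgue, Measure.map_apply measurable_matrixOf hs.measurableSet]
  have h1 : IsOpen ((fun v : Fin a → Fin b → ℝ => (Matrix.of v : Matrix (Fin a) (Fin b) ℝ)) ⁻¹' s) :=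
    hs.preimage (continuous_matrix fun i j => (continuous_apply j).comp (continuous_apply i))
  have h2 : ((fun v : Fin a → Fin b → ℝ => (Matrix.of v : Matrix (Fin a) (Fin b) ℝ)) ⁻¹' s).Nonempty :=
    hne
  have : (volume : Measure (Fin a → Fin b → ℝ)).IsOpenPosMeasure :=
    Measure.pi.isOpenPosMeasure fun _ => volume
  exact (h1.measure_pos volume h2).ne'

lemma measurable_invWishartKernel (C : Matrix (Fin n) (Fin n) ℝ) (ν : ℝ) :
    Measurable (invWishartKernel C ν) :=
  (measurable_det.pow_const _).mul
    ((measurable_const.mul (measurable_const.matrix_mul' Matrix.measurable_inv).matrix_trace').exp)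

/-- The bounded neighbourhood of the identity used to compare Haar measures. -/
def posDefWindow (n : ℕ) : Set (Matrix (Fin n) (Fin n) ℝ) :=
  {P | 1 / 2 < P.det} ∩ {P | ∀ i j, |P i j| < 2}

lemma isOpen_posDefWindow : IsOpen (posDefWindow n) := by
  refine (isOpen_lt continuous_const (continuous_id.matrix_det)).inter ?_
  simp only [Set.ofPred_forall]
  exact isOpen_iInter_of_finite fun i => isOpen_iInter_of_finite fun j =>
    isOpen_lt (continuous_id.matrix_elem i j).abs continuous_const

/-- Together with `lintegral_window_ne_zero`, this makes the indicator of the window a test function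
`w` for `lintegral_posDefHaar_mul_eq`: its integral is finite over the cone and nonzero over the
group, so finiteness passes from the group to the cone. -/
lemma posDefHaar_window_lt_top :
    ∫⁻ P, (posDefWindow n).indicator 1 P ∂(posDefHaar n) < ∞ := by
  have hm := isOpen_posDefWindow (n := n).measurableSet
  rw [lintegral_indicator_one hm, posDefHaar, withDensity_apply _ hm]
  have h1 : posDefLebesgue n (posDefWindow n) < ∞ := by
    refine (Measure.restrict_apply_le _ _).trans_lt ?_
    rw [Measure.map_apply continuous_symFill.measurable hm]
    have hsub : symFill ⁻¹' (posDefWindow n) ⊆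
        Metric.closedBall (0 : {p : Fin n × Fin n // p.1 ≤ p.2} → ℝ) 2 := by
      intro v hv
      rw [mem_closedBall_zero_iff, pi_norm_le_iff_of_nonneg (by norm_num)]
      intro p
      have := hv.2 p.1.1 p.1.2
      rw [symFill_apply_of_le v p.2] at this
      exact this.le
    exact (measure_mono hsub).trans_lt Metric.isBounded_closedBall.measure_lt_top
  have h2 : ∫⁻ P in posDefWindow n, ENNReal.ofReal (P.det ^ (-((n : ℝ) + 1) / 2))
      ∂(posDefLebesgue n) ≤ ∫⁻ _ in posDefWindow n,
        ENNReal.ofReal ((1 / 2 : ℝ) ^ (-((n : ℝ) + 1) / 2)) ∂(posDefLebesgue n) := by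
    refine setLIntegral_mono measurable_const fun P hP => ENNReal.ofReal_le_ofReal ?_
    refine Real.rpow_le_rpow_of_nonpos (by norm_num) hP.1.le ?_
    have : (0 : ℝ) ≤ n := n.cast_nonneg
    linarith
  refine h2.trans_lt ?_
  rw [setLIntegral_const]
  exact ENNReal.mul_lt_top ENNReal.ofReal_lt_top h1

/-- The matrices `X` with `Xᵀ X` in the window form an open set containing the identity, on which
the Haar density is positive. -/
lemma lintegral_window_ne_zero :
    ∫⁻ X, (posDefWindow n).indicator 1 (Xᵀ * X) ∂(generalLinearHaar n) ≠ 0 := by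
  have hO : IsOpen ((fun X : Matrix (Fin n) (Fin n) ℝ => Xᵀ * X) ⁻¹' posDefWindow n) :=
    isOpen_posDefWindow.preimage (continuous_id.matrix_transpose.matrix_mul continuous_id)
  have hmem : (1 : Matrix (Fin n) (Fin n) ℝ) ∈
      (fun X : Matrix (Fin n) (Fin n) ℝ => Xᵀ * X) ⁻¹' posDefWindow n := by
    simp only [Set.mem_preimage, transpose_one, Matrix.one_mul]
    refine ⟨by simp; norm_num, fun i j => ?_⟩
    rw [one_apply]
    split_ifs <;> norm_num
  intro h0
  have hm : Measurable fun X : Matrix (Fin n) (Fin n) ℝ =>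
      (posDefWindow n).indicator (1 : Matrix (Fin n) (Fin n) ℝ → ℝ≥0∞) (Xᵀ * X) :=
    (measurable_one.indicator isOpen_posDefWindow.measurableSet).comp
      (measurable_id.matrix_transpose'.matrix_mul' measurable_id)
  rw [lintegral_eq_zero_iff hm, generalLinearHaar] at h0
  have h1 := (ae_withDensity_iff measurable_generalLinearHaar_density).1 h0
  refine isOpenPosMeasure_matrixLebesgue hO ⟨1, hmem⟩ (measure_mono_null ?_ h1)
  intro X hX
  have hX' : Xᵀ * X ∈ posDefWindow n := hX
  have hdet : X.det ≠ 0 := by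
    intro h
    have := hX'.1
    rw [Set.mem_ofPred_eq, det_mul, h, mul_zero] at this
    norm_num at this
  simp only [Set.mem_compl_iff, Set.mem_ofPred_eq, Pi.zero_apply, not_forall]
  refine ⟨?_, ?_⟩
  · rw [Ne, ENNReal.ofReal_eq_zero, not_le]
    have := abs_pos.2 hdet
    positivity
  · rw [Set.indicator_of_mem hX']
    simp

/-- Relative to `posDefHaar` the kernel is `|P|^{-ν/2} exp(-tr P⁻¹ / 2)`. At `P = X⁻ᵀ X⁻¹` it
becomes `|det X|^ν exp(-tr (X Xᵀ) / 2)`, so on the group one has to integrate `|det X|^{ν - n}`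
against a Gaussian. -/
lemma lintegral_invWishartKernel_one_lt_top {ν : ℝ} (hν : (n : ℝ) < ν) :
    ∫⁻ P, ENNReal.ofReal (invWishartKernel (1 : Matrix (Fin n) (Fin n) ℝ) ν P)
      ∂(posDefLebesgue n) < ∞ := by
  let f : Matrix (Fin n) (Fin n) ℝ → ℝ := fun P =>
    P.det ^ (-ν / 2) * Real.exp (-(1 / 2) * (P⁻¹).trace)
  have hf : Measurable f := (measurable_det.pow_const _).mul
    ((measurable_const.mul Matrix.measurable_inv.matrix_trace').exp)
  have h1 : ∫⁻ P, ENNReal.ofReal (invWishartKernel (1 : Matrix (Fin n) (Fin n) ℝ) ν P)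
      ∂(posDefLebesgue n) = ∫⁻ P, ENNReal.ofReal (f P) ∂(posDefHaar n) := by
    rw [posDefHaar, lintegral_withDensity_eq_lintegral_mul _ measurable_posDefHaar_density
      hf.ennreal_ofReal]
    refine lintegral_congr_ae ?_
    filter_upwards [ae_posDef] with P hP
    have hd := hP.det_pos
    rw [Pi.mul_apply, ← ENNReal.ofReal_mul (by positivity)]
    congr 1
    simp only [invWishartKernel, f, Matrix.one_mul]
    rw [← mul_assoc, ← Real.rpow_add hd]
    congr 2
    ring
  have h2 := lintegral_posDefHaar_mul_eq hf.ennreal_ofReal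
    (measurable_one.indicator (isOpen_posDefWindow (n := n)).measurableSet)
  have h3 : ∫⁻ X, ENNReal.ofReal (f (X⁻¹ᵀ * X⁻¹)) ∂(generalLinearHaar n) < ∞ := by
    have hm : Measurable fun X : Matrix (Fin n) (Fin n) ℝ =>
        ENNReal.ofReal (f (X⁻¹ᵀ * X⁻¹)) :=
      (hf.comp (Matrix.measurable_inv.matrix_transpose'.matrix_mul' Matrix.measurable_inv)).ennreal_ofReal
    obtain ⟨c, hc, hle⟩ := rpow_abs_det_le (n := n) (sub_pos.2 hν)
    have h4 : ∫⁻ X, ENNReal.ofReal (f (X⁻¹ᵀ * X⁻¹)) ∂(generalLinearHaar n) ≤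
        ∫⁻ X, ENNReal.ofReal (c * Real.exp (-(1 / 4) * (X * Xᵀ).trace)) ∂(matrixLebesgue n n) := by
      have h5 : ∀ᵐ X ∂(generalLinearHaar n), ENNReal.ofReal (f (X⁻¹ᵀ * X⁻¹)) ≤
          ENNReal.ofReal (|X.det| ^ n * (c * Real.exp (-(1 / 4) * (X * Xᵀ).trace))) := by
        filter_upwards [ae_det_ne_zero_generalLinearHaar] with X hX
        have hX0 : 0 < |X.det| := abs_pos.2 hX
        refine ENNReal.ofReal_le_ofReal ?_
        have e1 : (X⁻¹ᵀ * X⁻¹).det = |X.det| ^ (-2 : ℝ) := by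
          rw [det_mul, det_transpose, det_nonsing_inv, Ring.inverse_eq_inv', ← mul_inv,
            Real.rpow_neg hX0.le, Real.rpow_two, sq_abs, sq]
        have e2 : (X⁻¹ᵀ * X⁻¹)⁻¹ = X * Xᵀ := by
          rw [Matrix.mul_inv_rev, transpose_nonsing_inv,
            nonsing_inv_nonsing_inv _ (isUnit_iff_ne_zero.2 hX),
            nonsing_inv_nonsing_inv _ (by rw [det_transpose]; exact isUnit_iff_ne_zero.2 hX)]
        simp only [f]
        rw [e1, e2, ← Real.rpow_mul hX0.le]
        -- The power `n` cancels against the Haar density; the positive rest `ν - n` is absorbed by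
        -- half of the exponential.
        have e3 : (-2 : ℝ) * (-ν / 2) = n + (ν - n) := by ring
        rw [e3, Real.rpow_add hX0, Real.rpow_natCast, mul_assoc]
        refine mul_le_mul_of_nonneg_left ?_ (by positivity)
        have e4 : -(1 / 4) * (X * Xᵀ).trace =
            1 / 4 * (X * Xᵀ).trace + -(1 / 2) * (X * Xᵀ).trace := by ring
        rw [e4, Real.exp_add, ← mul_assoc]
        exact mul_le_mul_of_nonneg_right (hle X) (Real.exp_pos _).le
      refine (lintegral_mono_ae h5).trans ?_
      have hm2 : Measurable fun X : Matrix (Fin n) (Fin n) ℝ =>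
          ENNReal.ofReal (|X.det| ^ n * (c * Real.exp (-(1 / 4) * (X * Xᵀ).trace))) :=
        ((measurable_det.abs.pow_const n).mul (measurable_const.mul (measurable_const.mul
          (measurable_id.matrix_mul' measurable_id.matrix_transpose').matrix_trace').exp)).ennreal_ofReal
      rw [generalLinearHaar, lintegral_withDensity_eq_lintegral_mul _
        measurable_generalLinearHaar_density hm2]
      refine lintegral_mono fun X => ?_
      rw [Pi.mul_apply, ← ENNReal.ofReal_mul (by positivity), ← mul_assoc]
      refine ENNReal.ofReal_le_ofReal ?_
      refine mul_le_of_le_one_left (by positivity) ?_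
      exact inv_mul_le_one
    refine h4.trans_lt ?_
    exact ((integrable_exp_neg_trace (by norm_num : (0 : ℝ) < 1 / 4)).const_mul c).lintegral_lt_top
  rw [h1]
  have h6 := ENNReal.mul_lt_top (posDefHaar_window_lt_top (n := n)) h3
  rw [← h2] at h6
  -- An infinite integral over the cone, multiplied by the nonzero window integral, would make the
  -- finite product infinite.
  by_contra h7
  rw [not_lt, top_le_iff] at h7
  rw [h7, ENNReal.top_mul lintegral_window_ne_zero] at h6
  exact h6.false

end Finiteness

/-! ### The inverse-Wishart kernel for a general scale matrix. -/

section Kernel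

variable {n : ℕ}

lemma invWishartKernel_pos (C : Matrix (Fin n) (Fin n) ℝ) (ν : ℝ) {P : Matrix (Fin n) (Fin n) ℝ}
    (hP : P.PosDef) : 0 < invWishartKernel C ν P :=
  mul_pos (Real.rpow_pos_of_pos hP.det_pos _) (Real.exp_pos _)

lemma trace_congr_mul_inv {L : Matrix (Fin n) (Fin n) ℝ} (hL : L.det ≠ 0)
    (C P : Matrix (Fin n) (Fin n) ℝ) :
    (L * C * Lᵀ * (L * P * Lᵀ)⁻¹).trace = (C * P⁻¹).trace := by
  have hu : IsUnit L.det := isUnit_iff_ne_zero.2 hL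
  have hu' : IsUnit Lᵀ.det := by rwa [det_transpose]
  rw [Matrix.mul_inv_rev, Matrix.mul_inv_rev, Matrix.mul_assoc, ← Matrix.mul_assoc Lᵀ,
    mul_nonsing_inv _ hu', Matrix.one_mul, trace_mul_comm, Matrix.mul_assoc, ← Matrix.mul_assoc L⁻¹,
    nonsing_inv_mul _ hu, Matrix.one_mul, trace_mul_comm]

lemma invWishartKernel_congr {L : Matrix (Fin n) (Fin n) ℝ} (hL : L.det ≠ 0)
    (C : Matrix (Fin n) (Fin n) ℝ) (ν : ℝ) {P : Matrix (Fin n) (Fin n) ℝ} (hP : P.PosDef) :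
    invWishartKernel (L * C * Lᵀ) ν (L * P * Lᵀ) =
      |L.det| ^ (-(ν + n + 1)) * invWishartKernel C ν P := by
  rw [invWishartKernel, invWishartKernel, trace_congr_mul_inv hL,
    det_congr_rpow hP.det_pos.le, mul_assoc]
  congr 2
  ring

/-- The congruence `P ↦ L P Lᵀ`, with `C = L Lᵀ`, reduces the scale `C` to the identity. -/
lemma integrable_invWishartKernel {C : Matrix (Fin n) (Fin n) ℝ} (hC : C.PosDef) {ν : ℝ}
    (hν : (n : ℝ) < ν) : Integrable (invWishartKernel C ν) (posDefLebesgue n) := by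
  obtain ⟨L, hL, rfl⟩ := hC.exists_eq_mul_transpose
  have h1 : Integrable (invWishartKernel (1 : Matrix (Fin n) (Fin n) ℝ) ν) (posDefLebesgue n) := by
    refine ⟨(measurable_invWishartKernel _ _).aestronglyMeasurable, ?_⟩
    rw [hasFiniteIntegral_iff_ofReal]
    · exact lintegral_invWishartKernel_one_lt_top hν
    · filter_upwards [ae_posDef] with P hP
      exact (invWishartKernel_pos _ _ hP).le
  have hc : ENNReal.ofReal |(L.det ^ (n + 1))⁻¹| ≠ 0 := by
    rw [Ne, ENNReal.ofReal_eq_zero, not_le, abs_pos]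
    exact inv_ne_zero (pow_ne_zero _ hL)
  have h2 : Integrable (invWishartKernel (L * Lᵀ) ν)
      ((posDefLebesgue n).map fun P => L * P * Lᵀ) := by
    rw [integrable_map_measure (measurable_invWishartKernel _ _).aestronglyMeasurable
      (measurable_congr L).aemeasurable]
    refine (h1.const_mul (|L.det| ^ (-(ν + n + 1)))).congr ?_
    filter_upwards [ae_posDef] with P hP
    rw [Function.comp_apply, ← invWishartKernel_congr hL 1 ν hP, Matrix.mul_one]
  rw [map_congr_posDefLebesgue hL, integrable_smul_measure hc ENNReal.ofReal_ne_top] at h2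
  exact h2

/-- The same congruence with constants kept. The dependence `|C|^{-ν/2}` is all that is needed of
the normalizer, whose value at the identity is never computed. -/
lemma integral_invWishartKernel {C : Matrix (Fin n) (Fin n) ℝ} (hC : C.PosDef) (ν : ℝ) :
    ∫ P, invWishartKernel C ν P ∂(posDefLebesgue n) = C.det ^ (-ν / 2) *
      ∫ P, invWishartKernel (1 : Matrix (Fin n) (Fin n) ℝ) ν P ∂(posDefLebesgue n) := by
  obtain ⟨L, hL, rfl⟩ := hC.exists_eq_mul_transpose
  have h0 : 0 < |L.det| := abs_pos.2 hL
  have h1 := integral_map (μ := posDefLebesgue n) (measurable_congr L).aemeasurable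
    (measurable_invWishartKernel (L * Lᵀ) ν).aestronglyMeasurable
  rw [map_congr_posDefLebesgue hL, integral_smul_measure, smul_eq_mul,
    ENNReal.toReal_ofReal (abs_nonneg _)] at h1
  have h2 : ∫ P, invWishartKernel (L * Lᵀ) ν (L * P * Lᵀ) ∂(posDefLebesgue n) =
      |L.det| ^ (-(ν + n + 1)) *
        ∫ P, invWishartKernel (1 : Matrix (Fin n) (Fin n) ℝ) ν P ∂(posDefLebesgue n) := by
    rw [← integral_const_mul]
    refine integral_congr_ae ?_
    filter_upwards [ae_posDef] with P hP
    rw [← invWishartKernel_congr hL 1 ν hP, Matrix.mul_one]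
  rw [h2, abs_inv, abs_pow, ← Real.rpow_natCast, ← Real.rpow_neg h0.le] at h1
  have h3 : (L * Lᵀ).det ^ (-ν / 2) = |L.det| ^ (-ν) := by
    have := det_congr_rpow (L := L) (P := 1) (by simp) (-ν / 2)
    rw [Matrix.mul_one, det_one, Real.one_rpow, mul_one] at this
    rw [this]
    congr 1
    ring
  have h4 : |L.det| ^ ((n + 1 : ℕ) : ℝ) * |L.det| ^ (-((n + 1 : ℕ) : ℝ)) = 1 := by
    rw [← Real.rpow_add h0, add_neg_cancel, Real.rpow_zero]
  have h5 : |L.det| ^ (-ν) = |L.det| ^ ((n + 1 : ℕ) : ℝ) * |L.det| ^ (-(ν + n + 1)) := by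
    rw [← Real.rpow_add h0]
    congr 1
    push_cast
    ring
  rw [h3, h5, mul_assoc, ← h1, ← mul_assoc, h4, one_mul]

lemma integral_invWishartKernel_pos {C : Matrix (Fin n) (Fin n) ℝ} (hC : C.PosDef) {ν : ℝ}
    (hν : (n : ℝ) < ν) : 0 < ∫ P, invWishartKernel C ν P ∂(posDefLebesgue n) := by
  have hae : ∀ᵐ P ∂(posDefLebesgue n), 0 < invWishartKernel C ν P := by
    filter_upwards [ae_posDef] with P hP
    exact invWishartKernel_pos _ _ hP
  have hnn : 0 ≤ᵐ[posDefLebesgue n] invWishartKernel C ν := hae.mono fun _ h => h.le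
  refine lt_of_le_of_ne (integral_nonneg_of_ae hnn) fun h => ?_
  have h1 := (integral_eq_zero_iff_of_nonneg_ae hnn (integrable_invWishartKernel hC hν)).1 h.symm
  have h2 : ∀ᵐ P ∂(posDefLebesgue n), False := by
    filter_upwards [hae, h1] with P h3 h4
    rw [h4] at h3
    exact lt_irrefl _ h3
  rw [Filter.eventually_false_iff_eq_bot, ae_eq_bot] at h2
  exact posDefLebesgue_ne_zero h2

end Kernel

end

noncomputable section

/-! ### Moments and the inverse-Wishart law -/

section Expectation

variable {α : Type*} [MeasurableSpace α] {a b n : ℕ} {q : Measure α}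

lemma integrable_trace_mul {F : α → Matrix (Fin a) (Fin b) ℝ} (hF : MatrixIntegrable q F)
    (D : Matrix (Fin b) (Fin a) ℝ) : Integrable (fun x => (D * F x).trace) q := by
  simp only [trace, diag_apply, mul_apply]
  exact integrable_finsetSum _ fun i _ => integrable_finsetSum _ fun j _ =>
    (hF j i).const_mul _

lemma matrixExpect_apply (F : α → Matrix (Fin a) (Fin b) ℝ) (i : Fin a) (j : Fin b) :
    matrixExpect q F i j = ∫ x, F x i j ∂q := rfl

lemma integral_trace_mul {F : α → Matrix (Fin a) (Fin b) ℝ} (hF : MatrixIntegrable q F)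
    (D : Matrix (Fin b) (Fin a) ℝ) :
    ∫ x, (D * F x).trace ∂q = (D * matrixExpect q F).trace := by
  simp only [trace, diag_apply, mul_apply, matrixExpect_apply]
  rw [integral_finsetSum _ fun i _ => integrable_finsetSum _ fun j _ => (hF j i).const_mul (D i j)]
  refine Finset.sum_congr rfl fun i _ => ?_
  rw [integral_finsetSum _ fun j _ => (hF j i).const_mul (D i j)]
  exact Finset.sum_congr rfl fun j _ => integral_const_mul _ _

lemma abs_apply_le_trace_mul {C : Matrix (Fin n) (Fin n) ℝ} {c : ℝ} (hc : 0 < c)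
    (hC : (C - c • 1).PosSemidef) {K : Matrix (Fin n) (Fin n) ℝ} (hK : K.PosSemidef)
    (i j : Fin n) : |K i j| ≤ c⁻¹ * (C * K).trace := by
  have h1 := hC.trace_mul_nonneg hK
  rw [Matrix.sub_mul, trace_sub, Matrix.smul_mul, Matrix.one_mul, trace_smul, smul_eq_mul] at h1
  have h2 := hK.abs_apply_le_trace i j
  rw [← div_eq_inv_mul, le_div_iff₀ hc]
  nlinarith

/-- Integrability of a positive semidefinite matrix function against a definite weight. -/
lemma matrixIntegrable_of_trace {F : α → Matrix (Fin n) (Fin n) ℝ} (hFm : Measurable F)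
    (hF : ∀ᵐ x ∂q, (F x).PosSemidef) {C : Matrix (Fin n) (Fin n) ℝ} (hC : C.PosDef)
    (h : Integrable (fun x => (C * F x).trace) q) : MatrixIntegrable q F := by
  obtain ⟨c, hc, hCc⟩ := hC.exists_smul_one_le
  intro i j
  refine (h.const_mul c⁻¹).mono' ((Matrix.measurable_apply i j).comp hFm).aestronglyMeasurable ?_
  filter_upwards [hF] with x hx
  exact abs_apply_le_trace_mul hc hCc hx i j

lemma trace_nonneg_of_posDef {C P : Matrix (Fin n) (Fin n) ℝ} (hC : C.PosSemidef)
    (hP : P.PosDef) : 0 ≤ (C * P⁻¹).trace :=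
  hC.trace_mul_nonneg hP.inv.posSemidef

lemma matrixExpect_transpose_eq {F : α → Matrix (Fin n) (Fin n) ℝ}
    (h : ∀ᵐ x ∂q, (F x)ᵀ = F x) : (matrixExpect q F)ᵀ = matrixExpect q F := by
  ext i j
  refine integral_congr_ae ?_
  filter_upwards [h] with x hx
  rw [← transpose_apply (F x), hx]

lemma dotProduct_matrixExpect {F : α → Matrix (Fin n) (Fin n) ℝ} (hF : MatrixIntegrable q F)
    (x : Fin n → ℝ) :
    x ⬝ᵥ (matrixExpect q F *ᵥ x) = ∫ y, x ⬝ᵥ (F y *ᵥ x) ∂q := by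
  simp only [dotProduct, mulVec, matrixExpect_apply, Finset.mul_sum]
  rw [integral_finsetSum _ fun i _ => integrable_finsetSum _ fun j _ =>
    ((hF i j).mul_const _).const_mul _]
  refine Finset.sum_congr rfl fun i _ => ?_
  rw [integral_finsetSum _ fun j _ => ((hF i j).mul_const _).const_mul _]
  refine Finset.sum_congr rfl fun j _ => ?_
  rw [integral_const_mul, integral_mul_const]

lemma integrable_dotProduct_mulVec {F : α → Matrix (Fin n) (Fin n) ℝ}
    (hF : MatrixIntegrable q F) (x : Fin n → ℝ) :
    Integrable (fun y => x ⬝ᵥ (F y *ᵥ x)) q := by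
  simp only [dotProduct, mulVec, Finset.mul_sum]
  exact integrable_finsetSum _ fun i _ => integrable_finsetSum _ fun j _ =>
    ((hF i j).mul_const _).const_mul _

lemma posSemidef_matrixExpect {F : α → Matrix (Fin n) (Fin n) ℝ} (hF : MatrixIntegrable q F)
    (h : ∀ᵐ x ∂q, (F x).PosSemidef) : (matrixExpect q F).PosSemidef := by
  refine PosSemidef.of_dotProduct_mulVec_nonneg ?_ fun x => ?_
  · rw [IsHermitian, conjTranspose_eq_transpose_of_trivial]
    refine matrixExpect_transpose_eq (h.mono fun x hx => ?_)
    simpa [IsHermitian] using hx.1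
  · rw [star_trivial, dotProduct_matrixExpect hF]
    exact integral_nonneg_of_ae (h.mono fun y hy => by simpa using hy.dotProduct_mulVec_nonneg x)

/-- Each quadratic form of the mean integrates an almost surely positive function against a
probability law, so it cannot vanish. -/
lemma posDef_matrixExpect [IsProbabilityMeasure q] {F : α → Matrix (Fin n) (Fin n) ℝ}
    (hF : MatrixIntegrable q F) (h : ∀ᵐ x ∂q, (F x).PosDef) : (matrixExpect q F).PosDef := by
  refine PosDef.of_dotProduct_mulVec_pos
    (posSemidef_matrixExpect hF (h.mono fun x hx => hx.posSemidef)).1 fun x hx => ?_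
  rw [star_trivial, dotProduct_matrixExpect hF]
  have h1 : ∀ᵐ y ∂q, 0 < x ⬝ᵥ (F y *ᵥ x) := h.mono fun y hy => by
    simpa using hy.dotProduct_mulVec_pos hx
  have h2 : 0 ≤ᵐ[q] fun y => x ⬝ᵥ (F y *ᵥ x) := h1.mono fun y hy => hy.le
  refine lt_of_le_of_ne (integral_nonneg_of_ae h2) fun h3 => ?_
  have h4 := (integral_eq_zero_iff_of_nonneg_ae h2 (integrable_dotProduct_mulVec hF x)).1 h3.symm
  have h5 : ∀ᵐ _ ∂q, False := by
    filter_upwards [h1, h4] with y h6 h7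
    rw [h7] at h6
    exact lt_irrefl _ h6
  rw [Filter.eventually_false_iff_eq_bot, ae_eq_bot] at h5
  exact IsProbabilityMeasure.ne_zero q h5

end Expectation

/-! ### The inverse-Wishart law and the mean of the inverse. -/

section InvWishart

variable {n : ℕ} {C : Matrix (Fin n) (Fin n) ℝ} {ν : ℝ}

lemma measurable_invWishartDensity (C : Matrix (Fin n) (Fin n) ℝ) (ν : ℝ) :
    Measurable (invWishartDensity C ν) :=
  (measurable_invWishartKernel C ν).const_mul _

lemma invWishartDensity_pos (hC : C.PosDef) (hν : (n : ℝ) < ν) {P : Matrix (Fin n) (Fin n) ℝ}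
    (hP : P.PosDef) : 0 < invWishartDensity C ν P :=
  mul_pos (inv_pos.2 (integral_invWishartKernel_pos hC hν)) (invWishartKernel_pos C ν hP)

lemma integrable_invWishartDensity (hC : C.PosDef) (hν : (n : ℝ) < ν) :
    Integrable (invWishartDensity C ν) (posDefLebesgue n) :=
  (integrable_invWishartKernel hC hν).const_mul _

lemma isProbabilityMeasure_invWishart (hC : C.PosDef) (hν : (n : ℝ) < ν) :
    IsProbabilityMeasure (invWishart C ν) := by
  constructor
  rw [invWishart, withDensity_apply _ MeasurableSet.univ, Measure.restrict_univ,
    ← ofReal_integral_eq_lintegral_ofReal (integrable_invWishartDensity hC hν)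
      (ae_posDef.mono fun P hP => (invWishartDensity_pos hC hν hP).le)]
  have : ∫ P, invWishartDensity C ν P ∂(posDefLebesgue n) = 1 := by
    simp only [invWishartDensity]
    rw [integral_const_mul, inv_mul_cancel₀ (integral_invWishartKernel_pos hC hν).ne']
  rw [this, ENNReal.ofReal_one]

lemma ae_posDef_invWishart : ∀ᵐ P ∂(invWishart C ν), P.PosDef :=
  (withDensity_absolutelyContinuous _ _).ae_le ae_posDef

lemma integrable_invWishart_iff (hC : C.PosDef) (hν : (n : ℝ) < ν)
    {g : Matrix (Fin n) (Fin n) ℝ → ℝ} :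
    Integrable g (invWishart C ν) ↔
      Integrable (fun P => invWishartKernel C ν P * g P) (posDefLebesgue n) := by
  rw [invWishart, integrable_withDensity_iff_integrable_smul'
    (measurable_invWishartDensity C ν).ennreal_ofReal
    (Filter.Eventually.of_forall fun _ => ENNReal.ofReal_lt_top)]
  have h0 := integral_invWishartKernel_pos hC hν
  rw [← integrable_const_mul_iff (isUnit_iff_ne_zero.2 (inv_ne_zero h0.ne'))
    (fun P => invWishartKernel C ν P * g P)]
  refine integrable_congr ?_
  filter_upwards [ae_posDef] with P hP
  rw [ENNReal.toReal_ofReal (invWishartDensity_pos hC hν hP).le, invWishartDensity, smul_eq_mul,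
    mul_assoc]

lemma integral_invWishart (hC : C.PosDef) (hν : (n : ℝ) < ν)
    (g : Matrix (Fin n) (Fin n) ℝ → ℝ) :
    ∫ P, g P ∂(invWishart C ν) = (∫ P, invWishartKernel C ν P ∂(posDefLebesgue n))⁻¹ *
      ∫ P, invWishartKernel C ν P * g P ∂(posDefLebesgue n) := by
  rw [invWishart, integral_withDensity_eq_integral_toReal_smul
    (measurable_invWishartDensity C ν).ennreal_ofReal
    (Filter.Eventually.of_forall fun _ => ENNReal.ofReal_lt_top), ← integral_const_mul]
  refine integral_congr_ae ?_
  filter_upwards [ae_posDef] with P hP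
  rw [ENNReal.toReal_ofReal (invWishartDensity_pos hC hν hP).le, invWishartDensity, smul_eq_mul,
    mul_assoc]

/-- Exponential tilting by a quarter of the trace stays in the family, with scale `C / 2`. As `x ≤ 4
exp (x / 4)`, this dominates the first moment, and it feeds the entropy inequality later. -/
lemma invWishartKernel_half_mul_exp (C : Matrix (Fin n) (Fin n) ℝ) (ν : ℝ)
    (P : Matrix (Fin n) (Fin n) ℝ) :
    invWishartKernel C ν P * Real.exp (1 / 4 * (C * P⁻¹).trace) =
      invWishartKernel ((1 / 2 : ℝ) • C) ν P := by
  rw [invWishartKernel, invWishartKernel, mul_assoc, ← Real.exp_add, Matrix.smul_mul, trace_smul,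
    smul_eq_mul]
  congr 2
  ring

lemma matrixIntegrable_inv_invWishart (hC : C.PosDef) (hν : (n : ℝ) < ν) :
    MatrixIntegrable (invWishart C ν) fun P => P⁻¹ := by
  refine matrixIntegrable_of_trace Matrix.measurable_inv
    (ae_posDef_invWishart.mono fun P hP => hP.inv.posSemidef) hC ?_
  rw [integrable_invWishart_iff hC hν]
  have h1 : ((1 / 2 : ℝ) • C).PosDef := hC.smul (by norm_num)
  refine ((integrable_invWishartKernel h1 hν).const_mul 4).mono'
    ((measurable_invWishartKernel C ν).mul
      (measurable_const.matrix_mul' Matrix.measurable_inv).matrix_trace').aestronglyMeasurable ?_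
  filter_upwards [ae_posDef] with P hP
  have h2 := invWishartKernel_pos C ν hP
  have h3 := trace_nonneg_of_posDef hC.posSemidef hP
  rw [Real.norm_of_nonneg (by positivity), ← invWishartKernel_half_mul_exp]
  have h4 := Real.add_one_le_exp (1 / 4 * (C * P⁻¹).trace)
  nlinarith

lemma eventually_posDef_add_smul (hC : C.PosDef) {D : Matrix (Fin n) (Fin n) ℝ} (hD : Dᵀ = D) :
    ∀ᶠ t : ℝ in nhds 0, (C + t • D).PosDef := by
  obtain ⟨L, hL, rfl⟩ := hC.exists_eq_mul_transpose
  have hu : IsUnit L.det := isUnit_iff_ne_zero.2 hL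
  have h1 : ∀ t : ℝ, L * Lᵀ + t • D = L * (1 + t • (L⁻¹ * D * L⁻¹ᵀ)) * Lᵀ := by
    intro t
    rw [Matrix.mul_add, Matrix.add_mul, Matrix.mul_one, Matrix.mul_smul, Matrix.smul_mul,
      transpose_nonsing_inv]
    congr 2
    rw [← Matrix.mul_assoc, ← Matrix.mul_assoc, mul_nonsing_inv _ hu, Matrix.one_mul,
      Matrix.mul_assoc, nonsing_inv_mul _ (by rwa [det_transpose]), Matrix.mul_one]
  have h2 : ∀ i j, ∀ᶠ t : ℝ in nhds 0, |t * (L⁻¹ * D * L⁻¹ᵀ) i j| < 1 / (n + 1) := by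
    intro i j
    have hc : Continuous fun t : ℝ => |t * (L⁻¹ * D * L⁻¹ᵀ) i j| := by fun_prop
    refine hc.tendsto 0 |>.eventually (gt_mem_nhds ?_)
    simp only [zero_mul, abs_zero]
    positivity
  filter_upwards [Filter.eventually_all.2 fun i => Filter.eventually_all.2 (h2 i)] with t ht
  rw [h1, posDef_congr_iff hL]
  refine posDef_of_forall_abs_sub_one_le ?_ fun i j => ?_
  · simp [transpose_mul, hD, Matrix.mul_assoc]
  · simpa using (ht i j).le

/-- Jacobi's formula, from `det (1 + t M) = 1 + t tr M + t² (polynomial in t)` with `M = C⁻¹ D`. -/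
lemma hasDerivAt_det_add_smul (hC : C.PosDef) (D : Matrix (Fin n) (Fin n) ℝ) :
    HasDerivAt (fun t : ℝ => (C + t • D).det) (C.det * (C⁻¹ * D).trace) 0 := by
  have hu : IsUnit C.det := isUnit_iff_ne_zero.2 hC.det_pos.ne'
  have h1 : (fun t : ℝ => (C + t • D).det) = fun t => C.det * (1 + t • (C⁻¹ * D)).det := by
    ext t
    rw [← det_mul, Matrix.mul_add, Matrix.mul_one, Matrix.mul_smul, ← Matrix.mul_assoc,
      mul_nonsing_inv _ hu, Matrix.one_mul]
  rw [h1]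
  refine HasDerivAt.const_mul _ ?_
  rw [funext fun t => det_one_add_smul t (C⁻¹ * D)]
  have h2 := (((hasDerivAt_id (0 : ℝ)).const_mul (C⁻¹ * D).trace).const_add 1).add
    ((Polynomial.hasDerivAt (det (1 + (Polynomial.X : Polynomial ℝ) •
      (C⁻¹ * D).map Polynomial.C)).divX.divX 0).mul ((hasDerivAt_id (0 : ℝ)).pow 2))
  refine h2.congr_deriv ?_
  simp

/-- The mean of `P⁻¹` under the inverse-Wishart law. -/
lemma matrixExpect_inv_invWishart (hC : C.PosDef) (hν : (n : ℝ) < ν) :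
    matrixExpect (invWishart C ν) (fun P => P⁻¹) = ν • C⁻¹ := by
  have hint := matrixIntegrable_inv_invWishart hC hν
  have hprob := isProbabilityMeasure_invWishart hC hν
  obtain ⟨V, hV⟩ : ∃ V, V = matrixExpect (invWishart C ν) fun P => P⁻¹ := ⟨_, rfl⟩
  rw [← hV]
  have hdet := hC.det_pos
  -- The right-hand side is the Laplace transform `E[exp(-tr (D P⁻¹) / 2)]`, a ratio of two
  -- normalizers; the left-hand side is its lower bound by Jensen.
  have key : ∀ D : Matrix (Fin n) (Fin n) ℝ, (C + D).PosDef →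
      Real.exp (-(1 / 2) * (D * V).trace) ≤ C.det ^ (ν / 2) * (C + D).det ^ (-ν / 2) := by
    intro D hD
    have h1 : ∀ P, invWishartKernel C ν P * Real.exp (-(1 / 2) * (D * P⁻¹).trace) =
        invWishartKernel (C + D) ν P := by
      intro P
      rw [invWishartKernel, invWishartKernel, mul_assoc, ← Real.exp_add, Matrix.add_mul, trace_add]
      congr 2
      ring
    have h2 : ∫ P, Real.exp (-(1 / 2) * (D * P⁻¹).trace) ∂(invWishart C ν) =
        C.det ^ (ν / 2) * (C + D).det ^ (-ν / 2) := by
      rw [integral_invWishart hC hν]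
      simp_rw [h1]
      rw [integral_invWishartKernel hC, integral_invWishartKernel hD]
      have h3 := integral_invWishartKernel_pos (PosDef.one (n := Fin n) (R := ℝ)) hν
      have h4 : C.det ^ (ν / 2) = (C.det ^ (-ν / 2))⁻¹ := by
        rw [neg_div, Real.rpow_neg hdet.le, inv_inv]
      have h5 : C.det ^ (-ν / 2) ≠ 0 := (Real.rpow_pos_of_pos hdet _).ne'
      rw [h4]
      field_simp
    have h6 : Integrable (fun P => Real.exp (-(1 / 2) * (D * P⁻¹).trace)) (invWishart C ν) := by
      rw [integrable_invWishart_iff hC hν]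
      simp_rw [h1]
      exact integrable_invWishartKernel hD hν
    -- The tangent line of the exponential at the mean: it integrates to the value there and lies
    -- below the exponential.
    have h7 : ∫ P, Real.exp (-(1 / 2) * (D * V).trace) *
        (-(1 / 2) * (D * P⁻¹).trace + (1 + 1 / 2 * (D * V).trace)) ∂(invWishart C ν) =
        Real.exp (-(1 / 2) * (D * V).trace) := by
      have hi := (integrable_trace_mul hint D).const_mul (-(1 / 2))
      rw [integral_const_mul, integral_add hi (integrable_const _), integral_const_mul,
        integral_trace_mul hint D, ← hV, integral_const, probReal_univ, one_smul]
      ring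
    rw [← h2, ← h7]
    refine integral_mono ?_ h6 fun P => ?_
    · exact (((integrable_trace_mul hint D).const_mul (-(1 / 2))).add
        (integrable_const _)).const_mul _
    · have h8 := Real.add_one_le_exp (-(1 / 2) * (D * P⁻¹).trace - -(1 / 2) * (D * V).trace)
      have h9 : Real.exp (-(1 / 2) * (D * P⁻¹).trace) = Real.exp (-(1 / 2) * (D * V).trace) *
          Real.exp (-(1 / 2) * (D * P⁻¹).trace - -(1 / 2) * (D * V).trace) := by
        rw [← Real.exp_add]
        congr 1
        ring
      simp only
      rw [h9]
      exact mul_le_mul_of_nonneg_left (by linarith) (Real.exp_pos _).le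
  have key2 : ∀ D : Matrix (Fin n) (Fin n) ℝ, Dᵀ = D → (D * V).trace = ν * (C⁻¹ * D).trace := by
    intro D hD
    have d1 := hasDerivAt_det_add_smul hC D
    have d2 : HasDerivAt (fun t : ℝ => Real.exp (-(1 / 2) * (t * (D * V).trace)))
        (-(1 / 2) * (D * V).trace) 0 := by
      have := (((hasDerivAt_id (0 : ℝ)).mul_const (D * V).trace).const_mul (-(1 / 2))).exp
      simpa using this
    have d3 : HasDerivAt (fun t : ℝ => C.det ^ (ν / 2) * (C + t • D).det ^ (-ν / 2))
        (-(ν / 2) * (C⁻¹ * D).trace) 0 := by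
      have h0 : (C + (0 : ℝ) • D).det ≠ 0 := by simpa using hdet.ne'
      refine ((d1.rpow_const (p := -ν / 2) (Or.inl h0)).const_mul (C.det ^ (ν / 2))).congr_deriv ?_
      rw [zero_smul, add_zero]
      have h1 : C.det ^ (ν / 2) * (C.det * C.det ^ (-ν / 2 - 1)) = 1 := by
        nth_rewrite 2 [← Real.rpow_one C.det]
        rw [← Real.rpow_add hdet, ← Real.rpow_add hdet]
        ring_nf
        exact Real.rpow_zero _
      linear_combination (-(ν / 2) * (C⁻¹ * D).trace) * h1
    -- Jensen's bound along `t D` is an equality at `t = 0`, so the two sides are tangent there and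
    -- their derivatives agree. No differentiation under the integral is needed.
    have hmax : IsLocalMax (fun t : ℝ => Real.exp (-(1 / 2) * (t * (D * V).trace)) -
        C.det ^ (ν / 2) * (C + t • D).det ^ (-ν / 2)) 0 := by
      filter_upwards [eventually_posDef_add_smul hC hD] with t ht
      have h1 := key (t • D) ht
      rw [Matrix.smul_mul, trace_smul, smul_eq_mul] at h1
      have h2 : C.det ^ (ν / 2) * C.det ^ (-ν / 2) = 1 := by
        rw [← Real.rpow_add hdet]
        ring_nf
        exact Real.rpow_zero _
      simp only [zero_mul, mul_zero, Real.exp_zero, zero_smul, add_zero, h2, sub_self]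
      linarith
    have := hmax.hasDerivAt_eq_zero (d2.sub d3)
    linarith
  have hVs : Vᵀ = V := by
    rw [hV]
    refine matrixExpect_transpose_eq (ae_posDef_invWishart.mono fun P hP => ?_)
    simpa [IsHermitian] using hP.inv.1
  have hCs : (C⁻¹)ᵀ = C⁻¹ := by simpa [IsHermitian] using hC.inv.1
  ext i j
  -- Only symmetric directions stay in the cone. The symmetrized matrix units suffice because `V`
  -- and `C⁻¹` are symmetric.
  have h1 := key2 (single i j 1 + single j i 1) (by
    rw [transpose_add, transpose_single, transpose_single, add_comm])
  rw [Matrix.add_mul, Matrix.mul_add, trace_add, trace_add] at h1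
  have e1 : V j i = V i j := by rw [← transpose_apply V, hVs]
  have e2 : C⁻¹ j i = C⁻¹ i j := by rw [← transpose_apply C⁻¹, hCs]
  simp only [trace_mul_comm C⁻¹, trace_single_mul, smul_eq_mul, one_mul, e1, e2] at h1
  rw [Matrix.smul_apply, smul_eq_mul]
  linarith

end InvWishart

end

noncomputable section

/-! ### Gaussian matrices with independent columns -/

section Density

lemma map_withDensity_comp {α β : Type*} [MeasurableSpace α] [MeasurableSpace β] {ν : Measure α}
    {φ : α → β} (hφ : Measurable φ) {g : β → ℝ≥0∞} (hg : Measurable g) :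
    (ν.withDensity fun x => g (φ x)).map φ = (ν.map φ).withDensity g := by
  ext s hs
  rw [Measure.map_apply hφ hs, withDensity_apply _ (hφ hs), withDensity_apply _ hs,
    setLIntegral_map hs hg hφ]

lemma pi_withDensity_ofReal {ι E : Type*} [Fintype ι] [MeasurableSpace E] {μ : Measure E}
    [SigmaFinite μ] {f : ι → E → ℝ} (hf : ∀ i, Integrable (f i) μ) (hnn : ∀ i x, 0 ≤ f i x) :
    Measure.pi (fun i => μ.withDensity fun x => ENNReal.ofReal (f i x)) =
      (Measure.pi fun _ : ι => μ).withDensity fun x => ENNReal.ofReal (∏ i, f i (x i)) := by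
  have : ∀ i, IsFiniteMeasure (μ.withDensity fun x => ENNReal.ofReal (f i x)) := fun i =>
    isFiniteMeasure_withDensity_ofReal (hf i).2
  refine Measure.pi_eq fun s hs => ?_
  rw [withDensity_apply _ (MeasurableSet.univ_pi hs), Measure.restrict_pi_pi,
    ← ofReal_integral_eq_lintegral_ofReal
      (Integrable.fintype_prod (μ := fun i => μ.restrict (s i)) fun i => (hf i).restrict)
      (Filter.Eventually.of_forall fun x => Finset.prod_nonneg fun i _ => hnn i _),
    integral_fintype_prod_eq_prod (E := fun _ => E) (μ := fun i => μ.restrict (s i)) f,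
    ENNReal.ofReal_prod_of_nonneg fun i _ => integral_nonneg (hnn i)]
  refine Finset.prod_congr rfl fun i _ => ?_
  rw [withDensity_apply _ (hs i), ofReal_integral_eq_lintegral_ofReal (hf i).restrict
    (Filter.Eventually.of_forall (hnn i))]

variable {n N : ℕ}

lemma gaussianDensity_pos (μ : Fin n → ℝ) {S : Matrix (Fin n) (Fin n) ℝ} (hS : S.PosDef)
    (x : Fin n → ℝ) : 0 < gaussianDensity μ S x :=
  mul_pos (mul_pos (Real.rpow_pos_of_pos (by positivity) _)
    (Real.rpow_pos_of_pos hS.det_pos _)) (Real.exp_pos _)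

lemma continuous_gaussianDensity (μ : Fin n → ℝ) (S : Matrix (Fin n) (Fin n) ℝ) :
    Continuous (gaussianDensity μ S) := by
  have h : Continuous fun x : Fin n → ℝ => x - μ := continuous_id.sub continuous_const
  exact continuous_const.mul (Real.continuous_exp.comp (continuous_const.mul
    (h.dotProduct (continuous_const.matrix_mulVec h))))

lemma stdGaussian_pi_eq : Measure.pi (fun _ : Fin n => gaussianReal 0 1) =
    (volume : Measure (Fin n → ℝ)).withDensity fun z =>
      ENNReal.ofReal ((2 * Real.pi) ^ (-(n : ℝ) / 2) * Real.exp (-(1 / 2) * (z ⬝ᵥ z))) := by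
  have h1 : gaussianReal 0 1 = volume.withDensity fun x => ENNReal.ofReal
      (gaussianPDFReal 0 1 x) := gaussianReal_of_var_ne_zero 0 one_ne_zero
  simp_rw [h1]
  rw [pi_withDensity_ofReal (fun _ => integrable_gaussianPDFReal 0 1)
    (fun _ => gaussianPDFReal_nonneg 0 1)]
  congr 1
  ext z
  congr 1
  simp only [gaussianPDFReal, NNReal.coe_one, mul_one, sub_zero]
  rw [Finset.prod_mul_distrib, Finset.prod_const, Finset.card_univ, Fintype.card_fin,
    ← Real.exp_sum]
  congr 1
  · rw [Real.sqrt_eq_rpow, ← Real.rpow_neg (by positivity), ← Real.rpow_natCast,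
      ← Real.rpow_mul (by positivity)]
    congr 1
    ring
  · congr 1
    rw [dotProduct, Finset.mul_sum]
    refine Finset.sum_congr rfl fun i _ => ?_
    ring

-- The law is the image of the standard Gaussian under `z ↦ μ + L z` with `L` the symmetric square
-- root of `S`; change variables, with Jacobian `|det L| = |S|^{1/2}`.
open scoped MatrixOrder in
lemma multivariateGaussian_eq_map_withDensity (μ : Fin n → ℝ) {S : Matrix (Fin n) (Fin n) ℝ}
    (hS : S.PosDef) : multivariateGaussian (WithLp.toLp 2 μ) S =
      ((volume : Measure (Fin n → ℝ)).withDensity fun x =>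
        ENNReal.ofReal (gaussianDensity μ S x)).map (WithLp.toLp 2) := by
  obtain ⟨L, hLdef⟩ : ∃ L, L = CFC.sqrt S := ⟨_, rfl⟩
  have hLL : L * L = S := by rw [hLdef]; exact CFC.sqrt_mul_sqrt_self _ hS.posSemidef.nonneg
  have hLs : Lᵀ = L := by
    have := (CFC.sqrt_nonneg S).isSelfAdjoint
    rw [← hLdef] at this
    simpa [IsSelfAdjoint, star_eq_conjTranspose] using this
  have hdet : L.det * L.det = S.det := by rw [← det_mul, hLL]
  have hL : L.det ≠ 0 := by
    intro h
    rw [h, zero_mul] at hdet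
    exact hS.det_pos.ne hdet
  have h0 : 0 < |L.det| := abs_pos.2 hL
  have hu : IsUnit L.det := isUnit_iff_ne_zero.2 hL
  have hquad : ∀ z : Fin n → ℝ, (L *ᵥ z) ⬝ᵥ (S⁻¹ *ᵥ (L *ᵥ z)) = z ⬝ᵥ z := by
    intro z
    have h1 : S⁻¹ *ᵥ (L *ᵥ z) = L⁻¹ *ᵥ z := by
      rw [mulVec_mulVec, ← hLL, Matrix.mul_inv_rev, Matrix.mul_assoc, nonsing_inv_mul _ hu,
        Matrix.mul_one]
    rw [h1, dotProduct_mulVec, vecMul_mulVec, hLs, mul_nonsing_inv _ hu, vecMul_one]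
  have hφ : Measurable fun z : Fin n → ℝ => μ + L *ᵥ z :=
    (continuous_const.add (continuous_const.matrix_mulVec continuous_id)).measurable
  have hmap : (volume : Measure (Fin n → ℝ)).map (fun z => μ + L *ᵥ z) =
      ENNReal.ofReal |L.det⁻¹| • volume := by
    have h1 : (volume : Measure (Fin n → ℝ)).map (fun z => L *ᵥ z) =
      ENNReal.ofReal |L.det⁻¹| • volume := Real.map_matrix_volume_pi_eq_smul_volume_pi hL
    have h2 : (fun z : Fin n → ℝ => μ + L *ᵥ z) = (fun x => μ + x) ∘ fun z => L *ᵥ z := rfl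
    have h3 : Measurable fun z : Fin n → ℝ => L *ᵥ z :=
      (continuous_const.matrix_mulVec continuous_id).measurable
    rw [h2, ← Measure.map_map (measurable_const_add μ) h3, h1, Measure.map_smul,
      map_add_left_eq_self]
  have hdens : ∀ z : Fin n → ℝ, ENNReal.ofReal ((2 * Real.pi) ^ (-(n : ℝ) / 2) *
      Real.exp (-(1 / 2) * (z ⬝ᵥ z))) = ENNReal.ofReal |L.det| *
        ENNReal.ofReal (gaussianDensity μ S (μ + L *ᵥ z)) := by
    intro z
    rw [← ENNReal.ofReal_mul h0.le, gaussianDensity, add_sub_cancel_left, hquad]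
    congr 1
    have h1 : S.det ^ (-(1 : ℝ) / 2) = |L.det|⁻¹ := by
      rw [← hdet, ← abs_mul_abs_self, ← sq, ← Real.rpow_natCast, ← Real.rpow_mul h0.le,
        ← Real.rpow_neg_one]
      congr 1
      norm_num
    rw [h1]
    field_simp
  have hg := (continuous_gaussianDensity μ S).measurable.ennreal_ofReal
  have hpush : (Measure.pi (fun _ : Fin n => gaussianReal 0 1)).map (fun z => μ + L *ᵥ z) =
      (volume : Measure (Fin n → ℝ)).withDensity fun x =>
        ENNReal.ofReal (gaussianDensity μ S x) := by
    rw [stdGaussian_pi_eq, funext hdens,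
      map_withDensity_comp hφ (g := fun x => ENNReal.ofReal |L.det| *
        ENNReal.ofReal (gaussianDensity μ S x)) (hg.const_mul _), hmap]
    rw [withDensity_smul_measure]
    have h3 := withDensity_smul (μ := (volume : Measure (Fin n → ℝ))) (ENNReal.ofReal |L.det|) hg
    have h4 : (ENNReal.ofReal |L.det| • fun x => ENNReal.ofReal (gaussianDensity μ S x)) =
        fun x => ENNReal.ofReal |L.det| * ENNReal.ofReal (gaussianDensity μ S x) := rfl
    rw [h4] at h3
    rw [h3, smul_smul, ← ENNReal.ofReal_mul (abs_nonneg _), abs_inv, inv_mul_cancel₀ h0.ne',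
      ENNReal.ofReal_one, one_smul]
  rw [multivariateGaussian, ← map_pi_eq_stdGaussian, ← hLdef, ← hpush,
    Measure.map_map (by fun_prop) (by fun_prop), Measure.map_map (by fun_prop) hφ]
  congr 1

lemma gaussianDensity_integrable (μ : Fin n → ℝ) {S : Matrix (Fin n) (Fin n) ℝ}
    (hS : S.PosDef) : Integrable (gaussianDensity μ S) := by
  refine ⟨(continuous_gaussianDensity μ S).aestronglyMeasurable, ?_⟩
  rw [hasFiniteIntegral_iff_ofReal
    (Filter.Eventually.of_forall fun x => (gaussianDensity_pos μ hS x).le)]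
  have h1 : multivariateGaussian (WithLp.toLp 2 μ) S Set.univ = 1 := measure_univ
  rw [multivariateGaussian_eq_map_withDensity μ hS,
    Measure.map_apply (by fun_prop) MeasurableSet.univ, Set.preimage_univ,
    withDensity_apply _ MeasurableSet.univ, Measure.restrict_univ] at h1
  rw [h1]
  exact ENNReal.one_lt_top

lemma measurable_columns :
    Measurable fun z : Fin N → Fin n → ℝ =>
      (Matrix.of fun i t => z t i : Matrix (Fin n) (Fin N) ℝ) :=
  measurable_of_apply fun i t => (measurable_pi_apply i).comp (measurable_pi_apply t)

lemma measurable_columnsLp :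
    Measurable fun z : Fin N → EuclideanSpace ℝ (Fin n) =>
      (Matrix.of fun i t => z t i : Matrix (Fin n) (Fin N) ℝ) := by
  refine measurable_of_apply fun i t => ?_
  simp only [of_apply]
  fun_prop

lemma map_columns_volume : (volume : Measure (Fin N → Fin n → ℝ)).map
    (fun z => (Matrix.of fun i t => z t i : Matrix (Fin n) (Fin N) ℝ)) = matrixLebesgue n N := by
  rw [matrixLebesgue, ← map_swap_volume (a := N) (b := n), Measure.map_map measurable_matrixOf
    (measurable_pi_iff.2 fun i => measurable_pi_iff.2 fun t =>
      (measurable_pi_apply i).comp (measurable_pi_apply t))]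
  rfl

instance isProbabilityMeasure_columnGaussian (M : Matrix (Fin n) (Fin N) ℝ)
    (S : Matrix (Fin n) (Fin n) ℝ) : IsProbabilityMeasure (columnGaussian M S) :=
  Measure.isProbabilityMeasure_map measurable_columnsLp.aemeasurable

/-- The density of `columnGaussian`. -/
def columnGaussianDensity (M : Matrix (Fin n) (Fin N) ℝ) (S : Matrix (Fin n) (Fin n) ℝ)
    (X : Matrix (Fin n) (Fin N) ℝ) : ℝ :=
  ∏ t, gaussianDensity (M.col t) S (X.col t)

/-- Summing over the columns turns the exponents into one trace, linear in `(X - M)(X - M)ᵀ`. This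
is why second moments alone enter the divergence. -/
lemma columnGaussianDensity_eq (M : Matrix (Fin n) (Fin N) ℝ) (S : Matrix (Fin n) (Fin n) ℝ)
    (X : Matrix (Fin n) (Fin N) ℝ) : columnGaussianDensity M S X =
      ((2 * Real.pi) ^ (-(n : ℝ) / 2) * S.det ^ (-(1 : ℝ) / 2)) ^ N *
        Real.exp (-(1 / 2) * (S⁻¹ * ((X - M) * (X - M)ᵀ)).trace) := by
  simp only [columnGaussianDensity, gaussianDensity]
  rw [Finset.prod_mul_distrib, Finset.prod_const, Finset.card_univ, Fintype.card_fin,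
    ← Real.exp_sum, trace_mul_mul_transpose_eq_sum, Finset.mul_sum]
  rfl

lemma columnGaussianDensity_pos (M : Matrix (Fin n) (Fin N) ℝ) {S : Matrix (Fin n) (Fin n) ℝ}
    (hS : S.PosDef) (X : Matrix (Fin n) (Fin N) ℝ) : 0 < columnGaussianDensity M S X :=
  Finset.prod_pos fun _ _ => gaussianDensity_pos _ hS _

lemma continuous_columnGaussianDensity (M : Matrix (Fin n) (Fin N) ℝ)
    (S : Matrix (Fin n) (Fin n) ℝ) : Continuous (columnGaussianDensity M S) := by
  rw [funext (columnGaussianDensity_eq M S)]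
  have h : Continuous fun X : Matrix (Fin n) (Fin N) ℝ => X - M := continuous_id.sub continuous_const
  exact continuous_const.mul (Real.continuous_exp.comp (continuous_const.mul
    (continuous_const.matrix_mul (h.matrix_mul h.matrix_transpose)).matrix_trace))

lemma columnGaussian_eq_withDensity (M : Matrix (Fin n) (Fin N) ℝ)
    {S : Matrix (Fin n) (Fin n) ℝ} (hS : S.PosDef) :
    columnGaussian M S =
      (matrixLebesgue n N).withDensity fun X => ENNReal.ofReal (columnGaussianDensity M S X) := by
  have h1 : ∀ t : Fin N, multivariateGaussian (WithLp.toLp 2 fun i => M i t) S =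
      ((volume : Measure (Fin n → ℝ)).withDensity fun x =>
        ENNReal.ofReal (gaussianDensity (M.col t) S x)).map (WithLp.toLp 2) := fun t =>
    multivariateGaussian_eq_map_withDensity (M.col t) hS
  have hm : Measurable (WithLp.toLp 2 : (Fin n → ℝ) → EuclideanSpace ℝ (Fin n)) := by fun_prop
  have hs : ∀ t : Fin N, SigmaFinite (((volume : Measure (Fin n → ℝ)).withDensity fun x =>
      ENNReal.ofReal (gaussianDensity (M.col t) S x)).map (WithLp.toLp 2)) := fun t => by
    rw [← h1]
    infer_instance
  have h2 := Measure.pi_map_pi (μ := fun t : Fin N => (volume : Measure (Fin n → ℝ)).withDensity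
    fun x => ENNReal.ofReal (gaussianDensity (M.col t) S x))
    (f := fun _ => (WithLp.toLp 2 : (Fin n → ℝ) → EuclideanSpace ℝ (Fin n))) (hμ := hs)
    (fun t => hm.aemeasurable)
  have h3 := pi_withDensity_ofReal (μ := (volume : Measure (Fin n → ℝ)))
    (f := fun t : Fin N => gaussianDensity (M.col t) S)
    (fun t => gaussianDensity_integrable _ hS) (fun t x => (gaussianDensity_pos _ hS x).le)
  have hm2 : Measurable fun (z : Fin N → Fin n → ℝ) (t : Fin N) =>
      (WithLp.toLp 2 (z t) : EuclideanSpace ℝ (Fin n)) :=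
    measurable_pi_iff.2 fun t => hm.comp (measurable_pi_apply t)
  rw [columnGaussian, funext h1, ← h2, h3, Measure.map_map measurable_columnsLp hm2]
  have h4 := map_withDensity_comp (ν := (volume : Measure (Fin N → Fin n → ℝ)))
    (measurable_columns (n := n) (N := N))
    (continuous_columnGaussianDensity M S).measurable.ennreal_ofReal
  rw [map_columns_volume] at h4
  exact h4

lemma trace_mul_mul_transpose_pos {A : Matrix (Fin n) (Fin n) ℝ} (hA : A.PosDef)
    {X : Matrix (Fin n) (Fin N) ℝ} (hX : X ≠ 0) : 0 < (A * (X * Xᵀ)).trace := by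
  rw [trace_mul_mul_transpose_eq_sum]
  have hnn : ∀ t, 0 ≤ X.col t ⬝ᵥ (A *ᵥ X.col t) := fun t => by
    simpa using hA.posSemidef.dotProduct_mulVec_nonneg (X.col t)
  obtain ⟨t, ht⟩ : ∃ t, X.col t ≠ 0 := by
    by_contra! h
    exact hX (by ext i t; exact congrFun (h t) i)
  refine Finset.sum_pos' (fun t _ => hnn t) ⟨t, Finset.mem_univ t, ?_⟩
  simpa using hA.dotProduct_mulVec_pos ht

lemma isUniqueMode_columnGaussian (M : Matrix (Fin n) (Fin N) ℝ)
    {S : Matrix (Fin n) (Fin n) ℝ} (hS : S.PosDef) : IsUniqueMode (columnGaussian M S) M := by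
  refine ⟨columnGaussianDensity M S, continuous_columnGaussianDensity M S,
    fun X => (columnGaussianDensity_pos M hS X).le, columnGaussian_eq_withDensity M hS,
    fun X hX => ?_⟩
  rw [columnGaussianDensity_eq, columnGaussianDensity_eq]
  have h1 := trace_mul_mul_transpose_pos hS.inv (sub_ne_zero.2 hX)
  have h2 := hS.det_pos
  refine mul_lt_mul_of_pos_left (Real.exp_lt_exp.2 ?_) (by positivity)
  simp only [sub_self, Matrix.zero_mul, trace_zero, mul_zero]
  linarith

/-- Only the `t`-th column matters, and its marginal is a multivariate Gaussian of known mean and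
covariance. The centre `M'` is free so that moments about the prior mean are included. -/
lemma columnGaussian_integral_mul (M M' : Matrix (Fin n) (Fin N) ℝ)
    {S : Matrix (Fin n) (Fin n) ℝ} (hS : S.PosSemidef) (i j : Fin n) (t : Fin N) :
    Integrable (fun X => (X i t - M' i t) * (X j t - M' j t)) (columnGaussian M S) ∧
    ∫ X, (X i t - M' i t) * (X j t - M' j t) ∂(columnGaussian M S) =
      S i j + (M i t - M' i t) * (M j t - M' j t) := by
  obtain ⟨G, hG⟩ : ∃ G, G = multivariateGaussian (WithLp.toLp 2 fun i => M i t) S := ⟨_, rfl⟩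
  have hGp : IsProbabilityMeasure G := by rw [hG]; infer_instance
  have hL2 : ∀ k, MemLp (fun x : EuclideanSpace ℝ (Fin n) => x k) 2 G := by
    intro k
    have h1 : MemLp id 2 G := by rw [hG]; exact IsGaussian.memLp_two_id
    exact h1.continuousLinearMap_comp (EuclideanSpace.proj (𝕜 := ℝ) k)
  have hmean : ∀ k, ∫ x, x k ∂G = M k t := by
    intro k
    have h1 := (EuclideanSpace.proj (𝕜 := ℝ) k : EuclideanSpace ℝ (Fin n) →L[ℝ] ℝ).integral_comp_id_comm
      (μ := G) (by rw [hG]; exact IsGaussian.integrable_id)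
    rw [hG] at h1 ⊢
    rw [integral_id_multivariateGaussian] at h1
    exact h1
  have hcov : ∫ x, x i * x j ∂G = S i j + M i t * M j t := by
    have h1 := covariance_eval_multivariateGaussian (μ := WithLp.toLp 2 fun i => M i t) hS i j
    rw [← hG, covariance_eq_sub (hL2 i) (hL2 j), hmean, hmean] at h1
    simp only [Pi.mul_apply] at h1
    linarith
  have hint : Integrable (fun x : EuclideanSpace ℝ (Fin n) => x i * x j) G :=
    (hL2 i).integrable_mul (hL2 j)
  have hi : ∀ k, Integrable (fun x : EuclideanSpace ℝ (Fin n) => x k) G := fun k =>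
    (hL2 k).integrable (by norm_num)
  have key : ∀ c d : ℝ, Integrable (fun x : EuclideanSpace ℝ (Fin n) => (x i - c) * (x j - d)) G ∧
      ∫ x : EuclideanSpace ℝ (Fin n), (x i - c) * (x j - d) ∂G =
        S i j + (M i t - c) * (M j t - d) := by
    intro c d
    have hexp : (fun x : EuclideanSpace ℝ (Fin n) => (x i - c) * (x j - d)) =
        fun x => x i * x j - (d * x i + c * x j) + c * d := by
      ext x; ring
    have h1 : Integrable (fun x : EuclideanSpace ℝ (Fin n) => d * x i + c * x j) G :=
      ((hi i).const_mul _).add ((hi j).const_mul _)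
    have h2 : Integrable (fun x : EuclideanSpace ℝ (Fin n) => x i * x j - (d * x i + c * x j)) G :=
      hint.sub h1
    rw [hexp]
    refine ⟨h2.add (integrable_const _), ?_⟩
    rw [integral_add h2 (integrable_const _), integral_sub hint h1,
      integral_add ((hi i).const_mul _) ((hi j).const_mul _), integral_const_mul,
      integral_const_mul, hmean, hmean, hcov, integral_const, probReal_univ, one_smul]
    ring
  obtain ⟨hI, hv⟩ := key (M' i t) (M' j t)
  have hev : (Measure.pi fun t : Fin N =>
      multivariateGaussian (WithLp.toLp 2 fun i => M i t) S).map (Function.eval t) = G := by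
    rw [hG]
    exact (measurePreserving_eval _ t).map_eq
  have hmX : Measurable fun X : Matrix (Fin n) (Fin N) ℝ =>
      (X i t - M' i t) * (X j t - M' j t) :=
    ((Matrix.measurable_apply i t).sub_const _).mul ((Matrix.measurable_apply j t).sub_const _)
  have hmx : Measurable fun x : EuclideanSpace ℝ (Fin n) =>
      (x i - M' i t) * (x j - M' j t) := by fun_prop
  rw [columnGaussian, integrable_map_measure hmX.aestronglyMeasurable
    measurable_columnsLp.aemeasurable, integral_map measurable_columnsLp.aemeasurable
    hmX.aestronglyMeasurable]
  rw [← hev] at hI hv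
  rw [integrable_map_measure hmx.aestronglyMeasurable (measurable_pi_apply t).aemeasurable] at hI
  rw [integral_map (measurable_pi_apply t).aemeasurable hmx.aestronglyMeasurable] at hv
  exact ⟨hI, hv⟩

lemma columnGaussian_moments (M M' : Matrix (Fin n) (Fin N) ℝ)
    {S : Matrix (Fin n) (Fin n) ℝ} (hS : S.PosSemidef) :
    MatrixIntegrable (columnGaussian M S) (fun X => (X - M') * (X - M')ᵀ) ∧
    matrixExpect (columnGaussian M S) (fun X => (X - M') * (X - M')ᵀ) =
      (N : ℝ) • S + (M - M') * (M - M')ᵀ := by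
  have h : ∀ i j (X : Matrix (Fin n) (Fin N) ℝ), ((X - M') * (X - M')ᵀ) i j =
      ∑ t, (X i t - M' i t) * (X j t - M' j t) := fun i j X => by
    simp [mul_apply]
  refine ⟨fun i j => ?_, ?_⟩
  · simp only [h]
    exact integrable_finsetSum _ fun t _ => (columnGaussian_integral_mul M M' hS i j t).1
  · ext i j
    rw [matrixExpect_apply]
    simp only [h]
    rw [integral_finsetSum _ fun t _ => (columnGaussian_integral_mul M M' hS i j t).1,
      Matrix.add_apply, h, Matrix.smul_apply]
    simp only [(columnGaussian_integral_mul M M' hS i j _).2]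
    rw [Finset.sum_add_distrib]
    simp

end Density

end

noncomputable section

/-! ### Entropy and divergence -/

section KullbackLeibler

variable {α β : Type*} [MeasurableSpace α] [MeasurableSpace β]

theorem ae_toReal_rnDeriv_pos {r μ : Measure α} [SigmaFinite r] [SigmaFinite μ] (h : r ≪ μ) :
    ∀ᵐ x ∂r, 0 < (r.rnDeriv μ x).toReal := by
  filter_upwards [Measure.rnDeriv_pos h, h.ae_le (Measure.rnDeriv_lt_top r μ)] with x h0 h1
  exact ENNReal.toReal_pos h0.ne' h1.ne

theorem llr_withDensity_ae_eq {r μ : Measure α} [SigmaFinite r] [SigmaFinite μ] (h : r ≪ μ)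
    {p : α → ℝ} (hp : Measurable p) (hpos : ∀ᵐ x ∂μ, 0 < p x) :
    llr r (μ.withDensity fun x => ENNReal.ofReal (p x)) =ᵐ[r]
      fun x => llr r μ x - Real.log (p x) := by
  have h1 := Measure.rnDeriv_withDensity_right r μ (f := fun x => ENNReal.ofReal (p x))
    hp.ennreal_ofReal.aemeasurable
    (hpos.mono fun x hx => by simpa using hx) (Filter.Eventually.of_forall fun x => by simp)
  filter_upwards [h.ae_le h1, h.ae_le hpos, ae_toReal_rnDeriv_pos h] with x hx hp0 hd
  simp only [llr, hx, ENNReal.toReal_mul, ENNReal.toReal_inv, ENNReal.toReal_ofReal hp0.le]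
  rw [Real.log_mul (inv_pos.2 hp0).ne' hd.ne', Real.log_inv]
  ring

/-- As `p > 0` almost everywhere, `μ` and `p μ` have the same null sets, and the log-likelihood
ratios differ by `log p`. Finiteness thus becomes a condition relative to the fixed reference
measure `μ`. -/
theorem klDiv_withDensity_ne_top_iff {r μ : Measure α} [SigmaFinite r] [SigmaFinite μ]
    {p : α → ℝ} (hp : Measurable p) (hpos : ∀ᵐ x ∂μ, 0 < p x) :
    InformationTheory.klDiv r (μ.withDensity fun x => ENNReal.ofReal (p x)) ≠ ∞ ↔
      r ≪ μ ∧ Integrable (fun x => llr r μ x - Real.log (p x)) r := by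
  rw [InformationTheory.klDiv_ne_top_iff]
  constructor
  · rintro ⟨h1, h2⟩
    have h := h1.trans (withDensity_absolutelyContinuous μ _)
    exact ⟨h, (integrable_congr (llr_withDensity_ae_eq h hp hpos)).1 h2⟩
  · rintro ⟨h1, h2⟩
    refine ⟨h1.trans (withDensity_absolutelyContinuous' hp.ennreal_ofReal.aemeasurable
      (hpos.mono fun x hx => by simpa using hx)), ?_⟩
    exact (integrable_congr (llr_withDensity_ae_eq h1 hp hpos)).2 h2

theorem toReal_klDiv_withDensity {r μ : Measure α} [IsProbabilityMeasure r] [SigmaFinite μ]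
    {p : α → ℝ} (hp : Measurable p) (hpos : ∀ᵐ x ∂μ, 0 < p x)
    [IsProbabilityMeasure (μ.withDensity fun x => ENNReal.ofReal (p x))] (h : r ≪ μ) :
    (InformationTheory.klDiv r (μ.withDensity fun x => ENNReal.ofReal (p x))).toReal =
      ∫ x, (llr r μ x - Real.log (p x)) ∂r := by
  rw [InformationTheory.toReal_klDiv_of_measure_eq]
  · exact integral_congr_ae (llr_withDensity_ae_eq h hp hpos)
  · exact h.trans (withDensity_absolutelyContinuous' hp.ennreal_ofReal.aemeasurable
      (hpos.mono fun x hx => by simpa using hx))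
  · simp

/-- A consequence of the entropy inequality `f s ≤ e^t - f`, where `s = t - log f`. -/
theorem integrable_of_integrable_llr_sub {r μ : Measure α} [IsProbabilityMeasure r]
    [SigmaFinite μ] (h : r ≪ μ) {u g : α → ℝ} (hg : AEStronglyMeasurable g μ)
    (hg0 : ∀ᵐ x ∂μ, 0 ≤ g x) (hu : Integrable (fun x => llr r μ x - u x) r)
    (he : Integrable (fun x => Real.exp (u x + g x)) μ) : Integrable g r := by
  rw [← integrable_rnDeriv_smul_iff h] at hu ⊢
  refine Integrable.mono' (hu.abs.add he) ?_ ?_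
  · exact ((Measure.measurable_rnDeriv r μ).ennreal_toReal.aestronglyMeasurable).smul hg
  · filter_upwards [hg0] with x hx
    have hf : 0 ≤ (r.rnDeriv μ x).toReal := ENNReal.toReal_nonneg
    simp only [Pi.add_apply, smul_eq_mul, llr]
    rw [Real.norm_of_nonneg (mul_nonneg hf hx)]
    rcases hf.eq_or_lt with h0 | h0
    · rw [← h0]; simp; positivity
    · set f := (r.rnDeriv μ x).toReal
      -- Multiplied by `f`, this reads `f g ≤ exp (u + g) + f (log f - u) - f`: both nontrivial
      -- terms on the right are integrable by hypothesis.
      have h1 := Real.add_one_le_exp (u x + g x - Real.log f)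
      have h2 : f * Real.exp (u x + g x - Real.log f) = Real.exp (u x + g x) := by
        rw [Real.exp_sub, Real.exp_log h0]; field_simp
      have h3 := le_abs_self (f * (Real.log f - u x))
      have h4 := mul_le_mul_of_nonneg_left h1 hf
      rw [h2] at h4
      nlinarith

theorem rnDeriv_prod_ae_eq {r₁ μ₁ : Measure α} {r₂ μ₂ : Measure β} [SigmaFinite r₁]
    [SigmaFinite μ₁] [SigmaFinite r₂] [SigmaFinite μ₂] (h₁ : r₁ ≪ μ₁) (h₂ : r₂ ≪ μ₂) :
    (r₁.prod r₂).rnDeriv (μ₁.prod μ₂) =ᵐ[μ₁.prod μ₂]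
      fun z => r₁.rnDeriv μ₁ z.1 * r₂.rnDeriv μ₂ z.2 := by
  have h : r₁.prod r₂ = (μ₁.prod μ₂).withDensity
      fun z => r₁.rnDeriv μ₁ z.1 * r₂.rnDeriv μ₂ z.2 := by
    conv_lhs => rw [← Measure.withDensity_rnDeriv_eq r₁ μ₁ h₁,
      ← Measure.withDensity_rnDeriv_eq r₂ μ₂ h₂]
    rw [prod_withDensity (Measure.measurable_rnDeriv _ _) (Measure.measurable_rnDeriv _ _)]
  rw [h]
  exact Measure.rnDeriv_withDensity _ (by fun_prop)

/-- Densities of product laws multiply, so their logarithms add wherever both are positive, which is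
almost everywhere for the product law. -/
theorem llr_prod_ae_eq {r₁ μ₁ : Measure α} {r₂ μ₂ : Measure β} [SigmaFinite r₁]
    [SigmaFinite μ₁] [SigmaFinite r₂] [SigmaFinite μ₂] (h₁ : r₁ ≪ μ₁) (h₂ : r₂ ≪ μ₂) :
    llr (r₁.prod r₂) (μ₁.prod μ₂) =ᵐ[r₁.prod r₂] fun z => llr r₁ μ₁ z.1 + llr r₂ μ₂ z.2 := by
  filter_upwards [(h₁.prod h₂).ae_le (rnDeriv_prod_ae_eq h₁ h₂),
    Measure.quasiMeasurePreserving_fst.ae (ae_toReal_rnDeriv_pos h₁),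
    Measure.quasiMeasurePreserving_snd.ae (ae_toReal_rnDeriv_pos h₂)] with z h h3 h4
  simp only [llr, h, ENNReal.toReal_mul]
  rw [Real.log_mul h3.ne' h4.ne']

theorem absolutelyContinuous_prod_iff {r₁ μ₁ : Measure α} {r₂ μ₂ : Measure β}
    [IsProbabilityMeasure r₁] [SigmaFinite μ₁] [IsProbabilityMeasure r₂] [SigmaFinite μ₂] :
    r₁.prod r₂ ≪ μ₁.prod μ₂ ↔ r₁ ≪ μ₁ ∧ r₂ ≪ μ₂ := by
  refine ⟨fun h => ⟨?_, ?_⟩, fun h => h.1.prod h.2⟩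
  · intro s hs
    have := h (show (μ₁.prod μ₂) (s ×ˢ Set.univ) = 0 by simp [Measure.prod_prod, hs])
    simpa [Measure.prod_prod] using this
  · intro s hs
    have := h (show (μ₁.prod μ₂) (Set.univ ×ˢ s) = 0 by simp [Measure.prod_prod, hs])
    simpa [Measure.prod_prod] using this

end KullbackLeibler

/-! ### Separating the entropy from the moments for a single factor. -/

variable {n m N : ℕ}

theorem Matrix.trace_sub_mul_transpose_le {a b : ℕ} (A B : Matrix (Fin a) (Fin b) ℝ) :
    ((A - B) * (A - B)ᵀ).trace ≤ 2 * (A * Aᵀ).trace + 2 * (B * Bᵀ).trace := by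
  simp only [trace_mul_transpose_self_eq_sum, Finset.mul_sum, ← Finset.sum_add_distrib]
  gcongr with i _ t _
  simp only [Matrix.sub_apply]
  nlinarith [sq_nonneg (A i t + B i t)]

theorem Measurable.matrix_mul_transpose_self {α : Type*} [MeasurableSpace α] {a b : ℕ}
    {F : α → Matrix (Fin a) (Fin b) ℝ} (hF : Measurable F) :
    Measurable fun x => F x * (F x)ᵀ :=
  hF.matrix_mul' hF.matrix_transpose'

/-- Write `K - G X = (K - G U) - G (X - U)` and bound the squared norm of a difference by twice the
sum of the squared norms. -/
theorem MatrixIntegrable.affine {r : Measure (Matrix (Fin n) (Fin N) ℝ)}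
    [IsProbabilityMeasure r] {U : Matrix (Fin n) (Fin N) ℝ}
    (h : MatrixIntegrable r fun X => (X - U) * (X - U)ᵀ)
    (K : Matrix (Fin m) (Fin N) ℝ) (G : Matrix (Fin m) (Fin n) ℝ) :
    MatrixIntegrable r fun X => (K - G * X) * (K - G * X)ᵀ := by
  have hm : Measurable fun X : Matrix (Fin n) (Fin N) ℝ => K - G * X :=
    measurable_const.matrix_sub' (measurable_mul_left G)
  have hm2 : Measurable fun X : Matrix (Fin n) (Fin N) ℝ => (K - G * X) * (K - G * X)ᵀ :=
    hm.matrix_mul_transpose_self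
  refine matrixIntegrable_of_trace hm2
    (Filter.Eventually.of_forall fun X => posSemidef_mul_transpose_self _) (C := 1)
    Matrix.PosDef.one ?_
  have h1 := integrable_trace_mul h (Gᵀ * G)
  have h2 : Integrable (fun X : Matrix (Fin n) (Fin N) ℝ =>
      2 * ((K - G * U) * (K - G * U)ᵀ).trace +
        2 * (Gᵀ * G * ((X - U) * (X - U)ᵀ)).trace) r :=
    (integrable_const _).add (h1.const_mul 2)
  simp only [Matrix.one_mul]
  refine h2.mono' hm2.matrix_trace'.aestronglyMeasurable
    (Filter.Eventually.of_forall fun X => ?_)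
  rw [Real.norm_of_nonneg (posSemidef_mul_transpose_self _).trace_nonneg]
  have h3 := trace_sub_mul_transpose_le (K - G * U) (G * (X - U))
  have h4 : K - G * U - G * (X - U) = K - G * X := by rw [Matrix.mul_sub]; abel
  have h5 : (Gᵀ * G * ((X - U) * (X - U)ᵀ)).trace =
      ((G * (X - U)) * (G * (X - U))ᵀ).trace := by
    rw [Matrix.transpose_mul, Matrix.mul_assoc Gᵀ, Matrix.trace_mul_comm]
    simp only [Matrix.mul_assoc]
  rwa [h4, ← h5] at h3

/-- The integrand is a multiple of the Gaussian density with column covariance `2 A⁻¹`. -/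
theorem integrable_exp_neg_trace_mul {A : Matrix (Fin n) (Fin n) ℝ} (hA : A.PosDef)
    (U : Matrix (Fin n) (Fin N) ℝ) :
    Integrable (fun X => Real.exp (-(1 / 4) * (A * ((X - U) * (X - U)ᵀ)).trace))
      (matrixLebesgue n N) := by
  have hS : ((2 : ℝ) • A⁻¹).PosDef := hA.inv.smul (by norm_num)
  have h1 : Integrable (fun X => columnGaussianDensity U ((2 : ℝ) • A⁻¹) X)
      (matrixLebesgue n N) := by
    refine ⟨(continuous_columnGaussianDensity _ _).aestronglyMeasurable, ?_⟩
    have h := (isProbabilityMeasure_columnGaussian U ((2 : ℝ) • A⁻¹)).measure_univ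
    rw [columnGaussian_eq_withDensity U hS, withDensity_apply _ MeasurableSet.univ,
      Measure.restrict_univ] at h
    rw [hasFiniteIntegral_iff_ofReal
      (Filter.Eventually.of_forall fun X => (columnGaussianDensity_pos U hS X).le), h]
    exact ENNReal.one_lt_top
  have hinv : ((2 : ℝ) • A⁻¹)⁻¹ = (1 / 2 : ℝ) • A := by
    apply Matrix.inv_eq_left_inv
    rw [Matrix.smul_mul, Matrix.mul_smul, Matrix.mul_nonsing_inv _ hA.det_pos.ne'.isUnit, smul_smul]
    norm_num
  have hK : 0 < ((2 * Real.pi) ^ (-(n : ℝ) / 2) *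
      ((2 : ℝ) • A⁻¹).det ^ (-(1 : ℝ) / 2)) ^ N := by
    have := hS.det_pos
    positivity
  refine (h1.const_mul (((2 * Real.pi) ^ (-(n : ℝ) / 2) *
      ((2 : ℝ) • A⁻¹).det ^ (-(1 : ℝ) / 2)) ^ N)⁻¹).congr
      (Filter.Eventually.of_forall fun X => ?_)
  simp only [columnGaussianDensity_eq, hinv]
  rw [inv_mul_cancel_left₀ hK.ne', Matrix.smul_mul, Matrix.trace_smul, smul_eq_mul]
  congr 1
  ring

theorem Matrix.PosSemidef.trace_mul_self_transpose_nonneg {A : Matrix (Fin n) (Fin n) ℝ}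
    (hA : A.PosSemidef) (X : Matrix (Fin n) (Fin N) ℝ) : 0 ≤ (A * (X * Xᵀ)).trace :=
  hA.trace_mul_nonneg (posSemidef_mul_transpose_self X)

/-- The entropy term has no sign, so integrability of the sum does not split for trivial reasons.
Half of the `A`-energy plays the role of `g` in the entropy inequality: the other half still makes
`exp (u + g)` at most a Gaussian. The second moments follow, and then the entropy by subtraction. -/
theorem integrable_llr_add_trace_iff {r : Measure (Matrix (Fin n) (Fin N) ℝ)}
    [IsProbabilityMeasure r] (hr : r ≪ matrixLebesgue n N) {A : Matrix (Fin n) (Fin n) ℝ}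
    (hA : A.PosDef) {B : Matrix (Fin m) (Fin m) ℝ} (hB : B.PosSemidef)
    (U : Matrix (Fin n) (Fin N) ℝ) (K : Matrix (Fin m) (Fin N) ℝ) (G : Matrix (Fin m) (Fin n) ℝ) :
    Integrable (fun X => llr r (matrixLebesgue n N) X +
        (1 / 2 * (A * ((X - U) * (X - U)ᵀ)).trace +
          1 / 2 * (B * ((K - G * X) * (K - G * X)ᵀ)).trace)) r ↔
      Integrable (llr r (matrixLebesgue n N)) r ∧
        MatrixIntegrable r fun X => (X - U) * (X - U)ᵀ := by
  have hm : Measurable fun X : Matrix (Fin n) (Fin N) ℝ => (X - U) * (X - U)ᵀ :=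
    (measurable_id.matrix_sub' measurable_const).matrix_mul_transpose_self
  have key : (MatrixIntegrable r fun X => (X - U) * (X - U)ᵀ) → Integrable (fun X =>
      (1 / 2 * (A * ((X - U) * (X - U)ᵀ)).trace +
          1 / 2 * (B * ((K - G * X) * (K - G * X)ᵀ)).trace)) r := fun h =>
    ((integrable_trace_mul h A).const_mul _).add
      ((integrable_trace_mul (h.affine K G) B).const_mul _)
  constructor
  · intro h
    have hmom : MatrixIntegrable r fun X => (X - U) * (X - U)ᵀ := by
      refine matrixIntegrable_of_trace hm
        (Filter.Eventually.of_forall fun X => posSemidef_mul_transpose_self _) hA ?_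
      have hg : Measurable fun X : Matrix (Fin n) (Fin N) ℝ =>
          (A * ((X - U) * (X - U)ᵀ)).trace := (measurable_const.matrix_mul' hm).matrix_trace'
      have hm3 : Measurable fun X : Matrix (Fin n) (Fin N) ℝ =>
          (B * ((K - G * X) * (K - G * X)ᵀ)).trace :=
        (measurable_const.matrix_mul' (measurable_const.matrix_sub'
          (measurable_mul_left G)).matrix_mul_transpose_self).matrix_trace'
      have := integrable_of_integrable_llr_sub hr
        (u := fun X => -(1 / 2 * (A * ((X - U) * (X - U)ᵀ)).trace +
          1 / 2 * (B * ((K - G * X) * (K - G * X)ᵀ)).trace))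
        (g := fun X => 1 / 4 * (A * ((X - U) * (X - U)ᵀ)).trace)
        (hg.const_mul _).aestronglyMeasurable
        (Filter.Eventually.of_forall fun X =>
          mul_nonneg (by norm_num) (hA.posSemidef.trace_mul_self_transpose_nonneg _))
        (by simpa only [sub_neg_eq_add] using h) ?_
      · have h4 := this.const_mul 4
        refine h4.congr (Filter.Eventually.of_forall fun X => ?_)
        simp only
        ring
      · refine (integrable_exp_neg_trace_mul hA U).mono'
          (by
            apply Measurable.aestronglyMeasurable
            fun_prop) (Filter.Eventually.of_forall fun X => ?_)
        rw [Real.norm_of_nonneg (Real.exp_pos _).le, Real.exp_le_exp]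
        have := hB.trace_mul_self_transpose_nonneg (K - G * X)
        linarith
    refine ⟨?_, hmom⟩
    refine (h.sub (key hmom)).congr (Filter.Eventually.of_forall fun X => ?_)
    simp only [Pi.sub_apply]
    ring
  · rintro ⟨h1, h2⟩
    exact h1.add (key h2)

theorem log_invWishartKernel (C : Matrix (Fin n) (Fin n) ℝ) (ν : ℝ) {P : Matrix (Fin n) (Fin n) ℝ}
    (hP : P.PosDef) : Real.log (invWishartKernel C ν P) =
      -((ν + n + 1) / 2 * Real.log P.det) - 1 / 2 * (C * P⁻¹).trace := by
  have := hP.det_pos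
  rw [invWishartKernel, Real.log_mul (by positivity) (by positivity), Real.log_exp,
    Real.log_rpow this]
  ring

theorem ae_posDef_of_absolutelyContinuous {r : Measure (Matrix (Fin n) (Fin n) ℝ)}
    (hr : r ≪ posDefLebesgue n) : ∀ᵐ P ∂r, P.PosDef :=
  hr.ae_le ae_posDef

/-- The argument of `integrable_llr_add_trace_iff` with the inverse-Wishart kernel: here `exp (u +
g)` is the kernel of scale `C / 2`. The log-determinant stays attached to the entropy, and this
combination does not involve `C`. -/
theorem integrable_llr_add_log_det_iff {r : Measure (Matrix (Fin n) (Fin n) ℝ)}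
    [IsProbabilityMeasure r] (hr : r ≪ posDefLebesgue n) {C : Matrix (Fin n) (Fin n) ℝ}
    (hC : C.PosDef) {ν : ℝ} (hν : (n : ℝ) < ν) :
    Integrable (fun P => llr r (posDefLebesgue n) P + ((ν + n + 1) / 2 * Real.log P.det +
        1 / 2 * (C * P⁻¹).trace)) r ↔
      Integrable (fun P => llr r (posDefLebesgue n) P + (ν + n + 1) / 2 * Real.log P.det) r ∧
        MatrixIntegrable r fun P => P⁻¹ := by
  constructor
  · intro h
    have hmom : MatrixIntegrable r fun P => P⁻¹ := by
      refine matrixIntegrable_of_trace Matrix.measurable_inv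
        ((ae_posDef_of_absolutelyContinuous hr).mono fun P hP => hP.inv.posSemidef) hC ?_
      have hg : Measurable fun P : Matrix (Fin n) (Fin n) ℝ => (C * P⁻¹).trace :=
        (measurable_const.matrix_mul' Matrix.measurable_inv).matrix_trace'
      have := integrable_of_integrable_llr_sub hr
        (u := fun P => Real.log (invWishartKernel C ν P))
        (g := fun P => 1 / 4 * (C * P⁻¹).trace)
        (hg.const_mul _).aestronglyMeasurable
        (ae_posDef.mono fun P hP =>
          mul_nonneg (by norm_num) (trace_nonneg_of_posDef hC.posSemidef hP))
        (h.congr ((ae_posDef_of_absolutelyContinuous hr).mono fun P hP => by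
          simp only [log_invWishartKernel C ν hP]; ring)) ?_
      · have h4 := this.const_mul 4
        refine h4.congr (Filter.Eventually.of_forall fun X => ?_)
        simp only
        ring
      · refine (integrable_invWishartKernel (hC.smul (by norm_num : (0 : ℝ) < 1 / 2)) hν).congr
          (ae_posDef.mono fun P hP => ?_)
        simp only
        rw [Real.exp_add, Real.exp_log (invWishartKernel_pos C ν hP), invWishartKernel_half_mul_exp]
    refine ⟨?_, hmom⟩
    refine (h.sub ((integrable_trace_mul hmom C).const_mul (1 / 2))).congr
      (Filter.Eventually.of_forall fun X => ?_)
    simp only [Pi.sub_apply]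
    ring
  · rintro ⟨h1, h2⟩
    refine (h1.add ((integrable_trace_mul h2 C).const_mul (1 / 2))).congr
      (Filter.Eventually.of_forall fun X => ?_)
    simp only [Pi.add_apply]
    ring

end

noncomputable section

/-! ### The posterior density -/

theorem MatrixIntegrable.trace_mul_prod {α β : Type*} [MeasurableSpace α] [MeasurableSpace β]
    {a b : ℕ} {q : Measure α} {r : Measure β} {F : α → Matrix (Fin a) (Fin b) ℝ}
    {G : β → Matrix (Fin b) (Fin a) ℝ}
    (hF : MatrixIntegrable q F) (hG : MatrixIntegrable r G) :
    Integrable (fun z => (G z.2 * F z.1).trace) (q.prod r) := by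
  simp only [Matrix.trace, Matrix.diag, Matrix.mul_apply]
  refine integrable_finsetSum _ fun i _ => integrable_finsetSum _ fun j _ => ?_
  simpa only [mul_comm] using (hF j i).mul_prod (hG i j)

/-- The trace is bilinear and the factors are independent, so expectations pass inside. -/
theorem MatrixIntegrable.integral_trace_mul_prod {α β : Type*} [MeasurableSpace α]
    [MeasurableSpace β] {a b : ℕ} {q : Measure α} {r : Measure β} [SFinite q] [SFinite r]
    {F : α → Matrix (Fin a) (Fin b) ℝ} {G : β → Matrix (Fin b) (Fin a) ℝ}
    (hF : MatrixIntegrable q F) (hG : MatrixIntegrable r G) :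
    ∫ z, (G z.2 * F z.1).trace ∂(q.prod r) = (matrixExpect r G * matrixExpect q F).trace := by
  have h : ∀ i j, Integrable (fun z : α × β => G z.2 i j * F z.1 j i) (q.prod r) := fun i j => by
    simpa only [mul_comm] using (hF j i).mul_prod (hG i j)
  simp only [Matrix.trace, Matrix.diag, Matrix.mul_apply, matrixExpect_apply]
  rw [integral_finsetSum _ fun i _ => integrable_finsetSum _ fun j _ => h i j]
  refine Finset.sum_congr rfl fun i _ => ?_
  rw [integral_finsetSum _ fun j _ => h i j]
  refine Finset.sum_congr rfl fun j _ => ?_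
  simp only [mul_comm (G _ _ _)]
  rw [integral_prod_mul (fun x => F x j i) (fun y => G y i j), mul_comm]

theorem ae_prod_posDef {n m : ℕ} :
    ∀ᵐ w ∂((posDefLebesgue n).prod (posDefLebesgue m)), w.1.PosDef ∧ w.2.PosDef :=
  (Measure.quasiMeasurePreserving_fst.ae ae_posDef).and
    (Measure.quasiMeasurePreserving_snd.ae ae_posDef)

theorem matrixLebesgue_ne_zero (a b : ℕ) : matrixLebesgue a b ≠ 0 := by
  intro h
  exact isOpenPosMeasure_matrixLebesgue (a := a) (b := b) isOpen_univ Set.univ_nonempty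
    (by rw [h]; rfl)

namespace LinearModel

variable {n m N : ℕ} (d : LinearModel n m N)

/-- The negative logarithm of the posterior density, up to an additive constant. -/
def energy (X : Matrix (Fin n) (Fin N) ℝ) (P : Matrix (Fin n) (Fin n) ℝ)
    (R : Matrix (Fin m) (Fin m) ℝ) : ℝ :=
  1 / 2 * (P⁻¹ * ((X - d.U) * (X - d.U)ᵀ)).trace +
    1 / 2 * (R⁻¹ * ((d.Y - d.H * X) * (d.Y - d.H * X)ᵀ)).trace +
    ((d.γx + n + 1) / 2 * Real.log P.det + 1 / 2 * (d.Cx * P⁻¹).trace) +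
    ((d.γw + m + 1) / 2 * Real.log R.det + 1 / 2 * (d.Cw * R⁻¹).trace)

theorem jointDensity_eq (X : Matrix (Fin n) (Fin N) ℝ) (P : Matrix (Fin n) (Fin n) ℝ)
    (R : Matrix (Fin m) (Fin m) ℝ) :
    d.jointDensity X P R = columnGaussianDensity (d.H * X) R d.Y * columnGaussianDensity d.U P X *
      invWishartDensity d.Cx d.νx P * invWishartDensity d.Cw d.νw R :=
  rfl

theorem measurable_jointDensity : Measurable fun z : Matrix (Fin n) (Fin N) ℝ ×
    Matrix (Fin n) (Fin n) ℝ × Matrix (Fin m) (Fin m) ℝ => d.jointDensity z.1 z.2.1 z.2.2 := by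
  simp only [jointDensity_eq, columnGaussianDensity_eq]
  have hP : Measurable fun z : Matrix (Fin n) (Fin N) ℝ ×
    Matrix (Fin n) (Fin n) ℝ × Matrix (Fin m) (Fin m) ℝ => z.2.1 := by fun_prop
  have hR : Measurable fun z : Matrix (Fin n) (Fin N) ℝ ×
    Matrix (Fin n) (Fin n) ℝ × Matrix (Fin m) (Fin m) ℝ => z.2.2 := by fun_prop
  have hHX : Measurable fun z : Matrix (Fin n) (Fin N) ℝ ×
      Matrix (Fin n) (Fin n) ℝ × Matrix (Fin m) (Fin m) ℝ => d.H * z.1 :=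
    (measurable_const (a := d.H)).matrix_mul' measurable_fst
  have h1 : Measurable fun z : Matrix (Fin n) (Fin N) ℝ ×
      Matrix (Fin n) (Fin n) ℝ × Matrix (Fin m) (Fin m) ℝ =>
      (z.2.2⁻¹ * ((d.Y - d.H * z.1) * (d.Y - d.H * z.1)ᵀ)).trace :=
    (hR.matrix_inv'.matrix_mul'
      (measurable_const.matrix_sub' hHX).matrix_mul_transpose_self).matrix_trace'
  have h2 : Measurable fun z : Matrix (Fin n) (Fin N) ℝ ×
      Matrix (Fin n) (Fin n) ℝ × Matrix (Fin m) (Fin m) ℝ =>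
      (z.2.1⁻¹ * ((z.1 - d.U) * (z.1 - d.U)ᵀ)).trace :=
    (hP.matrix_inv'.matrix_mul'
      (measurable_fst.matrix_sub' measurable_const).matrix_mul_transpose_self).matrix_trace'
  have h3 := (measurable_invWishartDensity d.Cx d.νx).comp hP
  have h4 := (measurable_invWishartDensity d.Cw d.νw).comp hR
  have h5 := hP.matrix_det'
  have h6 := hR.matrix_det'
  have h3' : Measurable fun z : Matrix (Fin n) (Fin N) ℝ ×
      Matrix (Fin n) (Fin n) ℝ × Matrix (Fin m) (Fin m) ℝ =>
      invWishartDensity d.Cx d.νx z.2.1 := h3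
  have h4' : Measurable fun z : Matrix (Fin n) (Fin N) ℝ ×
      Matrix (Fin n) (Fin n) ℝ × Matrix (Fin m) (Fin m) ℝ =>
      invWishartDensity d.Cw d.νw z.2.2 := h4
  exact ((((((h6.pow_const _).const_mul _).pow_const N).mul (h1.const_mul _).exp).mul
    ((((h5.pow_const _).const_mul _).pow_const N).mul (h2.const_mul _).exp)).mul h3').mul h4'

variable {d}

theorem jointDensity_pos (hCx : d.Cx.PosDef) (hCw : d.Cw.PosDef) (hνx : (n : ℝ) < d.νx)
    (hνw : (m : ℝ) < d.νw) (X : Matrix (Fin n) (Fin N) ℝ) {P : Matrix (Fin n) (Fin n) ℝ}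
    {R : Matrix (Fin m) (Fin m) ℝ} (hP : P.PosDef) (hR : R.PosDef) : 0 < d.jointDensity X P R := by
  rw [jointDensity_eq]
  have h1 := columnGaussianDensity_pos (d.H * X) hR d.Y
  have h2 := columnGaussianDensity_pos d.U hP X
  have h3 := invWishartDensity_pos hCx hνx hP
  have h4 := invWishartDensity_pos hCw hνw hR
  positivity

/-- The `N` Gaussian columns contribute `-(N/2) log |P|` and `-(N/2) log |R|`, which turns `ν` into
`γ = ν + N`; `K` collects the normalizing constants. -/
theorem exists_log_jointDensity (hCx : d.Cx.PosDef) (hCw : d.Cw.PosDef) (hνx : (n : ℝ) < d.νx)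
    (hνw : (m : ℝ) < d.νw) : ∃ K : ℝ, ∀ X P R, P.PosDef → R.PosDef →
      Real.log (d.jointDensity X P R) = K - d.energy X P R := by
  refine ⟨N * Real.log ((2 * Real.pi) ^ (-(m : ℝ) / 2)) +
    N * Real.log ((2 * Real.pi) ^ (-(n : ℝ) / 2)) -
    Real.log (∫ Q, invWishartKernel d.Cx d.νx Q ∂(posDefLebesgue n)) -
    Real.log (∫ Q, invWishartKernel d.Cw d.νw Q ∂(posDefLebesgue m)), fun X P R hP hR => ?_⟩
  have hZx := integral_invWishartKernel_pos hCx hνx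
  have hZw := integral_invWishartKernel_pos hCw hνw
  have hkx := invWishartKernel_pos d.Cx d.νx hP
  have hkw := invWishartKernel_pos d.Cw d.νw hR
  have hdP := hP.det_pos
  have hdR := hR.det_pos
  have h2π : 0 < 2 * Real.pi := by positivity
  rw [jointDensity_eq, columnGaussianDensity_eq, columnGaussianDensity_eq, invWishartDensity,
    invWishartDensity, Real.log_mul (by positivity) (by positivity),
    Real.log_mul (by positivity) (by positivity), Real.log_mul (by positivity) (by positivity),
    Real.log_mul (by positivity) (by positivity), Real.log_mul (by positivity) (by positivity),
    Real.log_mul (by positivity) (by positivity), Real.log_mul (by positivity) (by positivity),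
    Real.log_inv, Real.log_inv, Real.log_exp, Real.log_exp, Real.log_pow, Real.log_pow,
    Real.log_mul (by positivity) (by positivity), Real.log_mul (by positivity) (by positivity),
    Real.log_rpow hdP, Real.log_rpow hdR,
    log_invWishartKernel _ _ hP, log_invWishartKernel _ _ hR, energy, γx, γw]
  ring

/-- The exponential in the likelihood is at most 1, and its determinant factor raises `ν_w` to
`γ_w`. The bound is integrable one variable at a time. -/
theorem jointDensity_le_mul (hCw : d.Cw.PosDef) (hνw : (m : ℝ) < d.νw) :
    ∃ c : ℝ, 0 < c ∧ ∀ X P R, P.PosDef → R.PosDef → 0 ≤ invWishartDensity d.Cx d.νx P →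
      d.jointDensity X P R ≤ columnGaussianDensity d.U P X *
        (invWishartDensity d.Cx d.νx P * (c * invWishartKernel d.Cw d.γw R)) := by
  have hZw := integral_invWishartKernel_pos hCw hνw
  refine ⟨((2 * Real.pi) ^ (-(m : ℝ) / 2)) ^ N *
    (∫ Q, invWishartKernel d.Cw d.νw Q ∂(posDefLebesgue m))⁻¹, by positivity,
    fun X P R hP hR h0 => ?_⟩
  have hdR := hR.det_pos
  have h1 := columnGaussianDensity_pos d.U hP X
  have h2 : Real.exp (-(1 / 2) *
      (R⁻¹ * ((d.Y - d.H * X) * (d.Y - d.H * X)ᵀ)).trace) ≤ 1 := by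
    rw [Real.exp_le_one_iff]
    have := hR.inv.posSemidef.trace_mul_self_transpose_nonneg (d.Y - d.H * X)
    linarith
  have h3 : (R.det ^ (-(1 : ℝ) / 2)) ^ N * invWishartKernel d.Cw d.νw R =
      invWishartKernel d.Cw d.γw R := by
    rw [invWishartKernel, invWishartKernel, ← mul_assoc, ← Real.rpow_natCast,
      ← Real.rpow_mul hdR.le, ← Real.rpow_add hdR, γw]
    congr 2
    ring
  have hk := invWishartKernel_pos d.Cw d.νw hR
  rw [jointDensity_eq, columnGaussianDensity_eq (d.H * X), ← h3, mul_pow]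
  calc _ ≤ ((2 * Real.pi) ^ (-(m : ℝ) / 2)) ^ N * (R.det ^ (-(1 : ℝ) / 2)) ^ N * 1 *
        columnGaussianDensity d.U P X * invWishartDensity d.Cx d.νx P *
        invWishartDensity d.Cw d.νw R := by
        have : 0 ≤ invWishartDensity d.Cw d.νw R := by rw [invWishartDensity]; positivity
        gcongr
    _ = _ := by
        rw [show invWishartDensity d.Cw d.νw R = (∫ Q, invWishartKernel d.Cw d.νw Q
          ∂(posDefLebesgue m))⁻¹ * invWishartKernel d.Cw d.νw R from rfl]
        ring

theorem jointMeasure_univ_ne_top (hCx : d.Cx.PosDef) (hCw : d.Cw.PosDef) (hνx : (n : ℝ) < d.νx)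
    (hνw : (m : ℝ) < d.νw) : d.jointMeasure Set.univ ≠ ∞ := by
  obtain ⟨c, hc, hle⟩ := jointDensity_le_mul (d := d) hCw hνw
  rw [jointMeasure, withDensity_apply _ MeasurableSet.univ, Measure.restrict_univ,
    lintegral_prod_symm' _ d.measurable_jointDensity.ennreal_ofReal]
  have hγ : (m : ℝ) < d.γw := by
    have : (0 : ℝ) ≤ N := Nat.cast_nonneg N
    rw [γw]; linarith
  have h1 : Integrable (fun R => c * invWishartKernel d.Cw d.γw R) (posDefLebesgue m) :=
    (integrable_invWishartKernel hCw hγ).const_mul c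
  have h2 : Integrable (fun w : Matrix (Fin n) (Fin n) ℝ × Matrix (Fin m) (Fin m) ℝ =>
      invWishartDensity d.Cx d.νx w.1 * (c * invWishartKernel d.Cw d.γw w.2))
      ((posDefLebesgue n).prod (posDefLebesgue m)) :=
    (integrable_invWishartDensity hCx hνx).mul_prod h1
  refine ne_top_of_le_ne_top h2.lintegral_lt_top.ne ?_
  refine lintegral_mono_ae ?_
  filter_upwards [ae_prod_posDef] with w ⟨hP, hR⟩
  have h0 := (invWishartDensity_pos hCx hνx hP).le
  have hk := (invWishartKernel_pos d.Cw d.γw hR).le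
  have hg : ∫⁻ X, ENNReal.ofReal (columnGaussianDensity d.U w.1 X) ∂(matrixLebesgue n N) = 1 := by
    have h := (isProbabilityMeasure_columnGaussian d.U w.1).measure_univ
    rwa [columnGaussian_eq_withDensity d.U hP, withDensity_apply _ MeasurableSet.univ,
      Measure.restrict_univ] at h
  calc _ ≤ ∫⁻ X, ENNReal.ofReal (columnGaussianDensity d.U w.1 X) *
        ENNReal.ofReal (invWishartDensity d.Cx d.νx w.1 *
          (c * invWishartKernel d.Cw d.γw w.2)) ∂(matrixLebesgue n N) := by
        refine lintegral_mono fun X => ?_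
        rw [← ENNReal.ofReal_mul (columnGaussianDensity_pos d.U hP X).le]
        exact ENNReal.ofReal_le_ofReal (hle X w.1 w.2 hP hR h0)
    _ = _ := by
        rw [lintegral_mul_const _
          (continuous_columnGaussianDensity _ _).measurable.ennreal_ofReal, hg, one_mul]

theorem ae_jointDensity_pos (hCx : d.Cx.PosDef) (hCw : d.Cw.PosDef) (hνx : (n : ℝ) < d.νx)
    (hνw : (m : ℝ) < d.νw) :
    ∀ᵐ z ∂((matrixLebesgue n N).prod ((posDefLebesgue n).prod (posDefLebesgue m))),
      0 < d.jointDensity z.1 z.2.1 z.2.2 := by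
  filter_upwards [Measure.quasiMeasurePreserving_snd.ae ae_prod_posDef] with z hz
  exact jointDensity_pos hCx hCw hνx hνw _ hz.1 hz.2

theorem jointMeasure_univ_ne_zero (hCx : d.Cx.PosDef) (hCw : d.Cw.PosDef) (hνx : (n : ℝ) < d.νx)
    (hνw : (m : ℝ) < d.νw) : d.jointMeasure Set.univ ≠ 0 := by
  intro h
  have h0 : d.jointMeasure = 0 := Measure.measure_univ_eq_zero.1 h
  have hac : (matrixLebesgue n N).prod ((posDefLebesgue n).prod (posDefLebesgue m)) ≪
      d.jointMeasure :=
    withDensity_absolutelyContinuous' d.measurable_jointDensity.ennreal_ofReal.aemeasurable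
      ((ae_jointDensity_pos hCx hCw hνx hνw).mono fun x hx => by simpa using hx)
  have h1 := hac h
  rw [← Set.univ_prod_univ, Measure.prod_prod, ← Set.univ_prod_univ, Measure.prod_prod] at h1
  simp only [mul_eq_zero, Measure.measure_univ_eq_zero] at h1
  rcases h1 with h1 | h1 | h1
  · exact matrixLebesgue_ne_zero _ _ h1
  · exact posDefLebesgue_ne_zero h1
  · exact posDefLebesgue_ne_zero h1

/-- The posterior density, normalised. -/
def posteriorDensity (d : LinearModel n m N) (z : Matrix (Fin n) (Fin N) ℝ ×
    Matrix (Fin n) (Fin n) ℝ × Matrix (Fin m) (Fin m) ℝ) : ℝ :=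
  (d.jointMeasure Set.univ).toReal⁻¹ * d.jointDensity z.1 z.2.1 z.2.2

theorem measurable_posteriorDensity : Measurable d.posteriorDensity :=
  d.measurable_jointDensity.const_mul _

theorem posterior_eq_withDensity (hCx : d.Cx.PosDef) (hCw : d.Cw.PosDef) (hνx : (n : ℝ) < d.νx)
    (hνw : (m : ℝ) < d.νw) :
    d.posterior = ((matrixLebesgue n N).prod ((posDefLebesgue n).prod
      (posDefLebesgue m))).withDensity fun z => ENNReal.ofReal (d.posteriorDensity z) := by
  have h0 := jointMeasure_univ_ne_zero hCx hCw hνx hνw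
  have h1 := jointMeasure_univ_ne_top hCx hCw hνx hνw
  rw [posterior]
  conv_lhs => rw [jointMeasure]
  rw [← withDensity_smul _ d.measurable_jointDensity.ennreal_ofReal]
  congr 1
  funext z
  rw [posteriorDensity, ENNReal.ofReal_mul (by positivity), ENNReal.ofReal_inv_of_pos
    (ENNReal.toReal_pos h0 h1), ENNReal.ofReal_toReal h1]
  rfl

theorem isProbabilityMeasure_posterior (hCx : d.Cx.PosDef) (hCw : d.Cw.PosDef)
    (hνx : (n : ℝ) < d.νx) (hνw : (m : ℝ) < d.νw) : IsProbabilityMeasure d.posterior := by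
  constructor
  rw [posterior, Measure.smul_apply, smul_eq_mul]
  exact ENNReal.inv_mul_cancel (jointMeasure_univ_ne_zero hCx hCw hνx hνw)
    (jointMeasure_univ_ne_top hCx hCw hνx hνw)

theorem ae_posteriorDensity_pos (hCx : d.Cx.PosDef) (hCw : d.Cw.PosDef) (hνx : (n : ℝ) < d.νx)
    (hνw : (m : ℝ) < d.νw) :
    ∀ᵐ z ∂((matrixLebesgue n N).prod ((posDefLebesgue n).prod (posDefLebesgue m))),
      0 < d.posteriorDensity z := by
  filter_upwards [ae_jointDensity_pos hCx hCw hνx hνw] with z hz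
  exact mul_pos (inv_pos.2 (ENNReal.toReal_pos (jointMeasure_univ_ne_zero hCx hCw hνx hνw)
    (jointMeasure_univ_ne_top hCx hCw hνx hνw))) hz

theorem exists_log_posteriorDensity (hCx : d.Cx.PosDef) (hCw : d.Cw.PosDef)
    (hνx : (n : ℝ) < d.νx) (hνw : (m : ℝ) < d.νw) : ∃ K : ℝ, ∀ X P R, P.PosDef → R.PosDef →
      Real.log (d.posteriorDensity (X, P, R)) = K - d.energy X P R := by
  obtain ⟨K, hK⟩ := exists_log_jointDensity hCx hCw hνx hνw
  refine ⟨Real.log (d.jointMeasure Set.univ).toReal⁻¹ + K, fun X P R hP hR => ?_⟩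
  rw [posteriorDensity, Real.log_mul (inv_pos.2 (ENNReal.toReal_pos
    (jointMeasure_univ_ne_zero hCx hCw hνx hνw)
    (jointMeasure_univ_ne_top hCx hCw hνx hνw))).ne'
    (jointDensity_pos hCx hCw hνx hνw X hP hR).ne', hK X P R hP hR]
  ring

end LinearModel

end

noncomputable section

/-! ### The mean-field divergence -/

/-- Laws on positive definite matrices for which the divergence to an inverse-Wishart law with
`γ` degrees of freedom is finite. -/
def FiniteScaleEntropy {n : ℕ} (γ : ℝ) (q : Measure (Matrix (Fin n) (Fin n) ℝ)) : Prop :=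
  q ≪ posDefLebesgue n ∧
    Integrable (fun P => llr q (posDefLebesgue n) P + (γ + n + 1) / 2 * Real.log P.det) q ∧
    MatrixIntegrable q fun P => P⁻¹

/-- The part of the divergence to an inverse-Wishart law that does not depend on its scale. -/
def scaleEntropy {n : ℕ} (γ : ℝ) (q : Measure (Matrix (Fin n) (Fin n) ℝ)) : ℝ :=
  ∫ P, (llr q (posDefLebesgue n) P + (γ + n + 1) / 2 * Real.log P.det) ∂q

/-- Laws with finite entropy and second moments. -/
def FiniteEntropyMoment {n N : ℕ} (U : Matrix (Fin n) (Fin N) ℝ)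
    (q : Measure (Matrix (Fin n) (Fin N) ℝ)) : Prop :=
  q ≪ matrixLebesgue n N ∧ Integrable (llr q (matrixLebesgue n N)) q ∧
    MatrixIntegrable q fun X => (X - U) * (X - U)ᵀ

theorem integral_prod_snd_fst {α β γ : Type*} [MeasurableSpace α] [MeasurableSpace β]
    [MeasurableSpace γ] {q : Measure α} {r : Measure β} {s : Measure γ} [IsProbabilityMeasure q]
    [IsProbabilityMeasure r] [IsProbabilityMeasure s] (f : β → ℝ) :
    ∫ z, f z.2.1 ∂(q.prod (r.prod s)) = ∫ y, f y ∂r := by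
  rw [integral_fun_snd (fun w : β × γ => f w.1), integral_fun_fst f]
  simp

theorem integral_prod_snd_snd {α β γ : Type*} [MeasurableSpace α] [MeasurableSpace β]
    [MeasurableSpace γ] {q : Measure α} {r : Measure β} {s : Measure γ} [IsProbabilityMeasure q]
    [IsProbabilityMeasure r] [IsProbabilityMeasure s] (f : γ → ℝ) :
    ∫ z, f z.2.2 ∂(q.prod (r.prod s)) = ∫ y, f y ∂s := by
  rw [integral_fun_snd (fun w : β × γ => f w.2), integral_fun_snd f]
  simp

namespace LinearModel

variable {n m N : ℕ} {d : LinearModel n m N}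

theorem llr_prod_posterior_ae_eq {qX : Measure (Matrix (Fin n) (Fin N) ℝ)}
    {qP : Measure (Matrix (Fin n) (Fin n) ℝ)} {qR : Measure (Matrix (Fin m) (Fin m) ℝ)}
    [IsProbabilityMeasure qX] [IsProbabilityMeasure qP] [IsProbabilityMeasure qR]
    (hX : qX ≪ matrixLebesgue n N) (hP : qP ≪ posDefLebesgue n) (hR : qR ≪ posDefLebesgue m)
    {K : ℝ} (hK : ∀ X P R, P.PosDef → R.PosDef →
      Real.log (d.posteriorDensity (X, P, R)) = K - d.energy X P R) :
    (fun z => llr (qX.prod (qP.prod qR))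
      ((matrixLebesgue n N).prod ((posDefLebesgue n).prod (posDefLebesgue m))) z -
        Real.log (d.posteriorDensity z)) =ᵐ[qX.prod (qP.prod qR)] fun z =>
      llr qX (matrixLebesgue n N) z.1 + (llr qP (posDefLebesgue n) z.2.1 +
        llr qR (posDefLebesgue m) z.2.2) + d.energy z.1 z.2.1 z.2.2 - K := by
  filter_upwards [llr_prod_ae_eq hX (hP.prod hR),
    Measure.quasiMeasurePreserving_snd.ae (llr_prod_ae_eq hP hR),
    Measure.quasiMeasurePreserving_snd.ae ((hP.prod hR).ae_le ae_prod_posDef)] with z h1 h2 h3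
  rw [h1, h2, hK z.1 z.2.1 z.2.2 h3.1 h3.2]
  ring

/-- By Fubini almost every slice in one variable is integrable. A slice is, up to a constant, an
entropy plus traces with definite coefficients, to which the one-factor criteria apply. Conversely
the energy is a sum of products of integrable functions of independent variables. -/
theorem integrable_energy_iff {qX : Measure (Matrix (Fin n) (Fin N) ℝ)}
    {qP : Measure (Matrix (Fin n) (Fin n) ℝ)} {qR : Measure (Matrix (Fin m) (Fin m) ℝ)}
    [IsProbabilityMeasure qX] [IsProbabilityMeasure qP] [IsProbabilityMeasure qR]
    (hX : qX ≪ matrixLebesgue n N) (hP : qP ≪ posDefLebesgue n) (hR : qR ≪ posDefLebesgue m)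
    (hCx : d.Cx.PosDef) (hCw : d.Cw.PosDef) (hγx : (n : ℝ) < d.γx) (hγw : (m : ℝ) < d.γw) :
    Integrable (fun z => llr qX (matrixLebesgue n N) z.1 + (llr qP (posDefLebesgue n) z.2.1 +
        llr qR (posDefLebesgue m) z.2.2) + d.energy z.1 z.2.1 z.2.2) (qX.prod (qP.prod qR)) ↔
      FiniteEntropyMoment d.U qX ∧ FiniteScaleEntropy d.γx qP ∧ FiniteScaleEntropy d.γw qR := by
  have hPae := ae_posDef_of_absolutelyContinuous hP
  have hRae := ae_posDef_of_absolutelyContinuous hR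
  constructor
  · intro h
    refine ⟨⟨hX, ?_⟩, ⟨hP, ?_⟩, ⟨hR, ?_⟩⟩
    · obtain ⟨w, hw, hwP, hwR⟩ := (h.prod_left_ae.and
        ((hP.prod hR).ae_le ae_prod_posDef)).exists
      rw [← integrable_llr_add_trace_iff hX hwP.inv hwR.inv.posSemidef d.U d.Y d.H]
      refine (hw.sub (integrable_const (llr qP (posDefLebesgue n) w.1 +
        llr qR (posDefLebesgue m) w.2 +
        ((d.γx + n + 1) / 2 * Real.log w.1.det + 1 / 2 * (d.Cx * w.1⁻¹).trace) +
        ((d.γw + m + 1) / 2 * Real.log w.2.det + 1 / 2 * (d.Cw * w.2⁻¹).trace)))).congr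
        (Filter.Eventually.of_forall fun X => ?_)
      simp only [Pi.sub_apply, energy]
      ring
    · obtain ⟨X, hX'⟩ := h.prod_right_ae.exists
      obtain ⟨R, hR'⟩ := hX'.prod_left_ae.exists
      -- For a fixed `X` the Gaussian prior term merges into the scale of the inverse-Wishart
      -- kernel.
      rw [← integrable_llr_add_log_det_iff hP (C := d.Cx + (X - d.U) * (X - d.U)ᵀ)
        (hCx.add_posSemidef (posSemidef_mul_transpose_self _)) hγx]
      refine (hR'.sub (integrable_const (llr qX (matrixLebesgue n N) X +
        llr qR (posDefLebesgue m) R + 1 / 2 * (R⁻¹ * ((d.Y - d.H * X) * (d.Y - d.H * X)ᵀ)).trace +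
        ((d.γw + m + 1) / 2 * Real.log R.det + 1 / 2 * (d.Cw * R⁻¹).trace)))).congr
        (Filter.Eventually.of_forall fun P => ?_)
      simp only [Pi.sub_apply, energy, Matrix.add_mul, Matrix.trace_add]
      rw [Matrix.trace_mul_comm P⁻¹]
      ring
    · obtain ⟨X, hX'⟩ := h.prod_right_ae.exists
      obtain ⟨P, hP'⟩ := hX'.prod_right_ae.exists
      rw [← integrable_llr_add_log_det_iff hR
        (C := d.Cw + (d.Y - d.H * X) * (d.Y - d.H * X)ᵀ)
        (hCw.add_posSemidef (posSemidef_mul_transpose_self _)) hγw]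
      refine (hP'.sub (integrable_const (llr qX (matrixLebesgue n N) X +
        llr qP (posDefLebesgue n) P + 1 / 2 * (P⁻¹ * ((X - d.U) * (X - d.U)ᵀ)).trace +
        ((d.γx + n + 1) / 2 * Real.log P.det + 1 / 2 * (d.Cx * P⁻¹).trace)))).congr
        (Filter.Eventually.of_forall fun R => ?_)
      simp only [Pi.sub_apply, energy, Matrix.add_mul, Matrix.trace_add]
      rw [Matrix.trace_mul_comm R⁻¹]
      ring
  · rintro ⟨⟨-, ha, hS⟩, ⟨-, hb, hV⟩, ⟨-, hc, hW⟩⟩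
    have hV' : MatrixIntegrable (qP.prod qR) fun w => w.1⁻¹ := fun i j => (hV i j).comp_fst qR
    have hW' : MatrixIntegrable (qP.prod qR) fun w => w.2⁻¹ := fun i j => (hW i j).comp_snd qP
    have h1 := (hS.trace_mul_prod hV').const_mul (1 / 2)
    have h2 := ((hS.affine d.Y d.H).trace_mul_prod hW').const_mul (1 / 2)
    have h3 := ((hb.add ((integrable_trace_mul hV d.Cx).const_mul (1 / 2))).comp_fst qR).comp_snd qX
    have h4 := ((hc.add ((integrable_trace_mul hW d.Cw).const_mul (1 / 2))).comp_snd qP).comp_snd qX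
    have h5 := ha.comp_fst (qP.prod qR)
    refine ((((h5.add h1).add h2).add h3).add h4).congr
      (Filter.Eventually.of_forall fun z => ?_)
    simp only [Pi.add_apply, energy]
    ring

theorem integral_energy {qX : Measure (Matrix (Fin n) (Fin N) ℝ)}
    {qP : Measure (Matrix (Fin n) (Fin n) ℝ)} {qR : Measure (Matrix (Fin m) (Fin m) ℝ)}
    [IsProbabilityMeasure qX] [IsProbabilityMeasure qP] [IsProbabilityMeasure qR]
    (hX : FiniteEntropyMoment d.U qX) (hP : FiniteScaleEntropy d.γx qP)
    (hR : FiniteScaleEntropy d.γw qR) :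
    ∫ z, (llr qX (matrixLebesgue n N) z.1 + (llr qP (posDefLebesgue n) z.2.1 +
        llr qR (posDefLebesgue m) z.2.2) + d.energy z.1 z.2.1 z.2.2) ∂(qX.prod (qP.prod qR)) =
      ∫ X, llr qX (matrixLebesgue n N) X ∂qX + scaleEntropy d.γx qP + scaleEntropy d.γw qR +
        1 / 2 * (matrixExpect qP (fun P => P⁻¹) * (d.Cx +
          matrixExpect qX fun X => (X - d.U) * (X - d.U)ᵀ)).trace +
        1 / 2 * (matrixExpect qR (fun R => R⁻¹) * (d.Cw +
          matrixExpect qX fun X => (d.Y - d.H * X) * (d.Y - d.H * X)ᵀ)).trace := by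
  obtain ⟨-, ha, hS⟩ := hX
  obtain ⟨-, hb, hV⟩ := hP
  obtain ⟨-, hc, hW⟩ := hR
  have hT := hS.affine d.Y d.H
  have hV' : MatrixIntegrable (qP.prod qR) fun w => w.1⁻¹ := fun i j => (hV i j).comp_fst qR
  have hW' : MatrixIntegrable (qP.prod qR) fun w => w.2⁻¹ := fun i j => (hW i j).comp_snd qP
  have eV : matrixExpect (qP.prod qR) (fun w => w.1⁻¹) = matrixExpect qP fun P => P⁻¹ := by
    ext i j
    simp only [matrixExpect_apply]
    rw [integral_fun_fst (fun P : Matrix (Fin n) (Fin n) ℝ => P⁻¹ i j)]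
    simp
  have eW : matrixExpect (qP.prod qR) (fun w => w.2⁻¹) = matrixExpect qR fun R => R⁻¹ := by
    ext i j
    simp only [matrixExpect_apply]
    rw [integral_fun_snd (fun P : Matrix (Fin m) (Fin m) ℝ => P⁻¹ i j)]
    simp
  have h1 := (hS.trace_mul_prod hV').const_mul (1 / 2)
  have h2 := (hT.trace_mul_prod hW').const_mul (1 / 2)
  have hb2 := (integrable_trace_mul hV d.Cx).const_mul (1 / 2)
  have hc2 := (integrable_trace_mul hW d.Cw).const_mul (1 / 2)
  have hb3 : Integrable (fun P => llr qP (posDefLebesgue n) P +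
      (d.γx + n + 1) / 2 * Real.log P.det + 1 / 2 * (d.Cx * P⁻¹).trace) qP := hb.add hb2
  have hc3 : Integrable (fun P => llr qR (posDefLebesgue m) P +
      (d.γw + m + 1) / 2 * Real.log P.det + 1 / 2 * (d.Cw * P⁻¹).trace) qR := hc.add hc2
  have h3 := (hb3.comp_fst qR).comp_snd qX
  have h4 := (hc3.comp_snd qP).comp_snd qX
  have h5 := ha.comp_fst (qP.prod qR)
  have e1 := hS.integral_trace_mul_prod hV'
  have e2 := hT.integral_trace_mul_prod hW'
  rw [eV] at e1
  rw [eW] at e2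
  have e3 := integral_prod_snd_fst (q := qX) (r := qP) (s := qR) (fun P =>
    llr qP (posDefLebesgue n) P +
      (d.γx + n + 1) / 2 * Real.log P.det + 1 / 2 * (d.Cx * P⁻¹).trace)
  rw [integral_add hb hb2, integral_const_mul, integral_trace_mul hV] at e3
  have e4 := integral_prod_snd_snd (q := qX) (r := qP) (s := qR) (fun P =>
    llr qR (posDefLebesgue m) P +
      (d.γw + m + 1) / 2 * Real.log P.det + 1 / 2 * (d.Cw * P⁻¹).trace)
  rw [integral_add hc hc2, integral_const_mul, integral_trace_mul hW] at e4
  have e5 : ∫ z, llr qX (matrixLebesgue n N) z.1 ∂(qX.prod (qP.prod qR)) =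
      ∫ X, llr qX (matrixLebesgue n N) X ∂qX := by
    rw [integral_fun_fst (llr qX (matrixLebesgue n N))]
    simp
  have e6 := integral_add' (((h5.add h1).add h2).add h3) h4
  rw [integral_add' ((h5.add h1).add h2) h3, integral_add' (h5.add h1) h2, integral_add' h5 h1,
    integral_const_mul, integral_const_mul, e1, e2, e3, e4, e5] at e6
  calc _ = _ := integral_congr_ae (Filter.Eventually.of_forall fun z => by
            simp only [Pi.add_apply, energy]; ring)
    _ = _ := e6
    _ = _ := by
      simp only [scaleEntropy, Matrix.mul_add, Matrix.trace_add]
      rw [Matrix.trace_mul_comm d.Cx, Matrix.trace_mul_comm d.Cw]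
      ring

/-- The divergence to the posterior in terms of the moments of the factors. -/
theorem exists_meanFieldKL_eq (hCx : d.Cx.PosDef) (hCw : d.Cw.PosDef)
    (hνx : (n : ℝ) < d.νx) (hνw : (m : ℝ) < d.νw) : ∃ K : ℝ,
    ∀ (qX : Measure (Matrix (Fin n) (Fin N) ℝ)) (qP : Measure (Matrix (Fin n) (Fin n) ℝ))
      (qR : Measure (Matrix (Fin m) (Fin m) ℝ)), IsProbabilityMeasure qX →
      IsProbabilityMeasure qP → IsProbabilityMeasure qR →
      (d.meanFieldKL qX qP qR ≠ ∞ ↔ FiniteEntropyMoment d.U qX ∧ FiniteScaleEntropy d.γx qP ∧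
        FiniteScaleEntropy d.γw qR) ∧
      (FiniteEntropyMoment d.U qX → FiniteScaleEntropy d.γx qP → FiniteScaleEntropy d.γw qR →
        (d.meanFieldKL qX qP qR).toReal =
          ∫ X, llr qX (matrixLebesgue n N) X ∂qX + scaleEntropy d.γx qP + scaleEntropy d.γw qR +
          1 / 2 * (matrixExpect qP (fun P => P⁻¹) * (d.Cx +
            matrixExpect qX fun X => (X - d.U) * (X - d.U)ᵀ)).trace +
          1 / 2 * (matrixExpect qR (fun R => R⁻¹) * (d.Cw +
            matrixExpect qX fun X => (d.Y - d.H * X) * (d.Y - d.H * X)ᵀ)).trace - K) := by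
  obtain ⟨K, hK⟩ := exists_log_posteriorDensity hCx hCw hνx hνw
  have hN : (0 : ℝ) ≤ N := Nat.cast_nonneg N
  have hγx : (n : ℝ) < d.γx := by rw [γx]; linarith
  have hγw : (m : ℝ) < d.γw := by rw [γw]; linarith
  have hpos := ae_posteriorDensity_pos hCx hCw hνx hνw
  have heq := posterior_eq_withDensity hCx hCw hνx hνw
  have hprob := isProbabilityMeasure_posterior hCx hCw hνx hνw
  refine ⟨K, fun qX qP qR _ _ _ => ⟨?_, ?_⟩⟩
  · rw [meanFieldKL, heq, klDiv_withDensity_ne_top_iff measurable_posteriorDensity hpos,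
      absolutelyContinuous_prod_iff, absolutelyContinuous_prod_iff]
    have hiff : ∀ (hX : qX ≪ matrixLebesgue n N) (hP : qP ≪ posDefLebesgue n)
        (hR : qR ≪ posDefLebesgue m), Integrable (fun z => llr (qX.prod (qP.prod qR))
      ((matrixLebesgue n N).prod ((posDefLebesgue n).prod (posDefLebesgue m))) z -
        Real.log (d.posteriorDensity z)) (qX.prod (qP.prod qR)) ↔
        FiniteEntropyMoment d.U qX ∧ FiniteScaleEntropy d.γx qP ∧ FiniteScaleEntropy d.γw qR := by
      intro hX hP hR
      rw [integrable_congr (llr_prod_posterior_ae_eq hX hP hR hK),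
        ← integrable_energy_iff hX hP hR hCx hCw hγx hγw]
      simp only [sub_eq_add_neg _ K]
      exact integrable_add_const_iff
    constructor
    · rintro ⟨⟨hX, hP, hR⟩, h⟩
      exact (hiff hX hP hR).1 h
    · rintro ⟨hX, hP, hR⟩
      exact ⟨⟨hX.1, hP.1, hR.1⟩, (hiff hX.1 hP.1 hR.1).2 ⟨hX, hP, hR⟩⟩
  · intro hX hP hR
    have hint := (integrable_energy_iff hX.1 hP.1 hR.1 hCx hCw hγx hγw).2 ⟨hX, hP, hR⟩
    rw [heq] at hprob
    rw [meanFieldKL, heq, toReal_klDiv_withDensity measurable_posteriorDensity hpos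
      (hX.1.prod (hP.1.prod hR.1)),
      integral_congr_ae (llr_prod_posterior_ae_eq hX.1 hP.1 hR.1 hK),
      integral_sub hint (integrable_const K), integral_energy hX hP hR]
    simp

end LinearModel

end

noncomputable section

/-! ### The optimal factors -/

/-- A functional that differs from `KL(· ‖ Q)` by a constant is minimised exactly at `Q`. -/
theorem isMin_iff_of_eq_klDiv_add {α : Type*} [MeasurableSpace α] {F : Measure α → ℝ≥0∞}
    {Q : Measure α} [IsProbabilityMeasure Q] {c : ℝ}
    (h : ∀ r, IsProbabilityMeasure r →
      (F r ≠ ∞ ↔ InformationTheory.klDiv r Q ≠ ∞) ∧ (InformationTheory.klDiv r Q ≠ ∞ →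
        (F r).toReal = (InformationTheory.klDiv r Q).toReal + c)) (q : Measure α) :
    (IsProbabilityMeasure q ∧ ∀ r, IsProbabilityMeasure r → F q ≤ F r) ↔ q = Q := by
  have hQ : InformationTheory.klDiv Q Q = 0 := InformationTheory.klDiv_self Q
  have hQ' : InformationTheory.klDiv Q Q ≠ ∞ := by simp
  have hFQ := (h Q inferInstance).1.2 hQ'
  have hFQ' : (F Q).toReal = c := by rw [(h Q inferInstance).2 hQ', hQ]; simp
  constructor
  · rintro ⟨hq, hmin⟩
    have h1 := hmin Q inferInstance
    have h2 : F q ≠ ∞ := ne_top_of_le_ne_top hFQ h1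
    have h3 := (h q hq).1.1 h2
    have h4 := (ENNReal.toReal_le_toReal h2 hFQ).2 h1
    rw [(h q hq).2 h3, hFQ'] at h4
    have h5 : (InformationTheory.klDiv q Q).toReal = 0 :=
      le_antisymm (by linarith) ENNReal.toReal_nonneg
    rw [ENNReal.toReal_eq_zero_iff] at h5
    exact InformationTheory.klDiv_eq_zero_iff.1 (h5.resolve_right h3)
  · rintro rfl
    refine ⟨inferInstance, fun r hr => ?_⟩
    by_cases htop : F r = ∞
    · rw [htop]; exact le_top
    · have h3 := (h r hr).1.1 htop
      rw [← ENNReal.toReal_le_toReal hFQ htop, hFQ', (h r hr).2 h3]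
      linarith [ENNReal.toReal_nonneg (a := InformationTheory.klDiv r q)]

variable {n m N : ℕ}

theorem MatrixIntegrable.recenter {r : Measure (Matrix (Fin n) (Fin N) ℝ)}
    [IsProbabilityMeasure r] {U : Matrix (Fin n) (Fin N) ℝ}
    (h : MatrixIntegrable r fun X => (X - U) * (X - U)ᵀ) (M : Matrix (Fin n) (Fin N) ℝ) :
    MatrixIntegrable r fun X => (X - M) * (X - M)ᵀ := by
  have := h.affine (-M) (-1)
  have e : ∀ X : Matrix (Fin n) (Fin N) ℝ, -M - (-1 : Matrix (Fin n) (Fin n) ℝ) * X = X - M := fun X => by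
    rw [Matrix.neg_mul, Matrix.one_mul]; abel
  simpa only [e] using this

/-- Finiteness is the same condition for all nondegenerate Gaussians, whatever `M` and `S`. It can
therefore be matched with finiteness of the mean-field divergence, where moments are centred at the
prior mean. -/
theorem exists_klDiv_columnGaussian_eq (U M : Matrix (Fin n) (Fin N) ℝ)
    {S : Matrix (Fin n) (Fin n) ℝ} (hS : S.PosDef) : ∃ K : ℝ,
    ∀ r : Measure (Matrix (Fin n) (Fin N) ℝ), IsProbabilityMeasure r →
      (InformationTheory.klDiv r (columnGaussian M S) ≠ ∞ ↔ FiniteEntropyMoment U r) ∧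
      (FiniteEntropyMoment U r → (InformationTheory.klDiv r (columnGaussian M S)).toReal =
        ∫ X, llr r (matrixLebesgue n N) X ∂r +
          1 / 2 * (S⁻¹ * matrixExpect r fun X => (X - M) * (X - M)ᵀ).trace - K) := by
  have hdet := hS.det_pos
  have hK : 0 < ((2 * Real.pi) ^ (-(n : ℝ) / 2) * S.det ^ (-(1 : ℝ) / 2)) ^ N := by positivity
  refine ⟨Real.log (((2 * Real.pi) ^ (-(n : ℝ) / 2) * S.det ^ (-(1 : ℝ) / 2)) ^ N),
    fun r _ => ?_⟩
  have hpos : ∀ᵐ X ∂(matrixLebesgue n N), 0 < columnGaussianDensity M S X :=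
    Filter.Eventually.of_forall fun X => columnGaussianDensity_pos M hS X
  have hlog : ∀ X, Real.log (columnGaussianDensity M S X) =
      Real.log (((2 * Real.pi) ^ (-(n : ℝ) / 2) * S.det ^ (-(1 : ℝ) / 2)) ^ N) -
        1 / 2 * (S⁻¹ * ((X - M) * (X - M)ᵀ)).trace := fun X => by
    rw [columnGaussianDensity_eq, Real.log_mul hK.ne' (Real.exp_pos _).ne', Real.log_exp]
    ring
  have hm := (continuous_columnGaussianDensity M S).measurable
  constructor
  · rw [columnGaussian_eq_withDensity M hS, klDiv_withDensity_ne_top_iff hm hpos]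
    have hiff : ∀ h : r ≪ matrixLebesgue n N, Integrable (fun X => llr r (matrixLebesgue n N) X -
        Real.log (columnGaussianDensity M S X)) r ↔ Integrable (llr r (matrixLebesgue n N)) r ∧
        MatrixIntegrable r fun X => (X - M) * (X - M)ᵀ := fun h => by
      -- No likelihood term is present here, hence the zero matrix for `B`.
      rw [← integrable_llr_add_trace_iff h hS.inv (B := (0 : Matrix (Fin n) (Fin n) ℝ))
        Matrix.PosSemidef.zero M 0 0, ← integrable_add_const_iff (c := Real.log
          (((2 * Real.pi) ^ (-(n : ℝ) / 2) * S.det ^ (-(1 : ℝ) / 2)) ^ N))]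
      refine integrable_congr (Filter.Eventually.of_forall fun X => ?_)
      simp only [hlog, Matrix.zero_mul, Matrix.trace_zero]
      ring
    constructor
    · rintro ⟨h1, h2⟩
      obtain ⟨h3, h4⟩ := (hiff h1).1 h2
      exact ⟨h1, h3, h4.recenter U⟩
    · rintro ⟨h1, h2, h3⟩
      exact ⟨h1, (hiff h1).2 ⟨h2, h3.recenter M⟩⟩
  · rintro ⟨h1, h2, h3⟩
    have hprob := isProbabilityMeasure_columnGaussian M S
    rw [columnGaussian_eq_withDensity M hS] at hprob ⊢
    have h4 := h3.recenter M
    have h5 := (integrable_trace_mul h4 S⁻¹).const_mul (1 / 2)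
    rw [toReal_klDiv_withDensity hm hpos h1]
    have e : ∀ X, llr r (matrixLebesgue n N) X - Real.log (columnGaussianDensity M S X) =
        llr r (matrixLebesgue n N) X + 1 / 2 * (S⁻¹ * ((X - M) * (X - M)ᵀ)).trace -
        Real.log (((2 * Real.pi) ^ (-(n : ℝ) / 2) * S.det ^ (-(1 : ℝ) / 2)) ^ N) := fun X => by
      rw [hlog]; ring
    have h6 : Integrable (fun X => llr r (matrixLebesgue n N) X +
      1 / 2 * (S⁻¹ * ((X - M) * (X - M)ᵀ)).trace) r := h2.add h5
    simp only [e]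
    rw [integral_sub h6 (integrable_const _), integral_add h2 h5, integral_const_mul,
      integral_trace_mul h4]
    simp

/-- The finiteness condition depends on `ν` only, and the scale enters linearly through `E[P⁻¹]`.
Adding to the scale thus adds a linear term to the divergence, up to a constant. -/
theorem exists_klDiv_invWishart_eq {C : Matrix (Fin n) (Fin n) ℝ} (hC : C.PosDef) {ν : ℝ}
    (hν : (n : ℝ) < ν) : ∃ K : ℝ,
    ∀ r : Measure (Matrix (Fin n) (Fin n) ℝ), IsProbabilityMeasure r →
      (InformationTheory.klDiv r (invWishart C ν) ≠ ∞ ↔ FiniteScaleEntropy ν r) ∧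
      (FiniteScaleEntropy ν r → (InformationTheory.klDiv r (invWishart C ν)).toReal =
        scaleEntropy ν r + 1 / 2 * (C * matrixExpect r fun P => P⁻¹).trace - K) := by
  have hZ := integral_invWishartKernel_pos hC hν
  refine ⟨Real.log (∫ Q, invWishartKernel C ν Q ∂(posDefLebesgue n))⁻¹, fun r _ => ?_⟩
  have hpos : ∀ᵐ P ∂(posDefLebesgue n), 0 < invWishartDensity C ν P :=
    ae_posDef.mono fun P hP => invWishartDensity_pos hC hν hP
  have hm := measurable_invWishartDensity C ν
  have hlog : ∀ h : r ≪ posDefLebesgue n, (fun P => llr r (posDefLebesgue n) P -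
      Real.log (invWishartDensity C ν P)) =ᵐ[r] fun P => llr r (posDefLebesgue n) P +
      ((ν + n + 1) / 2 * Real.log P.det + 1 / 2 * (C * P⁻¹).trace) -
      Real.log (∫ Q, invWishartKernel C ν Q ∂(posDefLebesgue n))⁻¹ := fun h => by
    filter_upwards [ae_posDef_of_absolutelyContinuous h] with P hP
    rw [invWishartDensity, Real.log_mul (inv_pos.2 hZ).ne' (invWishartKernel_pos C ν hP).ne',
      log_invWishartKernel C ν hP]
    ring
  constructor
  · rw [invWishart, klDiv_withDensity_ne_top_iff hm hpos]
    refine and_congr_right fun h => ?_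
    rw [integrable_congr (hlog h), ← integrable_llr_add_log_det_iff h hC hν]
    simp only [sub_eq_add_neg]
    exact integrable_add_const_iff
  · rintro ⟨h1, h2, h3⟩
    have hprob := isProbabilityMeasure_invWishart hC hν
    rw [invWishart] at hprob ⊢
    have h5 := (integrable_trace_mul h3 C).const_mul (1 / 2)
    rw [toReal_klDiv_withDensity hm hpos h1, integral_congr_ae (hlog h1)]
    have h6 : Integrable (fun P => llr r (posDefLebesgue n) P + ((ν + n + 1) / 2 *
        Real.log P.det + 1 / 2 * (C * P⁻¹).trace)) r :=
      (integrable_llr_add_log_det_iff h1 hC hν).2 ⟨h2, h3⟩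
    rw [integral_sub h6 (integrable_const _)]
    simp only [← add_assoc]
    rw [integral_add h2 h5, integral_const_mul, integral_trace_mul h3]
    simp [scaleEntropy]

/-- The divergence of a law to itself is zero, in particular finite. -/
theorem finiteEntropyMoment_columnGaussian (U M : Matrix (Fin n) (Fin N) ℝ)
    {S : Matrix (Fin n) (Fin n) ℝ} (hS : S.PosDef) :
    FiniteEntropyMoment U (columnGaussian M S) := by
  obtain ⟨K, hK⟩ := exists_klDiv_columnGaussian_eq U M hS
  rw [← (hK _ inferInstance).1, InformationTheory.klDiv_self]
  exact ENNReal.zero_ne_top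

theorem finiteScaleEntropy_invWishart {C : Matrix (Fin n) (Fin n) ℝ} (hC : C.PosDef) {ν : ℝ}
    (hν : (n : ℝ) < ν) : FiniteScaleEntropy ν (invWishart C ν) := by
  obtain ⟨K, hK⟩ := exists_klDiv_invWishart_eq hC hν
  have := isProbabilityMeasure_invWishart hC hν
  rw [← (hK _ inferInstance).1, InformationTheory.klDiv_self]
  exact ENNReal.zero_ne_top

theorem FiniteScaleEntropy.posDef_matrixExpect_inv {γ : ℝ} {q : Measure (Matrix (Fin n) (Fin n) ℝ)}
    [IsProbabilityMeasure q] (h : FiniteScaleEntropy γ q) :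
    (matrixExpect q fun P => P⁻¹).PosDef :=
  posDef_matrixExpect h.2.2 ((ae_posDef_of_absolutelyContinuous h.1).mono fun _ hP => hP.inv)

theorem posSemidef_matrixExpect_mul_transpose {q : Measure (Matrix (Fin n) (Fin N) ℝ)}
    {F : Matrix (Fin n) (Fin N) ℝ → Matrix (Fin m) (Fin N) ℝ}
    (h : MatrixIntegrable q fun X => F X * (F X)ᵀ) :
    (matrixExpect q fun X => F X * (F X)ᵀ).PosSemidef :=
  posSemidef_matrixExpect h
    (Filter.Eventually.of_forall fun _ => posSemidef_mul_transpose_self _)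

namespace LinearModel

variable {d : LinearModel n m N}

theorem posDef_precision {V : Matrix (Fin n) (Fin n) ℝ} {W : Matrix (Fin m) (Fin m) ℝ}
    (hV : V.PosDef) (hW : W.PosDef) : (d.Hᵀ * W * d.H + V).PosDef :=
  hV.posSemidef_add (hW.posSemidef.transpose_congr d.H)

theorem posDef_tildeP {V : Matrix (Fin n) (Fin n) ℝ} {W : Matrix (Fin m) (Fin m) ℝ}
    (hV : V.PosDef) (hW : W.PosDef) : (d.tildeP V W).PosDef :=
  (posDef_precision hV hW).inv

theorem trace_mul_transpose_sub {a b : ℕ} {A : Matrix (Fin a) (Fin a) ℝ} (hA : A.IsHermitian)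
    (X Z : Matrix (Fin a) (Fin b) ℝ) : (A * ((X - Z) * (X - Z)ᵀ)).trace =
      (A * (X * Xᵀ)).trace - 2 * (A * Z * Xᵀ).trace + (A * (Z * Zᵀ)).trace := by
  have hAt : Aᵀ = A := by rw [← Matrix.conjTranspose_eq_transpose_of_trivial]; exact hA
  have h : (A * (X * Zᵀ)).trace = (A * Z * Xᵀ).trace := by
    rw [← Matrix.trace_transpose, Matrix.transpose_mul, Matrix.transpose_mul,
      Matrix.transpose_transpose, hAt, Matrix.trace_mul_comm, Matrix.mul_assoc]
  rw [Matrix.transpose_sub, Matrix.sub_mul, Matrix.mul_sub, Matrix.mul_sub, Matrix.mul_sub,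
    Matrix.mul_sub, Matrix.mul_sub, Matrix.trace_sub, Matrix.trace_sub, Matrix.trace_sub, h,
    ← Matrix.mul_assoc A Z Xᵀ]
  ring

/-- Completing the square. -/
theorem exists_trace_add_trace_eq {V : Matrix (Fin n) (Fin n) ℝ} {W : Matrix (Fin m) (Fin m) ℝ}
    (hV : V.PosDef) (hW : W.PosDef) : ∃ c : ℝ, ∀ X : Matrix (Fin n) (Fin N) ℝ,
      (V * ((X - d.U) * (X - d.U)ᵀ)).trace +
        (W * ((d.Y - d.H * X) * (d.Y - d.H * X)ᵀ)).trace =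
      ((d.tildeP V W)⁻¹ * ((X - d.tildeU V W) * (X - d.tildeU V W)ᵀ)).trace + c := by
  have hL := posDef_precision (d := d) hV hW
  have hinv : (d.tildeP V W)⁻¹ = d.Hᵀ * W * d.H + V :=
    Matrix.nonsing_inv_nonsing_inv _ hL.det_pos.ne'.isUnit
  have hM : (d.Hᵀ * W * d.H + V) * d.tildeU V W = d.Hᵀ * W * d.Y + V * d.U := by
    rw [tildeU, Matrix.mul_nonsing_inv_cancel_left _ _ hL.det_pos.ne'.isUnit]
  refine ⟨(V * (d.U * d.Uᵀ)).trace + (W * (d.Y * d.Yᵀ)).trace -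
    ((d.Hᵀ * W * d.H + V) * (d.tildeU V W * (d.tildeU V W)ᵀ)).trace, fun X => ?_⟩
  have h1 : ((d.Y - d.H * X) * (d.Y - d.H * X)ᵀ) = ((d.H * X - d.Y) * (d.H * X - d.Y)ᵀ) := by
    rw [← neg_sub d.Y, Matrix.transpose_neg, Matrix.neg_mul, Matrix.mul_neg, neg_neg]
  have h2 : (W * (d.H * X * (d.H * X)ᵀ)).trace = (d.Hᵀ * W * d.H * (X * Xᵀ)).trace := by
    rw [Matrix.transpose_mul, Matrix.trace_mul_comm, ← Matrix.mul_assoc, Matrix.mul_assoc,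
      Matrix.trace_mul_comm]
    simp only [Matrix.mul_assoc]
  have h3 : (W * d.Y * (d.H * X)ᵀ).trace = (d.Hᵀ * W * d.Y * Xᵀ).trace := by
    rw [Matrix.transpose_mul, ← Matrix.mul_assoc, Matrix.trace_mul_comm, ← Matrix.mul_assoc,
      ← Matrix.mul_assoc, Matrix.mul_assoc, Matrix.trace_mul_comm, Matrix.trace_mul_comm]
  rw [h1, hinv, trace_mul_transpose_sub hV.isHermitian, trace_mul_transpose_sub hW.isHermitian,
    trace_mul_transpose_sub hL.isHermitian, hM, h2, h3]
  simp only [Matrix.add_mul, Matrix.trace_add]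
  ring

/-- The optimal first factor, when the other two have finite moments and entropy. -/
theorem isOptimalX_iff (hCx : d.Cx.PosDef) (hCw : d.Cw.PosDef)
    (hνx : (n : ℝ) < d.νx) (hνw : (m : ℝ) < d.νw)
    {qP : Measure (Matrix (Fin n) (Fin n) ℝ)} {qR : Measure (Matrix (Fin m) (Fin m) ℝ)}
    [IsProbabilityMeasure qP] [IsProbabilityMeasure qR]
    (hP : FiniteScaleEntropy d.γx qP) (hR : FiniteScaleEntropy d.γw qR)
    (qX : Measure (Matrix (Fin n) (Fin N) ℝ)) :
    d.IsOptimalX qX qP qR ↔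
      qX = columnGaussian
        (d.tildeU (matrixExpect qP fun P => P⁻¹) (matrixExpect qR fun R => R⁻¹))
        (d.tildeP (matrixExpect qP fun P => P⁻¹) (matrixExpect qR fun R => R⁻¹)) := by
  have hV := hP.posDef_matrixExpect_inv
  have hW := hR.posDef_matrixExpect_inv
  obtain ⟨K, hK⟩ := exists_meanFieldKL_eq hCx hCw hνx hνw
  obtain ⟨K', hK'⟩ := exists_klDiv_columnGaussian_eq d.U
    (d.tildeU (matrixExpect qP fun P => P⁻¹) (matrixExpect qR fun R => R⁻¹))
    (posDef_tildeP (d := d) hV hW)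
  obtain ⟨c, hc⟩ := exists_trace_add_trace_eq (d := d) hV hW
  set V := matrixExpect qP fun P => P⁻¹ with hVdef
  set W := matrixExpect qR fun R => R⁻¹ with hWdef
  refine isMin_iff_of_eq_klDiv_add (c := scaleEntropy d.γx qP + scaleEntropy d.γw qR +
    1 / 2 * (V * d.Cx).trace + 1 / 2 * (W * d.Cw).trace + 1 / 2 * c + K' - K)
    (fun r hr => ⟨?_, fun h => ?_⟩) qX
  · rw [(hK r qP qR hr inferInstance inferInstance).1, (hK' r hr).1]
    exact ⟨fun h => h.1, fun h => ⟨h, hP, hR⟩⟩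
  · have hr' := (hK' r hr).1.1 h
    rw [(hK r qP qR hr inferInstance inferInstance).2 hr' hP hR, (hK' r hr).2 hr',
      ← hVdef, ← hWdef]
    have hS := hr'.2.2
    have hT := hS.affine d.Y d.H
    have hS' := hS.recenter (d.tildeU V W)
    -- The completed square is averaged over the competitor `r`, which identifies the quadratic part
    -- of its divergence to the Gaussian.
    have e : ∫ X, ((V * ((X - d.U) * (X - d.U)ᵀ)).trace +
        (W * ((d.Y - d.H * X) * (d.Y - d.H * X)ᵀ)).trace) ∂r =
      ∫ X, (((d.tildeP V W)⁻¹ * ((X - d.tildeU V W) * (X - d.tildeU V W)ᵀ)).trace + c) ∂r :=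
      integral_congr_ae (Filter.Eventually.of_forall hc)
    rw [integral_add (integrable_trace_mul hS V) (integrable_trace_mul hT W),
      integral_add (integrable_trace_mul hS' _) (integrable_const c), integral_trace_mul hS,
      integral_trace_mul hT, integral_trace_mul hS'] at e
    simp only [integral_const, probReal_univ, one_smul] at e
    simp only [Matrix.mul_add, Matrix.trace_add]
    linarith

/-- As a function of `qP` the divergence is `scaleEntropy` plus half the trace of `E[P⁻¹]` against
`C_x + E[(X - U)(X - U)ᵀ]`, plus a constant: the divergence to the inverse-Wishart law with that
scale. -/
theorem isOptimalP_iff (hCx : d.Cx.PosDef) (hCw : d.Cw.PosDef)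
    (hνx : (n : ℝ) < d.νx) (hνw : (m : ℝ) < d.νw)
    {qX : Measure (Matrix (Fin n) (Fin N) ℝ)} {qR : Measure (Matrix (Fin m) (Fin m) ℝ)}
    [IsProbabilityMeasure qX] [IsProbabilityMeasure qR]
    (hX : FiniteEntropyMoment d.U qX) (hR : FiniteScaleEntropy d.γw qR)
    (qP : Measure (Matrix (Fin n) (Fin n) ℝ)) :
    d.IsOptimalP qX qP qR ↔
      qP = invWishart (d.Cx + matrixExpect qX fun X => (X - d.U) * (X - d.U)ᵀ) d.γx := by
  have hγx : (n : ℝ) < d.γx := by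
    have : (0 : ℝ) ≤ N := Nat.cast_nonneg N
    rw [γx]; linarith
  have hC : (d.Cx + matrixExpect qX fun X => (X - d.U) * (X - d.U)ᵀ).PosDef :=
    hCx.add_posSemidef (posSemidef_matrixExpect_mul_transpose hX.2.2)
  obtain ⟨K, hK⟩ := exists_meanFieldKL_eq hCx hCw hνx hνw
  obtain ⟨K', hK'⟩ := exists_klDiv_invWishart_eq hC hγx
  have := isProbabilityMeasure_invWishart hC hγx
  refine isMin_iff_of_eq_klDiv_add (c := ∫ X, llr qX (matrixLebesgue n N) X ∂qX +
    scaleEntropy d.γw qR + 1 / 2 * (matrixExpect qR (fun R => R⁻¹) * (d.Cw +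
      matrixExpect qX fun X => (d.Y - d.H * X) * (d.Y - d.H * X)ᵀ)).trace + K' - K)
    (fun r hr => ⟨?_, fun h => ?_⟩) qP
  · rw [(hK qX r qR inferInstance hr inferInstance).1, (hK' r hr).1]
    exact ⟨fun h => h.2.1, fun h => ⟨hX, h, hR⟩⟩
  · have hr' := (hK' r hr).1.1 h
    rw [(hK qX r qR inferInstance hr inferInstance).2 hX hr' hR, (hK' r hr).2 hr',
      Matrix.trace_mul_comm (matrixExpect r fun P => P⁻¹)]
    ring

theorem isOptimalR_iff (hCx : d.Cx.PosDef) (hCw : d.Cw.PosDef)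
    (hνx : (n : ℝ) < d.νx) (hνw : (m : ℝ) < d.νw)
    {qX : Measure (Matrix (Fin n) (Fin N) ℝ)} {qP : Measure (Matrix (Fin n) (Fin n) ℝ)}
    [IsProbabilityMeasure qX] [IsProbabilityMeasure qP]
    (hX : FiniteEntropyMoment d.U qX) (hP : FiniteScaleEntropy d.γx qP)
    (qR : Measure (Matrix (Fin m) (Fin m) ℝ)) :
    d.IsOptimalR qX qP qR ↔ qR = invWishart
      (d.Cw + matrixExpect qX fun X => (d.Y - d.H * X) * (d.Y - d.H * X)ᵀ) d.γw := by
  have hγw : (m : ℝ) < d.γw := by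
    have : (0 : ℝ) ≤ N := Nat.cast_nonneg N
    rw [γw]; linarith
  have hC : (d.Cw + matrixExpect qX fun X => (d.Y - d.H * X) * (d.Y - d.H * X)ᵀ).PosDef :=
    hCw.add_posSemidef (posSemidef_matrixExpect_mul_transpose (hX.2.2.affine d.Y d.H))
  obtain ⟨K, hK⟩ := exists_meanFieldKL_eq hCx hCw hνx hνw
  obtain ⟨K', hK'⟩ := exists_klDiv_invWishart_eq hC hγw
  have := isProbabilityMeasure_invWishart hC hγw
  refine isMin_iff_of_eq_klDiv_add (c := ∫ X, llr qX (matrixLebesgue n N) X ∂qX +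
    scaleEntropy d.γx qP + 1 / 2 * (matrixExpect qP (fun P => P⁻¹) * (d.Cx +
      matrixExpect qX fun X => (X - d.U) * (X - d.U)ᵀ)).trace + K' - K)
    (fun r hr => ⟨?_, fun h => ?_⟩) qR
  · rw [(hK qX qP r inferInstance inferInstance hr).1, (hK' r hr).1]
    exact ⟨fun h => h.2.2, fun h => ⟨hX, hP, h⟩⟩
  · have hr' := (hK' r hr).1.1 h
    rw [(hK qX qP r inferInstance inferInstance hr).2 hX hP hr', (hK' r hr).2 hr',
      Matrix.trace_mul_comm (matrixExpect r fun P => P⁻¹)]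
    ring

end LinearModel

end

noncomputable section

/-! ### Explicit moments -/

section MatrixExpect

variable {α : Type*} [MeasurableSpace α] {q : Measure α} {a b c : ℕ}

theorem MatrixIntegrable.mul_left {F : α → Matrix (Fin a) (Fin b) ℝ} (hF : MatrixIntegrable q F)
    (D : Matrix (Fin c) (Fin a) ℝ) : MatrixIntegrable q fun x => D * F x := fun i j => by
  simp only [Matrix.mul_apply]
  exact integrable_finsetSum _ fun k _ => (hF k j).const_mul _

theorem MatrixIntegrable.mul_right {F : α → Matrix (Fin a) (Fin b) ℝ} (hF : MatrixIntegrable q F)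
    (D : Matrix (Fin b) (Fin c) ℝ) : MatrixIntegrable q fun x => F x * D := fun i j => by
  simp only [Matrix.mul_apply]
  exact integrable_finsetSum _ fun k _ => (hF i k).mul_const _

theorem matrixExpect_mul_left {F : α → Matrix (Fin a) (Fin b) ℝ} (hF : MatrixIntegrable q F)
    (D : Matrix (Fin c) (Fin a) ℝ) :
    matrixExpect q (fun x => D * F x) = D * matrixExpect q F := by
  ext i j
  simp only [matrixExpect_apply, Matrix.mul_apply]
  rw [integral_finsetSum _ fun k _ => (hF k j).const_mul _]
  simp only [integral_const_mul]

theorem matrixExpect_mul_right {F : α → Matrix (Fin a) (Fin b) ℝ} (hF : MatrixIntegrable q F)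
    (D : Matrix (Fin b) (Fin c) ℝ) :
    matrixExpect q (fun x => F x * D) = matrixExpect q F * D := by
  ext i j
  simp only [matrixExpect_apply, Matrix.mul_apply]
  rw [integral_finsetSum _ fun k _ => (hF i k).mul_const _]
  simp only [integral_mul_const]

theorem matrixExpect_transpose (F : α → Matrix (Fin a) (Fin b) ℝ) :
    matrixExpect q (fun x => (F x)ᵀ) = (matrixExpect q F)ᵀ := rfl

end MatrixExpect

variable {n m N : ℕ}

/-- First moments are recovered from second moments about two centres by `2 x = (x + 1)² - x² - 1`.
-/
theorem integrable_apply_columnGaussian (M : Matrix (Fin n) (Fin N) ℝ)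
    {S : Matrix (Fin n) (Fin n) ℝ} (hS : S.PosSemidef) (i : Fin n) (t : Fin N) :
    Integrable (fun X => X i t - M i t) (columnGaussian M S) ∧
      ∫ X, (X i t - M i t) ∂(columnGaussian M S) = 0 := by
  obtain ⟨h1, e1⟩ := columnGaussian_integral_mul M M hS i i t
  obtain ⟨h2, e2⟩ := columnGaussian_integral_mul M (Matrix.of fun a s => M a s - 1) hS i i t
  simp only [Matrix.of_apply] at h2 e2
  have h21 : Integrable (fun X : Matrix (Fin n) (Fin N) ℝ =>
      (X i t - (M i t - 1)) * (X i t - (M i t - 1)) -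
        (X i t - M i t) * (X i t - M i t)) (columnGaussian M S) := h2.sub h1
  have h3 : Integrable (fun X : Matrix (Fin n) (Fin N) ℝ =>
      (X i t - (M i t - 1)) * (X i t - (M i t - 1)) -
        (X i t - M i t) * (X i t - M i t) - 1) (columnGaussian M S) := h21.sub (integrable_const 1)
  have e : (fun X : Matrix (Fin n) (Fin N) ℝ => X i t - M i t) = fun X => 1 / 2 *
      ((X i t - (M i t - 1)) * (X i t - (M i t - 1)) -
        (X i t - M i t) * (X i t - M i t) - 1) := funext fun X => by ring
  rw [e]
  refine ⟨h3.const_mul (1 / 2), ?_⟩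
  rw [integral_const_mul, integral_sub h21 (integrable_const 1), integral_sub h2 h1, e1, e2]
  simp

theorem integral_const_sub_sub_add {α : Type*} [MeasurableSpace α] {q : Measure α}
    [IsProbabilityMeasure q] {f g h : α → ℝ} (c : ℝ) (hf : Integrable f q) (hg : Integrable g q)
    (hh : Integrable h q) (hf0 : ∫ x, f x ∂q = 0) (hg0 : ∫ x, g x ∂q = 0) :
    ∫ x, (c - f x - g x + h x) ∂q = c + ∫ x, h x ∂q := by
  have h1 : Integrable (fun x => c - f x) q := (integrable_const c).sub hf
  have h2 : Integrable (fun x => c - f x - g x) q := h1.sub hg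
  rw [integral_add h2 hh, integral_sub h1 hg, integral_sub (integrable_const c) hf, hf0, hg0]
  simp

theorem sub_mul_mul_transpose_eq (A : Matrix (Fin m) (Fin N) ℝ) (G : Matrix (Fin m) (Fin n) ℝ)
    (D : Matrix (Fin n) (Fin N) ℝ) : (A - G * D) * (A - G * D)ᵀ =
      A * Aᵀ - (G * D) * Aᵀ - ((G * D) * Aᵀ)ᵀ + G * (D * Dᵀ) * Gᵀ := by
  rw [Matrix.transpose_sub, Matrix.sub_mul, Matrix.mul_sub, Matrix.mul_sub,
    Matrix.transpose_mul (G * D), Matrix.transpose_transpose, Matrix.transpose_mul G D]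
  simp only [Matrix.mul_assoc]
  abel

/-- Expand about the mean `M`: the cross terms have expectation zero and the quadratic term
contributes `N G S Gᵀ`. -/
theorem matrixExpect_affine_columnGaussian (M : Matrix (Fin n) (Fin N) ℝ)
    {S : Matrix (Fin n) (Fin n) ℝ} (hS : S.PosSemidef) (K : Matrix (Fin m) (Fin N) ℝ)
    (G : Matrix (Fin m) (Fin n) ℝ) :
    matrixExpect (columnGaussian M S) (fun X => (K - G * X) * (K - G * X)ᵀ) =
      (N : ℝ) • (G * S * Gᵀ) + (K - G * M) * (K - G * M)ᵀ := by
  obtain ⟨h2, e2⟩ := columnGaussian_moments M M hS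
  have h1 : MatrixIntegrable (columnGaussian M S) fun X => X - M := fun i t =>
    (integrable_apply_columnGaussian M hS i t).1
  have e1 : matrixExpect (columnGaussian M S) (fun X => X - M) = 0 := by
    ext i t
    exact (integrable_apply_columnGaussian M hS i t).2
  have hexp : ∀ X : Matrix (Fin n) (Fin N) ℝ, (K - G * X) * (K - G * X)ᵀ =
      (K - G * M) * (K - G * M)ᵀ - (G * (X - M)) * (K - G * M)ᵀ -
        ((G * (X - M)) * (K - G * M)ᵀ)ᵀ + G * ((X - M) * (X - M)ᵀ) * Gᵀ := fun X => by
    have : K - G * X = (K - G * M) - G * (X - M) := by rw [Matrix.mul_sub]; abel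
    rw [← sub_mul_mul_transpose_eq, ← this]
  have i1 := (h1.mul_left G).mul_right (K - G * M)ᵀ
  have i2 : MatrixIntegrable (columnGaussian M S) fun X =>
      ((G * (X - M)) * (K - G * M)ᵀ)ᵀ := fun i j => i1 j i
  have i3 := (h2.mul_left G).mul_right Gᵀ
  have z1 : matrixExpect (columnGaussian M S) (fun X => (G * (X - M)) * (K - G * M)ᵀ) = 0 := by
    rw [matrixExpect_mul_right (h1.mul_left G), matrixExpect_mul_left h1, e1]
    simp
  have z2 : matrixExpect (columnGaussian M S) (fun X => ((G * (X - M)) * (K - G * M)ᵀ)ᵀ) = 0 := by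
    rw [matrixExpect_transpose, z1, Matrix.transpose_zero]
  have z3 : matrixExpect (columnGaussian M S) (fun X => G * ((X - M) * (X - M)ᵀ) * Gᵀ) =
      (N : ℝ) • (G * S * Gᵀ) := by
    rw [matrixExpect_mul_right (h2.mul_left G), matrixExpect_mul_left h2, e2]
    simp
  rw [funext hexp, ← z3]
  ext i j
  have j1 := i1 i j
  have j2 := i2 i j
  have j3 := i3 i j
  have y1 := congrFun (congrFun z1 i) j
  have y2 := congrFun (congrFun z2 i) j
  exact (integral_const_sub_sub_add (((K - G * M) * (K - G * M)ᵀ) i j) j1 j2 j3 y1 y2).trans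
    (add_comm _ _)

namespace LinearModel

variable {d : LinearModel n m N}

theorem lt_γx (d : LinearModel n m N) (hνx : (n : ℝ) < d.νx) : (n : ℝ) < d.γx := by
  have : (0 : ℝ) ≤ N := Nat.cast_nonneg N
  rw [γx]; linarith

theorem lt_γw (d : LinearModel n m N) (hνw : (m : ℝ) < d.νw) : (m : ℝ) < d.γw := by
  have : (0 : ℝ) ≤ N := Nat.cast_nonneg N
  rw [γw]; linarith

theorem tildeU_smul_inv (d : LinearModel n m N) (A : Matrix (Fin n) (Fin n) ℝ)
    (B : Matrix (Fin m) (Fin m) ℝ) :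
    d.tildeU (d.γx • A⁻¹) (d.γw • B⁻¹) = d.vmapEstimate A B := by
  simp only [tildeU, vmapEstimate, Matrix.mul_smul, Matrix.smul_mul]

theorem tildeP_smul_inv (d : LinearModel n m N) (A : Matrix (Fin n) (Fin n) ℝ)
    (B : Matrix (Fin m) (Fin m) ℝ) :
    d.tildeP (d.γx • A⁻¹) (d.γw • B⁻¹) = d.vmapCov A B := by
  simp only [tildeP, vmapCov, Matrix.mul_smul, Matrix.smul_mul]

/-- In this form the matrix is visibly positive definite, and equal to the scale given by the
optimal update. -/
theorem tildeCx_eq (d : LinearModel n m N) (M : Matrix (Fin n) (Fin N) ℝ)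
    (S : Matrix (Fin n) (Fin n) ℝ) :
    d.tildeCx M S = d.Cx + ((N : ℝ) • S + (M - d.U) * (M - d.U)ᵀ) := by
  rw [tildeCx, Matrix.transpose_sub, Matrix.sub_mul, Matrix.mul_sub, Matrix.mul_sub]
  abel

theorem tildeCw_eq (d : LinearModel n m N) (M : Matrix (Fin n) (Fin N) ℝ)
    (S : Matrix (Fin n) (Fin n) ℝ) : d.tildeCw M S =
      d.Cw + ((N : ℝ) • (d.H * S * d.Hᵀ) + (d.Y - d.H * M) * (d.Y - d.H * M)ᵀ) := by
  rw [tildeCw, Matrix.transpose_sub, Matrix.sub_mul, Matrix.mul_sub, Matrix.mul_sub,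
    Matrix.transpose_mul]
  simp only [Matrix.mul_assoc]
  abel

theorem add_matrixExpect_columnGaussian_eq_tildeCx (d : LinearModel n m N)
    (M : Matrix (Fin n) (Fin N) ℝ) {S : Matrix (Fin n) (Fin n) ℝ} (hS : S.PosDef) :
    d.Cx + matrixExpect (columnGaussian M S) (fun X => (X - d.U) * (X - d.U)ᵀ) =
      d.tildeCx M S := by
  rw [tildeCx_eq, (columnGaussian_moments M d.U hS.posSemidef).2]

theorem add_matrixExpect_columnGaussian_eq_tildeCw (d : LinearModel n m N)
    (M : Matrix (Fin n) (Fin N) ℝ) {S : Matrix (Fin n) (Fin n) ℝ} (hS : S.PosDef) :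
    d.Cw + matrixExpect (columnGaussian M S) (fun X => (d.Y - d.H * X) * (d.Y - d.H * X)ᵀ) =
      d.tildeCw M S := by
  rw [tildeCw_eq, matrixExpect_affine_columnGaussian M hS.posSemidef]

theorem posDef_tildeCx (hCx : d.Cx.PosDef) (M : Matrix (Fin n) (Fin N) ℝ)
    {S : Matrix (Fin n) (Fin n) ℝ} (hS : S.PosDef) : (d.tildeCx M S).PosDef := by
  rw [tildeCx_eq]
  exact hCx.add_posSemidef ((hS.posSemidef.smul (Nat.cast_nonneg N)).add
    (posSemidef_mul_transpose_self _))

theorem posDef_tildeCw (hCw : d.Cw.PosDef) (M : Matrix (Fin n) (Fin N) ℝ)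
    {S : Matrix (Fin n) (Fin n) ℝ} (hS : S.PosDef) : (d.tildeCw M S).PosDef := by
  rw [tildeCw_eq]
  exact hCw.add_posSemidef (((hS.posSemidef.congr_transpose d.H).smul (Nat.cast_nonneg N)).add
    (posSemidef_mul_transpose_self _))

theorem posDef_vmapCov (hγx : 0 < d.γx) (hγw : 0 < d.γw) {A : Matrix (Fin n) (Fin n) ℝ}
    {B : Matrix (Fin m) (Fin m) ℝ} (hA : A.PosDef) (hB : B.PosDef) : (d.vmapCov A B).PosDef := by
  rw [← tildeP_smul_inv]
  exact posDef_tildeP (hA.inv.smul hγx) (hB.inv.smul hγw)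

theorem posDef_vmapScales (hCx : d.Cx.PosDef) (hCw : d.Cw.PosDef) (hγx : 0 < d.γx)
    (hγw : 0 < d.γw) (k : ℕ) : (d.vmapScales k).1.PosDef ∧ (d.vmapScales k).2.PosDef := by
  induction k with
  | zero => exact ⟨hCx, hCw⟩
  | succ k ih =>
    have hS := posDef_vmapCov hγx hγw ih.1 ih.2
    exact ⟨posDef_tildeCx hCx _ hS, posDef_tildeCw hCw _ hS⟩

theorem isOptimalX_invWishart_iff (hCx : d.Cx.PosDef) (hCw : d.Cw.PosDef)
    (hνx : (n : ℝ) < d.νx) (hνw : (m : ℝ) < d.νw) {A : Matrix (Fin n) (Fin n) ℝ}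
    {B : Matrix (Fin m) (Fin m) ℝ} (hA : A.PosDef) (hB : B.PosDef)
    (qX : Measure (Matrix (Fin n) (Fin N) ℝ)) :
    d.IsOptimalX qX (invWishart A d.γx) (invWishart B d.γw) ↔
      qX = columnGaussian (d.vmapEstimate A B) (d.vmapCov A B) := by
  have hγx := d.lt_γx hνx
  have hγw := d.lt_γw hνw
  have := isProbabilityMeasure_invWishart hA hγx
  have := isProbabilityMeasure_invWishart hB hγw
  rw [isOptimalX_iff hCx hCw hνx hνw (finiteScaleEntropy_invWishart hA hγx)
    (finiteScaleEntropy_invWishart hB hγw), matrixExpect_inv_invWishart hA hγx,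
    matrixExpect_inv_invWishart hB hγw, tildeU_smul_inv, tildeP_smul_inv]

/-- Guarantees that a jointly optimal triple has finite divergence, so that the formulas for finite
divergence apply to it. -/
theorem exists_meanFieldKL_ne_top (hCx : d.Cx.PosDef) (hCw : d.Cw.PosDef)
    (hνx : (n : ℝ) < d.νx) (hνw : (m : ℝ) < d.νw) :
    ∃ qX qP qR, IsProbabilityMeasure qX ∧ IsProbabilityMeasure qP ∧ IsProbabilityMeasure qR ∧
      d.meanFieldKL qX qP qR ≠ ∞ := by
  have hγx := d.lt_γx hνx
  have hγw := d.lt_γw hνw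
  have h1 := isProbabilityMeasure_invWishart hCx hγx
  have h2 := isProbabilityMeasure_invWishart hCw hγw
  obtain ⟨K, hK⟩ := exists_meanFieldKL_eq hCx hCw hνx hνw
  exact ⟨columnGaussian d.U 1, _, _, inferInstance, h1, h2,
    (hK _ _ _ inferInstance h1 h2).1.2 ⟨finiteEntropyMoment_columnGaussian _ _ Matrix.PosDef.one,
      finiteScaleEntropy_invWishart hCx hγx, finiteScaleEntropy_invWishart hCw hγw⟩⟩

end LinearModel

end

noncomputable section

/-! ### The objective in terms of the scale matrices -/

theorem llr_withDensity_self_ae_eq {α : Type*} [MeasurableSpace α] {μ : Measure α} [SigmaFinite μ]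
    {p : α → ℝ} (hp : Measurable p) (hpos : ∀ᵐ x ∂μ, 0 < p x) :
    llr (μ.withDensity fun x => ENNReal.ofReal (p x)) μ
      =ᵐ[μ.withDensity fun x => ENNReal.ofReal (p x)] fun x => Real.log (p x) := by
  have hac := withDensity_absolutelyContinuous μ fun x => ENNReal.ofReal (p x)
  filter_upwards [hac.ae_le (Measure.rnDeriv_withDensity μ hp.ennreal_ofReal),
    hac.ae_le hpos] with x h1 h2
  simp only [llr, h1, ENNReal.toReal_ofReal h2.le]

variable {n m N : ℕ}

theorem exists_integral_llr_columnGaussian (n N : ℕ) : ∃ c : ℝ,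
    ∀ (M : Matrix (Fin n) (Fin N) ℝ) (S : Matrix (Fin n) (Fin n) ℝ), S.PosDef →
      ∫ X, llr (columnGaussian M S) (matrixLebesgue n N) X ∂(columnGaussian M S) =
        c - N / 2 * Real.log S.det := by
  refine ⟨N * Real.log ((2 * Real.pi) ^ (-(n : ℝ) / 2)) - 1 / 2 * (N * n), fun M S hS => ?_⟩
  have hm := (continuous_columnGaussianDensity M S).measurable
  have hpos : ∀ᵐ X ∂(matrixLebesgue n N), 0 < columnGaussianDensity M S X :=
    Filter.Eventually.of_forall fun X => columnGaussianDensity_pos M hS X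
  have hdet := hS.det_pos
  have h1 := llr_withDensity_self_ae_eq hm hpos
  rw [← columnGaussian_eq_withDensity M hS] at h1
  obtain ⟨h2, e2⟩ := columnGaussian_moments M M hS.posSemidef
  have e : ∀ X, Real.log (columnGaussianDensity M S X) =
      (N * Real.log ((2 * Real.pi) ^ (-(n : ℝ) / 2)) - N / 2 * Real.log S.det) -
        1 / 2 * (S⁻¹ * ((X - M) * (X - M)ᵀ)).trace := fun X => by
    rw [columnGaussianDensity_eq, Real.log_mul (by positivity) (by positivity), Real.log_exp,
      Real.log_pow, Real.log_mul (by positivity) (by positivity), Real.log_rpow hdet]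
    ring
  rw [integral_congr_ae h1]
  simp only [e]
  rw [integral_sub (integrable_const _) ((integrable_trace_mul h2 S⁻¹).const_mul _),
    integral_const_mul, integral_trace_mul h2, e2]
  simp [Matrix.nonsing_inv_mul _ hdet.ne'.isUnit]
  ring

/-- The log-determinant in `scaleEntropy` has the exponent of the density and cancels, so only the
normalizer and `E[tr (C P⁻¹)] = ν n` remain. -/
theorem exists_scaleEntropy_invWishart {ν : ℝ} (hν : (n : ℝ) < ν) : ∃ c : ℝ,
    ∀ C : Matrix (Fin n) (Fin n) ℝ, C.PosDef →
      scaleEntropy ν (invWishart C ν) = c + ν / 2 * Real.log C.det := by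
  have h1 := integral_invWishartKernel_pos (Matrix.PosDef.one (n := Fin n) (R := ℝ)) hν
  refine ⟨-Real.log (∫ Q, invWishartKernel (1 : Matrix (Fin n) (Fin n) ℝ) ν Q
    ∂(posDefLebesgue n)) - 1 / 2 * (ν * n), fun C hC => ?_⟩
  have hZ := integral_invWishartKernel_pos hC hν
  have hdet := hC.det_pos
  have hpos : ∀ᵐ P ∂(posDefLebesgue n), 0 < invWishartDensity C ν P :=
    ae_posDef.mono fun P hP => invWishartDensity_pos hC hν hP
  have hprob := isProbabilityMeasure_invWishart hC hν
  have h2 := llr_withDensity_self_ae_eq (measurable_invWishartDensity C ν) hpos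
  have hV := matrixIntegrable_inv_invWishart hC hν
  have e : (fun P => llr (invWishart C ν) (posDefLebesgue n) P +
      (ν + n + 1) / 2 * Real.log P.det) =ᵐ[invWishart C ν] fun P =>
      -Real.log (∫ Q, invWishartKernel C ν Q ∂(posDefLebesgue n)) -
        1 / 2 * (C * P⁻¹).trace := by
    filter_upwards [h2, ae_posDef_invWishart (C := C) (ν := ν)] with P h3 hP
    rw [invWishart, h3, invWishartDensity, Real.log_mul (inv_pos.2 hZ).ne'
      (invWishartKernel_pos C ν hP).ne', log_invWishartKernel C ν hP, Real.log_inv]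
    ring
  rw [scaleEntropy, integral_congr_ae e, integral_sub (integrable_const _)
    ((integrable_trace_mul hV C).const_mul _), integral_const_mul, integral_trace_mul hV,
    matrixExpect_inv_invWishart hC hν, integral_invWishartKernel hC ν,
    Real.log_mul (by positivity) h1.ne', Real.log_rpow hdet, Matrix.mul_smul,
    Matrix.mul_nonsing_inv _ hdet.ne'.isUnit]
  simp
  ring

theorem Continuous.matrix_inv' {α : Type*} [TopologicalSpace α]
    {f : α → Matrix (Fin n) (Fin n) ℝ} (hf : Continuous f) (h : ∀ x, (f x).det ≠ 0) :
    Continuous fun x => (f x)⁻¹ := by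
  simp only [Matrix.inv_def, Ring.inverse_eq_inv']
  exact (hf.matrix_det.inv₀ h).smul hf.matrix_adjugate

/-- A sublevel set of the trace in the cone of positive semidefinite matrices is compact. -/
theorem isCompact_posSemidef_trace_le (C : Matrix (Fin n) (Fin n) ℝ) (τ : ℝ) :
    IsCompact {A : Matrix (Fin n) (Fin n) ℝ | (A - C).PosSemidef ∧ (A - C).trace ≤ τ} := by
  have h1 : IsCompact {A : Matrix (Fin n) (Fin n) ℝ | A.PosSemidef ∧ A.trace ≤ τ} := by
    have hbox : IsCompact {A : Matrix (Fin n) (Fin n) ℝ | ∀ i j, A i j ∈ Set.Icc (-τ) τ} := by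
      have := isCompact_univ_pi (X := fun _ : Fin n => Fin n → ℝ)
        (s := fun _ => Set.univ.pi fun _ => Set.Icc (-τ) τ)
        fun _ => isCompact_univ_pi fun _ => isCompact_Icc
      have e : {A : Matrix (Fin n) (Fin n) ℝ | ∀ i j, A i j ∈ Set.Icc (-τ) τ} =
          Set.univ.pi fun _ : Fin n => Set.univ.pi fun _ : Fin n => Set.Icc (-τ) τ :=
        Set.ext fun A => ⟨fun h i _ j _ => h i j, fun h i j => h i trivial j trivial⟩
      rw [e]
      exact this
    refine hbox.of_isClosed_subset ?_ ?_
    · exact Matrix.isClosed_posSemidef.inter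
        (isClosed_le (continuous_id.matrix_trace) continuous_const)
    · rintro A ⟨hA, ht⟩ i j
      have := hA.abs_apply_le_trace i j
      exact abs_le.1 (this.trans ht)
  have h2 : {A : Matrix (Fin n) (Fin n) ℝ | (A - C).PosSemidef ∧ (A - C).trace ≤ τ} =
      (fun A => A + C) '' {A | A.PosSemidef ∧ A.trace ≤ τ} := by
    ext A
    constructor
    · intro h
      exact ⟨A - C, h, sub_add_cancel A C⟩
    · rintro ⟨B, hB, rfl⟩
      simpa using hB
  rw [h2]
  exact h1.image (continuous_id.add continuous_const)

namespace LinearModel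

variable {d : LinearModel n m N}

/-- The divergence after an update of the first factor, as a function of the scale matrices. -/
def objective (d : LinearModel n m N) (A : Matrix (Fin n) (Fin n) ℝ)
    (B : Matrix (Fin m) (Fin m) ℝ) : ℝ :=
  -(N / 2 * Real.log (d.vmapCov A B).det) + d.γx / 2 * Real.log A.det +
    d.γw / 2 * Real.log B.det +
    d.γx / 2 * (A⁻¹ * d.tildeCx (d.vmapEstimate A B) (d.vmapCov A B)).trace +
    d.γw / 2 * (B⁻¹ * d.tildeCw (d.vmapEstimate A B) (d.vmapCov A B)).trace

theorem exists_meanFieldKL_eq_objective (hCx : d.Cx.PosDef) (hCw : d.Cw.PosDef)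
    (hνx : (n : ℝ) < d.νx) (hνw : (m : ℝ) < d.νw) : ∃ c : ℝ,
    ∀ (A : Matrix (Fin n) (Fin n) ℝ) (B : Matrix (Fin m) (Fin m) ℝ), A.PosDef → B.PosDef →
      d.meanFieldKL (columnGaussian (d.vmapEstimate A B) (d.vmapCov A B))
        (invWishart A d.γx) (invWishart B d.γw) ≠ ∞ ∧
      (d.meanFieldKL (columnGaussian (d.vmapEstimate A B) (d.vmapCov A B))
        (invWishart A d.γx) (invWishart B d.γw)).toReal = c + d.objective A B := by
  have hγx := d.lt_γx hνx
  have hγw := d.lt_γw hνw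
  obtain ⟨K, hK⟩ := exists_meanFieldKL_eq hCx hCw hνx hνw
  obtain ⟨c1, h1⟩ := exists_integral_llr_columnGaussian n N
  obtain ⟨c2, h2⟩ := exists_scaleEntropy_invWishart hγx
  obtain ⟨c3, h3⟩ := exists_scaleEntropy_invWishart hγw
  refine ⟨c1 + c2 + c3 - K, fun A B hA hB => ?_⟩
  have hS : (d.vmapCov A B).PosDef := posDef_vmapCov ((Nat.cast_nonneg n).trans_lt hγx)
    ((Nat.cast_nonneg m).trans_lt hγw) hA hB
  have i1 := isProbabilityMeasure_invWishart hA hγx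
  have i2 := isProbabilityMeasure_invWishart hB hγw
  have f1 := finiteEntropyMoment_columnGaussian d.U (d.vmapEstimate A B) hS
  have f2 := finiteScaleEntropy_invWishart hA hγx
  have f3 := finiteScaleEntropy_invWishart hB hγw
  obtain ⟨h4, h5⟩ := hK (columnGaussian (d.vmapEstimate A B) (d.vmapCov A B)) _ _
    inferInstance i1 i2
  refine ⟨h4.2 ⟨f1, f2, f3⟩, ?_⟩
  rw [h5 f1 f2 f3, h1 _ _ hS, h2 A hA, h3 B hB, matrixExpect_inv_invWishart hA hγx,
    matrixExpect_inv_invWishart hB hγw, add_matrixExpect_columnGaussian_eq_tildeCx _ _ hS,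
    add_matrixExpect_columnGaussian_eq_tildeCw _ _ hS, objective, Matrix.smul_mul,
    Matrix.smul_mul, Matrix.trace_smul, Matrix.trace_smul, smul_eq_mul, smul_eq_mul]
  ring

theorem posDef_of_sub_posSemidef {C A : Matrix (Fin n) (Fin n) ℝ} (hC : C.PosDef)
    (h : (A - C).PosSemidef) : A.PosDef := by
  have := hC.add_posSemidef h
  rwa [add_sub_cancel] at this

theorem continuousOn_objective (hγx : 0 < d.γx) (hγw : 0 < d.γw) :
    ContinuousOn (fun z : Matrix (Fin n) (Fin n) ℝ × Matrix (Fin m) (Fin m) ℝ =>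
      d.objective z.1 z.2) {z | z.1.PosDef ∧ z.2.PosDef} := by
  rw [continuousOn_iff_continuous_domRestrict]
  set s := {z : Matrix (Fin n) (Fin n) ℝ × Matrix (Fin m) (Fin m) ℝ | z.1.PosDef ∧ z.2.PosDef}
  have cA : Continuous fun z : s => z.1.1 := by fun_prop
  have cB : Continuous fun z : s => z.1.2 := by fun_prop
  have cAi : Continuous fun z : s => z.1.1⁻¹ := cA.matrix_inv' fun z => z.2.1.det_pos.ne'
  have cBi : Continuous fun z : s => z.1.2⁻¹ := cB.matrix_inv' fun z => z.2.2.det_pos.ne'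
  have cS : Continuous fun z : s => d.vmapCov z.1.1 z.1.2 := by
    refine Continuous.matrix_inv' (f := fun z : s =>
      d.γw • (d.Hᵀ * z.1.2⁻¹ * d.H) + d.γx • z.1.1⁻¹) ?_ fun z => ?_
    · fun_prop
    · have h := (posDef_vmapCov hγx hγw z.2.1 z.2.2).inv.det_pos
      rw [vmapCov] at h
      intro h0
      rw [Matrix.det_nonsing_inv, Matrix.det_nonsing_inv, h0] at h
      simp at h
  have cM : Continuous fun z : s => d.vmapEstimate z.1.1 z.1.2 := by
    refine cS.matrix_mul (B := fun z : s =>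
      d.γw • (d.Hᵀ * z.1.2⁻¹ * d.Y) + d.γx • (z.1.1⁻¹ * d.U)) ?_
    fun_prop
  have cX : Continuous fun z : s =>
      d.tildeCx (d.vmapEstimate z.1.1 z.1.2) (d.vmapCov z.1.1 z.1.2) := by
    simp only [tildeCx_eq]
    fun_prop
  have cW : Continuous fun z : s =>
      d.tildeCw (d.vmapEstimate z.1.1 z.1.2) (d.vmapCov z.1.1 z.1.2) := by
    simp only [tildeCw_eq]
    fun_prop
  exact (((((cS.matrix_det.log fun z =>
    (posDef_vmapCov hγx hγw z.2.1 z.2.2).det_pos.ne').const_mul _).neg.add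
    ((cA.matrix_det.log fun z => z.2.1.det_pos.ne').const_mul _)).add
    ((cB.matrix_det.log fun z => z.2.2.det_pos.ne').const_mul _)).add
    ((cAi.matrix_mul cX).matrix_trace.const_mul _)).add
    ((cBi.matrix_mul cW).matrix_trace.const_mul _)

/-- Drop the two nonnegative traces and the observation term in the precision. The precision then
still satisfies `log det ≥ n log γ_x - log |A|`; this costs `(N/2) log |A|` and leaves the
coefficient `ν_x / 2` instead of `γ_x / 2`. -/
theorem objective_ge (hCx : d.Cx.PosDef) (hCw : d.Cw.PosDef) (hγx : 0 < d.γx) (hγw : 0 < d.γw)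
    {A : Matrix (Fin n) (Fin n) ℝ} {B : Matrix (Fin m) (Fin m) ℝ} (hA : A.PosDef)
    (hB : B.PosDef) : N / 2 * (n * Real.log d.γx) + d.νx / 2 * Real.log A.det +
      d.γw / 2 * Real.log B.det ≤ d.objective A B := by
  have hS := posDef_vmapCov hγx hγw hA hB
  have h1 : 0 ≤ (A⁻¹ * d.tildeCx (d.vmapEstimate A B) (d.vmapCov A B)).trace :=
    hA.inv.posSemidef.trace_mul_nonneg (posDef_tildeCx hCx _ hS).posSemidef
  have h2 : 0 ≤ (B⁻¹ * d.tildeCw (d.vmapEstimate A B) (d.vmapCov A B)).trace :=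
    hB.inv.posSemidef.trace_mul_nonneg (posDef_tildeCw hCw _ hS).posSemidef
  have hAd := hA.det_pos
  have h3 : (d.γx • A⁻¹).det ≤ (d.γx • A⁻¹ + d.γw • (d.Hᵀ * B⁻¹ * d.H)).det :=
    (hA.inv.smul hγx).det_le_det_add
      ((hB.inv.posSemidef.transpose_congr d.H).smul hγw.le)
  have h4 : (d.γx • A⁻¹).det = d.γx ^ n * A.det⁻¹ := by
    rw [Matrix.det_smul, Matrix.det_nonsing_inv, Ring.inverse_eq_inv', Fintype.card_fin]
  have h5 : Real.log (d.vmapCov A B).det =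
      -Real.log (d.γx • A⁻¹ + d.γw • (d.Hᵀ * B⁻¹ * d.H)).det := by
    rw [vmapCov, Matrix.det_nonsing_inv, Ring.inverse_eq_inv', Real.log_inv, add_comm]
  have h6 : n * Real.log d.γx - Real.log A.det ≤ -Real.log (d.vmapCov A B).det := by
    rw [h5, neg_neg]
    have := Real.log_le_log (by rw [h4]; positivity) h3
    rwa [h4, Real.log_mul (by positivity) (by positivity), Real.log_pow, Real.log_inv,
      ← sub_eq_add_neg] at this
  have hN : (0 : ℝ) ≤ N / 2 := by positivity
  have h7 := mul_le_mul_of_nonneg_left h6 hN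
  have h8 := mul_nonneg (half_pos hγx).le h1
  have h9 := mul_nonneg (half_pos hγw).le h2
  have h10 : d.γx / 2 * Real.log A.det = d.νx / 2 * Real.log A.det + N / 2 * Real.log A.det := by
    rw [γx]; ring
  rw [objective]
  linarith

end LinearModel

end

noncomputable section

/-! ### Existence of an optimum -/

variable {n m N : ℕ}

theorem Matrix.PosDef.exists_le_log_det {C : Matrix (Fin n) (Fin n) ℝ} (hC : C.PosDef) :
    ∃ c : ℝ, 0 < c ∧ ∀ A : Matrix (Fin n) (Fin n) ℝ, (A - C).PosSemidef →
      n * Real.log c + Real.log (1 + c⁻¹ * (A - C).trace) ≤ Real.log A.det := by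
  obtain ⟨c, hc, hle⟩ := hC.exists_smul_one_le
  refine ⟨c, hc, fun A hA => ?_⟩
  have h1 : (A - c • (1 : Matrix (Fin n) (Fin n) ℝ)).PosSemidef := by
    have := hA.add hle
    rwa [sub_add_sub_cancel] at this
  have h2 := h1.pow_mul_le_det hc
  have h3 : (A - C).trace ≤ (A - c • (1 : Matrix (Fin n) (Fin n) ℝ)).trace := by
    have := hle.trace_nonneg
    rw [Matrix.trace_sub] at this ⊢
    rw [Matrix.trace_sub]
    linarith
  have h4 : 0 < 1 + c⁻¹ * (A - C).trace := by
    have := hA.trace_nonneg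
    positivity
  rw [← Real.log_pow, ← Real.log_mul (by positivity) h4.ne']
  refine Real.log_le_log (by positivity) (le_trans ?_ h2)
  gcongr

theorem le_mul_exp_of_mul_log_le {c t x T : ℝ} (hc : 0 < c) (ht : 0 < t) (hx : 0 ≤ x)
    (h : t * Real.log (1 + c⁻¹ * x) ≤ T) : x ≤ c * Real.exp (T / t) := by
  have h0 : 0 < 1 + c⁻¹ * x := by positivity
  have h1 : Real.log (1 + c⁻¹ * x) ≤ T / t := by
    rw [le_div_iff₀ ht]; linarith
  rw [Real.log_le_iff_le_exp h0] at h1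
  have h2 : c⁻¹ * x ≤ Real.exp (T / t) := by linarith
  rwa [inv_mul_le_iff₀ hc] at h2

namespace LinearModel

variable {d : LinearModel n m N}

/-- Coercivity from `objective_ge` and `Matrix.PosDef.exists_le_log_det`. Minimality is needed only
against scales above `C_x` and `C_w`, as every optimal update produces such scales. -/
theorem exists_objective_le (hCx : d.Cx.PosDef) (hCw : d.Cw.PosDef) (hνx : 0 < d.νx)
    (hγw : 0 < d.γw) : ∃ A B, A.PosDef ∧ B.PosDef ∧
      ∀ A' B', (A' - d.Cx).PosSemidef → (B' - d.Cw).PosSemidef →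
        d.objective A B ≤ d.objective A' B' := by
  have hγx : 0 < d.γx := by
    have : (0 : ℝ) ≤ N := Nat.cast_nonneg N
    rw [γx]; linarith
  obtain ⟨a, ha, hA⟩ := hCx.exists_le_log_det
  obtain ⟨b, hb, hB⟩ := hCw.exists_le_log_det
  -- `T` is what remains for the two logarithmic trace terms when the objective is at most its value
  -- at `(C_x, C_w)`. Both terms are nonnegative, so each is at most `T`, which bounds the traces as
  -- in `s`.
  set T := d.objective d.Cx d.Cw - N / 2 * (n * Real.log d.γx) - d.νx / 2 * (n * Real.log a) -
    d.γw / 2 * (m * Real.log b) with hT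
  set s := {A : Matrix (Fin n) (Fin n) ℝ | (A - d.Cx).PosSemidef ∧
      (A - d.Cx).trace ≤ a * Real.exp (T / (d.νx / 2))} ×ˢ
    {B : Matrix (Fin m) (Fin m) ℝ | (B - d.Cw).PosSemidef ∧
      (B - d.Cw).trace ≤ b * Real.exp (T / (d.γw / 2))} with hs
  have hcomp : IsCompact s :=
    (isCompact_posSemidef_trace_le _ _).prod (isCompact_posSemidef_trace_le _ _)
  have h0 : (d.Cx, d.Cw) ∈ s := by
    refine ⟨⟨?_, ?_⟩, ⟨?_, ?_⟩⟩
    · rw [sub_self]; exact Matrix.PosSemidef.zero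
    · simp only [sub_self, Matrix.trace_zero]; positivity
    · rw [sub_self]; exact Matrix.PosSemidef.zero
    · simp only [sub_self, Matrix.trace_zero]; positivity
  have hcont : ContinuousOn (fun z : Matrix (Fin n) (Fin n) ℝ × Matrix (Fin m) (Fin m) ℝ =>
      d.objective z.1 z.2) s :=
    (continuousOn_objective hγx hγw).mono fun z hz =>
      ⟨posDef_of_sub_posSemidef hCx hz.1.1, posDef_of_sub_posSemidef hCw hz.2.1⟩
  obtain ⟨z, hz, hmin⟩ := hcomp.exists_isMinOn ⟨_, h0⟩ hcont
  refine ⟨z.1, z.2, posDef_of_sub_posSemidef hCx hz.1.1, posDef_of_sub_posSemidef hCw hz.2.1,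
    fun A' B' hA' hB' => ?_⟩
  have hmin' : ∀ w ∈ s, d.objective z.1 z.2 ≤ d.objective w.1 w.2 := fun w hw => hmin hw
  by_contra! hlt
  -- A competitor below the minimum over `s` is also below the value at `(C_x, C_w)`, which forces
  -- it into `s`.
  have h1 := hlt.trans_le (hmin' _ h0)
  have h2 := objective_ge hCx hCw hγx hγw (posDef_of_sub_posSemidef hCx hA')
    (posDef_of_sub_posSemidef hCw hB')
  have hta := hA'.trace_nonneg
  have htb := hB'.trace_nonneg
  have h3 := mul_le_mul_of_nonneg_left (hA A' hA') (half_pos hνx).le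
  have h4 := mul_le_mul_of_nonneg_left (hB B' hB') (half_pos hγw).le
  have h5 : 0 ≤ d.νx / 2 * Real.log (1 + a⁻¹ * (A' - d.Cx).trace) := by
    refine mul_nonneg (half_pos hνx).le (Real.log_nonneg ?_)
    have : 0 ≤ a⁻¹ * (A' - d.Cx).trace := by positivity
    linarith
  have h6 : 0 ≤ d.γw / 2 * Real.log (1 + b⁻¹ * (B' - d.Cw).trace) := by
    refine mul_nonneg (half_pos hγw).le (Real.log_nonneg ?_)
    have : 0 ≤ b⁻¹ * (B' - d.Cw).trace := by positivity
    linarith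
  rw [mul_add] at h3 h4
  have h7 : (A', B') ∈ s :=
    ⟨⟨hA', le_mul_exp_of_mul_log_le ha (half_pos hνx) hta (by linarith)⟩,
      ⟨hB', le_mul_exp_of_mul_log_le hb (half_pos hγw) htb (by linarith)⟩⟩
  exact absurd (hmin' _ h7) (not_le.2 hlt)

theorem exists_isMeanFieldOptimal (hCx : d.Cx.PosDef) (hCw : d.Cw.PosDef)
    (hνx : (n : ℝ) < d.νx) (hνw : (m : ℝ) < d.νw) :
    ∃ qX qP qR, d.IsMeanFieldOptimal qX qP qR := by
  have hγx := d.lt_γx hνx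
  have hγw := d.lt_γw hνw
  obtain ⟨A, B, hA, hB, hmin⟩ := exists_objective_le hCx hCw
    ((Nat.cast_nonneg n).trans_lt hνx) ((Nat.cast_nonneg m).trans_lt hγw)
  obtain ⟨K, hK⟩ := exists_meanFieldKL_eq hCx hCw hνx hνw
  obtain ⟨c, hc⟩ := exists_meanFieldKL_eq_objective hCx hCw hνx hνw
  refine ⟨columnGaussian (d.vmapEstimate A B) (d.vmapCov A B), invWishart A d.γx,
    invWishart B d.γw, inferInstance, isProbabilityMeasure_invWishart hA hγx,
    isProbabilityMeasure_invWishart hB hγw, fun rX rP rR iX iP iR => ?_⟩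
  by_cases htop : d.meanFieldKL rX rP rR = ∞
  · rw [htop]; exact le_top
  obtain ⟨gX, gP, -⟩ := (hK rX rP rR iX iP iR).1.1 htop
  have hSx := posSemidef_matrixExpect_mul_transpose gX.2.2
  have hSw := posSemidef_matrixExpect_mul_transpose (gX.2.2.affine d.Y d.H)
  set A' := d.Cx + matrixExpect rX fun X => (X - d.U) * (X - d.U)ᵀ with hA'def
  set B' := d.Cw + matrixExpect rX fun X => (d.Y - d.H * X) * (d.Y - d.H * X)ᵀ with hB'def
  have hA' : A'.PosDef := hCx.add_posSemidef hSx
  have hB' : B'.PosDef := hCw.add_posSemidef hSw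
  have jB := isProbabilityMeasure_invWishart hB' hγw
  -- Three updates applied to an arbitrary finite competitor, each not increasing the divergence.
  -- The new scales `A'` and `B'` both come from `rX`, so `X` has to be updated last.
  have s1 := ((isOptimalR_iff hCx hCw hνx hνw gX gP _).2 rfl).2 rR iR
  have s2 := ((isOptimalP_iff hCx hCw hνx hνw gX
    (finiteScaleEntropy_invWishart hB' hγw) _).2 rfl).2 rP iP
  have s3 := ((isOptimalX_invWishart_iff hCx hCw hνx hνw hA' hB' _).2 rfl).2 rX iX
  refine le_trans ?_ (s3.trans (s2.trans s1))
  rw [← ENNReal.toReal_le_toReal (hc A B hA hB).1 (hc A' B' hA' hB').1, (hc A B hA hB).2,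
    (hc A' B' hA' hB').2]
  have := hmin A' B' (by rw [hA'def, add_sub_cancel_left]; exact hSx)
    (by rw [hB'def, add_sub_cancel_left]; exact hSw)
  linarith

end LinearModel

end

/-! ### Assembly of the theorem. -/

theorem mainTheorem6 {n m N : ℕ} (d : LinearModel n m N)
    (hCx : d.Cx.PosDef) (hCw : d.Cw.PosDef)
    (hνx : (n : ℝ) + 1 < d.νx) (hνw : (m : ℝ) + 1 < d.νw) :
    -- the optimal `q(X)` for given `q(P)`, `q(R)`
    (∀ (qP : Measure (Matrix (Fin n) (Fin n) ℝ)) (qR : Measure (Matrix (Fin m) (Fin m) ℝ)),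
      IsProbabilityMeasure qP → IsProbabilityMeasure qR →
      (∃ r, IsProbabilityMeasure r ∧ d.meanFieldKL r qP qR ≠ ∞) →
      MatrixIntegrable qP (fun P => P⁻¹) ∧ MatrixIntegrable qR (fun R => R⁻¹) ∧
      ∀ V W, V = matrixExpect qP (fun P => P⁻¹) → W = matrixExpect qR (fun R => R⁻¹) →
        (∀ qX, d.IsOptimalX qX qP qR ↔ qX = columnGaussian (d.tildeU V W) (d.tildeP V W)) ∧
        IsUniqueMode (columnGaussian (d.tildeU V W) (d.tildeP V W)) (d.tildeU V W)) ∧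
    -- the optimal `q(P)` for given `q(X)`, `q(R)`
    (∀ (qX : Measure (Matrix (Fin n) (Fin N) ℝ)) (qR : Measure (Matrix (Fin m) (Fin m) ℝ)),
      IsProbabilityMeasure qX → IsProbabilityMeasure qR →
      (∃ r, IsProbabilityMeasure r ∧ d.meanFieldKL qX r qR ≠ ∞) →
      MatrixIntegrable qX (fun X => (X - d.U) * (X - d.U)ᵀ) ∧
      ∀ qP, d.IsOptimalP qX qP qR ↔
        qP = invWishart (d.Cx + matrixExpect qX (fun X => (X - d.U) * (X - d.U)ᵀ)) d.γx) ∧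
    -- the optimal `q(R)` for given `q(X)`, `q(P)`
    (∀ (qX : Measure (Matrix (Fin n) (Fin N) ℝ)) (qP : Measure (Matrix (Fin n) (Fin n) ℝ)),
      IsProbabilityMeasure qX → IsProbabilityMeasure qP →
      (∃ r, IsProbabilityMeasure r ∧ d.meanFieldKL qX qP r ≠ ∞) →
      MatrixIntegrable qX (fun X => (d.Y - d.H * X) * (d.Y - d.H * X)ᵀ) ∧
      ∀ qR, d.IsOptimalR qX qP qR ↔
        qR = invWishart
          (d.Cw + matrixExpect qX (fun X => (d.Y - d.H * X) * (d.Y - d.H * X)ᵀ)) d.γw) ∧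
    -- a jointly optimal triple exists
    (∃ qX qP qR, d.IsMeanFieldOptimal qX qP qR) ∧
    -- every jointly optimal triple has the stated form
    (∀ qX qP qR, d.IsMeanFieldOptimal qX qP qR →
      ∀ V W U' P' A B,
        V = matrixExpect qP (fun P => P⁻¹) → W = matrixExpect qR (fun R => R⁻¹) →
        U' = d.tildeU V W → P' = d.tildeP V W →
        A = d.Cx + matrixExpect qX (fun X => (X - d.U) * (X - d.U)ᵀ) →
        B = d.Cw + matrixExpect qX (fun X => (d.Y - d.H * X) * (d.Y - d.H * X)ᵀ) →
        MatrixIntegrable qP (fun P => P⁻¹) ∧ MatrixIntegrable qR (fun R => R⁻¹) ∧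
        MatrixIntegrable qX (fun X => (X - d.U) * (X - d.U)ᵀ) ∧
        MatrixIntegrable qX (fun X => (d.Y - d.H * X) * (d.Y - d.H * X)ᵀ) ∧
        P'.PosDef ∧ A.PosDef ∧ B.PosDef ∧
        qX = columnGaussian U' P' ∧ qP = invWishart A d.γx ∧ qR = invWishart B d.γw ∧
        A = d.tildeCx U' P' ∧ B = d.tildeCw U' P' ∧
        V = d.γx • A⁻¹ ∧ W = d.γw • B⁻¹ ∧
        IsUniqueMode qX U' ∧
        U' = (d.γw • (d.Hᵀ * B⁻¹ * d.H) + d.γx • A⁻¹)⁻¹ *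
          (d.γw • (d.Hᵀ * B⁻¹ * d.Y) + d.γx • (A⁻¹ * d.U))) ∧
    -- the iteration consists of the successive optimal updates of the three factors
    (∀ (k : ℕ) (A A' P' : Matrix (Fin n) (Fin n) ℝ) (B B' : Matrix (Fin m) (Fin m) ℝ)
      (X' : Matrix (Fin n) (Fin N) ℝ),
      (A, B) = d.vmapScales k → (A', B') = d.vmapScales (k + 1) →
      X' = (d.γw • (d.Hᵀ * B⁻¹ * d.H) + d.γx • A⁻¹)⁻¹ *
        (d.γw • (d.Hᵀ * B⁻¹ * d.Y) + d.γx • (A⁻¹ * d.U)) →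
      P' = (d.γw • (d.Hᵀ * B⁻¹ * d.H) + d.γx • A⁻¹)⁻¹ →
      A.PosDef ∧ B.PosDef ∧ P'.PosDef ∧
      A' = d.tildeCx X' P' ∧ B' = d.tildeCw X' P' ∧
      matrixExpect (invWishart A d.γx) (fun P => P⁻¹) = d.γx • A⁻¹ ∧
      matrixExpect (invWishart B d.γw) (fun R => R⁻¹) = d.γw • B⁻¹ ∧
      (∀ qX, d.IsOptimalX qX (invWishart A d.γx) (invWishart B d.γw) ↔
        qX = columnGaussian X' P') ∧
      IsUniqueMode (columnGaussian X' P') X' ∧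
      (∀ qP, d.IsOptimalP (columnGaussian X' P') qP (invWishart B d.γw) ↔
        qP = invWishart A' d.γx) ∧
      (∀ qR, d.IsOptimalR (columnGaussian X' P') (invWishart A' d.γx) qR ↔
        qR = invWishart B' d.γw)) := by
  have hνx' : (n : ℝ) < d.νx := by linarith
  have hνw' : (m : ℝ) < d.νw := by linarith
  have hγx := d.lt_γx hνx'
  have hγw := d.lt_γw hνw'
  have hγx0 : 0 < d.γx := (Nat.cast_nonneg n).trans_lt hγx
  have hγw0 : 0 < d.γw := (Nat.cast_nonneg m).trans_lt hγw
  obtain ⟨K, hK⟩ := LinearModel.exists_meanFieldKL_eq hCx hCw hνx' hνw'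
  refine ⟨?_, ?_, ?_, LinearModel.exists_isMeanFieldOptimal hCx hCw hνx' hνw', ?_, ?_⟩
  · rintro qP qR iP iR ⟨r, ir, hr⟩
    obtain ⟨-, gP, gR⟩ := (hK r qP qR ir iP iR).1.1 hr
    refine ⟨gP.2.2, gR.2.2, ?_⟩
    rintro V W rfl rfl
    exact ⟨LinearModel.isOptimalX_iff hCx hCw hνx' hνw' gP gR,
      isUniqueMode_columnGaussian _ (LinearModel.posDef_tildeP gP.posDef_matrixExpect_inv
        gR.posDef_matrixExpect_inv)⟩
  · rintro qX qR iX iR ⟨r, ir, hr⟩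
    obtain ⟨gX, -, gR⟩ := (hK qX r qR iX ir iR).1.1 hr
    exact ⟨gX.2.2, LinearModel.isOptimalP_iff hCx hCw hνx' hνw' gX gR⟩
  · rintro qX qP iX iP ⟨r, ir, hr⟩
    obtain ⟨gX, gP, -⟩ := (hK qX qP r iX iP ir).1.1 hr
    exact ⟨gX.2.2.affine d.Y d.H, LinearModel.isOptimalR_iff hCx hCw hνx' hνw' gX gP⟩
  · rintro qX qP qR ⟨iX, iP, iR, hopt⟩ V W U' P' A B hV hW hU' hP' hA hB
    obtain ⟨rX, rP, rR, jX, jP, jR, hr⟩ :=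
      LinearModel.exists_meanFieldKL_ne_top hCx hCw hνx' hνw'
    -- Comparison with one triple of finite divergence yields all moments. Joint optimality then
    -- implies optimality in each factor, and the single-factor results identify the three laws.
    have hfin := ne_top_of_le_ne_top hr (hopt rX rP rR jX jP jR)
    obtain ⟨gX, gP, gR⟩ := (hK qX qP qR iX iP iR).1.1 hfin
    have eX : qX = columnGaussian U' P' := by
      rw [hU', hP', hV, hW]
      exact (LinearModel.isOptimalX_iff hCx hCw hνx' hνw' gP gR qX).1
        ⟨iX, fun r ir => hopt r qP qR ir iP iR⟩
    have eP : qP = invWishart A d.γx := by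
      rw [hA]
      exact (LinearModel.isOptimalP_iff hCx hCw hνx' hνw' gX gR qP).1
        ⟨iP, fun r ir => hopt qX r qR iX ir iR⟩
    have eR : qR = invWishart B d.γw := by
      rw [hB]
      exact (LinearModel.isOptimalR_iff hCx hCw hνx' hνw' gX gP qR).1
        ⟨iR, fun r ir => hopt qX qP r iX iP ir⟩
    have pV : V.PosDef := hV ▸ gP.posDef_matrixExpect_inv
    have pW : W.PosDef := hW ▸ gR.posDef_matrixExpect_inv
    have pP' : P'.PosDef := hP' ▸ LinearModel.posDef_tildeP pV pW
    have eA : A = d.tildeCx U' P' := by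
      rw [hA, eX, d.add_matrixExpect_columnGaussian_eq_tildeCx U' pP']
    have eB : B = d.tildeCw U' P' := by
      rw [hB, eX, d.add_matrixExpect_columnGaussian_eq_tildeCw U' pP']
    have pA : A.PosDef := eA ▸ LinearModel.posDef_tildeCx hCx U' pP'
    have pB : B.PosDef := eB ▸ LinearModel.posDef_tildeCw hCw U' pP'
    have eV : V = d.γx • A⁻¹ := by rw [hV, eP, matrixExpect_inv_invWishart pA hγx]
    have eW : W = d.γw • B⁻¹ := by rw [hW, eR, matrixExpect_inv_invWishart pB hγw]
    refine ⟨gP.2.2, gR.2.2, gX.2.2, gX.2.2.affine d.Y d.H, pP', pA, pB, eX, eP, eR, eA, eB, eV,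
      eW, ?_, ?_⟩
    · rw [eX]
      exact isUniqueMode_columnGaussian _ pP'
    · rw [hU', eV, eW, d.tildeU_smul_inv, LinearModel.vmapEstimate]
  · rintro k A A' P' B B' X' hk hk1 rfl rfl
    have hAB := LinearModel.posDef_vmapScales hCx hCw hγx0 hγw0 k
    rw [← hk] at hAB
    obtain ⟨pA, pB⟩ := hAB
    have hS := LinearModel.posDef_vmapCov hγx0 hγw0 pA pB
    have hA' : A' = d.tildeCx (d.vmapEstimate A B) (d.vmapCov A B) := by
      have := congrArg Prod.fst hk1
      rwa [LinearModel.vmapScales, ← hk] at this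
    have hB' : B' = d.tildeCw (d.vmapEstimate A B) (d.vmapCov A B) := by
      have := congrArg Prod.snd hk1
      rwa [LinearModel.vmapScales, ← hk] at this
    have pA' : A'.PosDef := hA' ▸ LinearModel.posDef_tildeCx hCx _ hS
    have iB := isProbabilityMeasure_invWishart pB hγw
    have iA' := isProbabilityMeasure_invWishart pA' hγx
    have gX := finiteEntropyMoment_columnGaussian d.U (d.vmapEstimate A B) hS
    refine ⟨pA, pB, hS, hA', hB', matrixExpect_inv_invWishart pA hγx,
      matrixExpect_inv_invWishart pB hγw,
      LinearModel.isOptimalX_invWishart_iff hCx hCw hνx' hνw' pA pB,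
      isUniqueMode_columnGaussian _ hS, ?_, ?_⟩
    · have h := LinearModel.isOptimalP_iff hCx hCw hνx' hνw' gX
        (finiteScaleEntropy_invWishart pB hγw)
      rw [d.add_matrixExpect_columnGaussian_eq_tildeCx _ hS, ← hA'] at h
      exact h
    · have h := LinearModel.isOptimalR_iff hCx hCw hνx' hνw' gX
        (finiteScaleEntropy_invWishart pA' hγx)
      rw [d.add_matrixExpect_columnGaussian_eq_tildeCw _ hS, ← hB'] at h
      exact h
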